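/- Let $\Bbbk$ be a commutative ring. Chain complexes are unbounded complexes of $\Bbbk$-modules with differential $d$ of degree $-1$; maps are homogeneous linear maps, and the Koszul sign rule is used throughout. Let $\mathcal{C}$ be a cooperad, i.e. a (coassociative, counital) comonoid in the monoidal category of symmetric sequences $\{\mathcal{C}(n)\}_{n\ge 0}$ of chain complexes with the composition product, and let $\mathcal{C}[A]=\bigoplus_n \mathcal{C}(n)\otimes_{\Sigma_n}A^{\otimes n}$ be its Schur functor, a comonad. A $\mathcal{C}$-coalgebra is a coalgebra $\Delta_A\colon A\to\mathcal{C}[A]$ over this comonad. **Definitions.** * A contraction consists of chain complexes $A,B$ and maps $f\colon A\to B$, $g\colon B\to A$, $h\colon A\to A$ of degrees $0,0,1$ such that $f,g$ are chain maps, $dh+hd=gf-1_A$, $fg=1_B$, $fh=0$, $hh=0$, $hg=0$. It is filtered if $A$ and $B$ carry increasing, exhaustive, bounded below ($F_p=0$ for some $p$) filtrations by subcomplexes that are preserved by $f,g,h$. * A thick map $\mathbf{F}\colon A\to B$ of degree $e$ is a sequence of maps $F_n\colon A^{\otimes n}\to B^{\otimes n}$, $n\ge 0$, of degree $e$. It is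 symmetric if each $F_n$ is $\Sigma_n$-equivariant, and it then induces $\mathcal{C}[\mathbf{F}]=\bigoplus_n 1\otimes F_n\colon \mathcal{C}[A]\to\mathcal{C}[B]$. A thick map of $\mathcal{C}$-coalgebras is a symmetric thick map with $\Delta_B F_1=\mathcal{C}[\mathbf{F}]\Delta_A$. A degree $0$ chain map $f$ is a morphism of $\mathcal{C}$-coalgebras if $(f^{\otimes n})_n$ is a thick map of $\mathcal{C}$-coalgebras, and a map $t\colon A\to A$ is a coderivation if $\big(\sum_{i+1+j=n}1^{\otimes i}\otimes t\otimes 1^{\otimes j}\big)_n$ is one. * A thick contraction of $\mathcal{C}$-coalgebras consists of $\mathcal{C}$-coalgebras $A,B$ and thick maps of $\mathcal{C}$-coalgebras $\mathbf{F}\colon A\to B$, $\mathbf{G}\colon B\to A$, $\mathbf{H}\colon A\to A$ such that for every $n\ge 0$ the maps $F_n,G_n,H_n$ form a contraction of $A^{\otimes n}$ onto $B^{\otimes n}$, $F_n=F_1^{\otimes n}$, $G_n=G_1^{\otimes n}$, and $\mathbf{H}$ is a pseudo-derivation: for all $p,q\ge 0$, $$(H_p\otimes 1-1\otimes H_q)H_{p+q}=-H_{p+q}(H_p\otimes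 1-1\otimes H_q)=H_p\otimes H_q.$$ * A filtered contraction of $\mathcal{C}$-coalgebras is a filtered contraction $(f,g,h)$ of $\mathcal{C}$-coalgebras $A$, $B$ for which there is a thick contraction of $\mathcal{C}$-coalgebras with $F_1=f$, $G_1=g$, $H_1=h$ such that $F_n,G_n,H_n$ preserve the induced filtrations of $A^{\otimes n}$ and $B^{\otimes n}$ for all $n\ge 0$; the $p$-th level of the induced filtration is the sum of the images of $F_{i_1}\otimes\cdots\otimes F_{i_n}$ with $i_1+\cdots+i_n=p$. **Theorem ($\mathcal{C}$-coalgebra Perturbation Lemma).** Let $(f,g,h)$ be a filtered contraction of $\mathcal{C}$-coalgebras of $A$ onto $B$, and let $t\colon A\to A$ be a perturbation (a map of degree $-1$ with $(d_A+t)^2=0$) that is a coderivation of $\mathcal{C}$-coalgebras and lowers the filtration, $t(F_pA)\subseteq F_{p-1}A$ for all $p$. Then $1-ht$ is invertible, and $\Sigma=t(1-ht)^{-1}$ is given by the pointwise finite sum $\sum_{m\ge 0}t(ht)^m$. Put $$f'=f+f\Sigma h,\qquad g'=g+h\Sigma g,\qquad h'=h+h\Sigma h,\qquad t'=f\Sigma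 g.$$ Then $t'$ is a perturbation of $B$, and $(f',g',h')$ is, with the same filtrations and the same structure maps $\Delta_A,\Delta_B$, a filtered contraction of $\mathcal{C}$-coalgebras of $(A,d_A+t)$ onto $(B,d_B+t')$. Moreover $f'$ and $g'$ are morphisms of $\mathcal{C}$-coalgebras between $(A,d_A+t)$ and $(B,d_B+t')$, and $t'$ is a coderivation of the $\mathcal{C}$-coalgebra $B$. -/

import Mathlib

open scoped TensorProduct DirectSum

universe u

noncomputable section

/-- A `ℤ`-graded module over `k`: a module that is the internal direct sum of submodules
`gr i`, `i : ℤ`. -/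
structure GrMod (k : Type u) [CommRing k] where
  carrier : Type u
  [grp : AddCommGroup carrier]
  [mod : Module k carrier]
  gr : ℤ → Submodule k carrier
  [dec : DirectSum.Decomposition gr]

attribute [instance] GrMod.grp GrMod.mod GrMod.dec

instance (k : Type u) [CommRing k] : CoeSort (GrMod k) (Type u) := ⟨GrMod.carrier⟩

/-- The linear map `f` is homogeneous of degree `e`. -/
def HasDegree {k : Type u} [CommRing k] (A B : GrMod k) (e : ℤ) (f : A →ₗ[k] B) : Prop :=
  ∀ i, ∀ a ∈ A.gr i, f a ∈ B.gr (i + e)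

namespace GrMod

variable {k : Type u} [CommRing k]

/-- The linear map that is multiplication by `c i` on the component of degree `i`. -/
def scale (A : GrMod k) (c : ℤ → ℤ) : A →ₗ[k] A :=
  DirectSum.toModule k ℤ A (fun i => c i • (A.gr i).subtype) ∘ₗ
    (DirectSum.decomposeLinearEquiv A.gr).toLinearMap

theorem scale_of_mem (A : GrMod k) (c : ℤ → ℤ) {i : ℤ} {a : A} (ha : a ∈ A.gr i) :
    A.scale c a = c i • a := by
  lift a to A.gr i using ha
  simp [scale]

/-- The projection onto the component of degree `i`. -/
def proj (A : GrMod k) (i : ℤ) : A →ₗ[k] A := A.scale (fun j => if j = i then 1 else 0)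

/-- The map `a ↦ (-1) ^ (e * |a|) • a` (the sign picked up when a map of degree `e` is moved
past `a`). -/
def sg (A : GrMod k) (e : ℤ) : A →ₗ[k] A := A.scale (fun i => (Int.negOnePow (e * i) : ℤˣ))

/-- The projection onto the odd part (`b = true`) or the even part (`b = false`). -/
def par (A : GrMod k) (b : Bool) : A →ₗ[k] A :=
  A.scale (fun i => if decide (Odd i) = b then 1 else 0)

/-- All homogeneous components at once. -/
def coact (A : GrMod k) : A →ₗ[k] (ℤ →₀ A) :=
  DirectSum.toModule k ℤ _ (fun i => Finsupp.lsingle i ∘ₗ (A.gr i).subtype) ∘ₗ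
    (DirectSum.decomposeLinearEquiv A.gr).toLinearMap

theorem coact_of_mem (A : GrMod k) {i : ℤ} {a : A} (ha : a ∈ A.gr i) :
    A.coact a = Finsupp.single i a := by
  lift a to A.gr i using ha
  simp [coact]

theorem hom_ind (A : GrMod k) {p : A → Prop} (h0 : p 0) (hh : ∀ i, ∀ a ∈ A.gr i, p a)
    (ha : ∀ a b, p a → p b → p (a + b)) (a : A) : p a :=
  DirectSum.Decomposition.inductionOn A.gr h0 (fun {i} m => hh i m m.2) ha a

theorem lin_ext (A : GrMod k) {M : Type*} [AddCommMonoid M] [Module k M] {f g : A →ₗ[k] M}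
    (h : ∀ i, ∀ a ∈ A.gr i, f a = g a) : f = g := by
  ext a
  induction a using A.hom_ind with
  | h0 => simp
  | hh i a ha => exact h i a ha
  | ha a b h1 h2 => simp [h1, h2]

theorem coact_mem (A : GrMod k) (a : A) (i : ℤ) : A.coact a i ∈ A.gr i := by
  induction a using A.hom_ind with
  | h0 => simp
  | hh j a ha =>
    rw [A.coact_of_mem ha, Finsupp.single_apply]
    split_ifs with h
    · exact h ▸ ha
    · exact zero_mem _
  | ha a b h1 h2 => simpa using add_mem h1 h2

theorem coact_sum (A : GrMod k) (a : A) : Finsupp.lsum k (fun _ => (LinearMap.id : A →ₗ[k] A)) (A.coact a) = a := by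
  induction a using A.hom_ind with
  | h0 => simp
  | hh j a ha => simp [A.coact_of_mem ha]
  | ha a b h1 h2 => rw [map_add, map_add, h1, h2]

/-- A family of submodules that spans, together with a compatible linear map to the families of
components, is a decomposition. -/
@[reducible]
def decOf {M : Type u} [AddCommGroup M] [Module k M] (gr : ℤ → Submodule k M)
    (r : M →ₗ[k] (ℤ →₀ M)) (h2 : ⨆ i, gr i = ⊤)
    (h3 : ∀ i, ∀ m ∈ gr i, r m = Finsupp.single i m) : DirectSum.Decomposition gr :=
  DirectSum.IsInternal.chooseDecomposition (ℳ := gr) <| by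
    classical
    have key : ∀ x : ⨁ i, gr i, ∀ i, r (DirectSum.coeLinearMap gr x) i = x i := by
      intro x i
      induction x using DirectSum.induction_on with
      | zero => simp
      | of j y =>
        rw [← DirectSum.lof_eq_of k, DirectSum.coeLinearMap_lof, h3 j y y.2, Finsupp.single_apply]
        split_ifs with h
        · subst h; simp [DirectSum.lof_eq_of]
        · rw [DirectSum.lof_eq_of, DirectSum.of_eq_of_ne _ _ _ (fun e => h e.symm)]; simp
      | add x y hx hy => simp [hx, hy]
    constructor
    · intro x y hxy
      ext i
      rw [← key x i, ← key y i]
      exact congrArg (fun z => r z i) hxy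
    · intro m
      have hm : m ∈ LinearMap.range (DirectSum.coeLinearMap gr) := by
        rw [DirectSum.range_coeLinearMap, h2]; trivial
      exact hm

/-- The tensor product of graded modules. -/
@[reducible]
def tensor (A B : GrMod k) : GrMod k where
  carrier := A ⊗[k] B
  gr m := Submodule.span k {z | ∃ i j, ∃ a ∈ A.gr i, ∃ b ∈ B.gr j, i + j = m ∧ a ⊗ₜ[k] b = z}
  dec := by
    classical
    refine decOf _ (Finsupp.lmapDomain _ k (fun p : ℤ × ℤ => p.1 + p.2) ∘ₗ
      (finsuppTensorFinsupp k k A B ℤ ℤ).toLinearMap ∘ₗ TensorProduct.map A.coact B.coact) ?_ ?_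
    · rw [eq_top_iff]
      rintro x -
      induction x using TensorProduct.induction_on with
      | zero => exact zero_mem _
      | add x y hx hy => exact add_mem hx hy
      | tmul a b =>
        induction a using A.hom_ind with
        | h0 => simp
        | ha a b h1 h2 => rw [TensorProduct.add_tmul]; exact add_mem h1 h2
        | hh i a ha =>
          induction b using B.hom_ind with
          | h0 => simp
          | ha a b h1 h2 => rw [TensorProduct.tmul_add]; exact add_mem h1 h2
          | hh j b hb =>
            exact Submodule.mem_iSup_of_mem (i + j)
              (Submodule.subset_span ⟨i, j, a, ha, b, hb, rfl, rfl⟩)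
    · intro m x hx
      induction hx using Submodule.span_induction with
      | zero => simp
      | add x y _ _ hx hy => rw [map_add, hx, hy, Finsupp.single_add]
      | smul c x _ hx => rw [map_smul, hx, Finsupp.smul_single]
      | mem x hx =>
        obtain ⟨i, j, a, ha, b, hb, rfl, rfl⟩ := hx
        simp [A.coact_of_mem ha, B.coact_of_mem hb, Finsupp.mapDomain_single]

theorem tprod_span {n : ℕ} (X : Fin n → GrMod k) :
    Submodule.span k {z : ⨂[k] i, X i | ∃ (deg : Fin n → ℤ) (x : ∀ i, X i),
      (∀ i, x i ∈ (X i).gr (deg i)) ∧ PiTensorProduct.tprod k x = z} = ⊤ := by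
  classical
  rw [eq_top_iff, ← PiTensorProduct.span_tprod_eq_top, Submodule.span_le]
  suffices H : ∀ (s : Finset (Fin n)) (x : ∀ i, X i) (deg : Fin n → ℤ),
      (∀ i ∉ s, x i ∈ (X i).gr (deg i)) → PiTensorProduct.tprod k x ∈
        Submodule.span k {z : ⨂[k] i, X i | ∃ (deg : Fin n → ℤ) (x : ∀ i, X i),
          (∀ i, x i ∈ (X i).gr (deg i)) ∧ PiTensorProduct.tprod k x = z} by
    rintro _ ⟨x, rfl⟩
    exact H Finset.univ x 0 (by simp)
  intro s
  induction s using Finset.induction_on with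
  | empty => exact fun x deg h => Submodule.subset_span ⟨deg, x, fun i => h i (by simp), rfl⟩
  | insert j s hj ih =>
    intro x deg h
    have : ∀ a : X j, PiTensorProduct.tprod k (Function.update x j a) ∈
        Submodule.span k {z : ⨂[k] i, X i | ∃ (deg : Fin n → ℤ) (x : ∀ i, X i),
          (∀ i, x i ∈ (X i).gr (deg i)) ∧ PiTensorProduct.tprod k x = z} := by
      intro a
      induction a using (X j).hom_ind with
      | h0 => rw [MultilinearMap.map_update_zero]; exact zero_mem _
      | ha a b h1 h2 => rw [MultilinearMap.map_update_add]; exact add_mem h1 h2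
      | hh d a ha =>
        refine ih _ (Function.update deg j d) fun i hi => ?_
        by_cases hij : i = j
        · subst hij; simpa using ha
        · simpa [hij] using h i (by simp [hij, hi])
    simpa using this (x j)

theorem pi_ext {n : ℕ} {X : Fin n → GrMod k} {M : Type*} [AddCommMonoid M] [Module k M]
    {f g : (⨂[k] i, X i) →ₗ[k] M}
    (h : ∀ (deg : Fin n → ℤ) (x : ∀ i, X i), (∀ i, x i ∈ (X i).gr (deg i)) →
      f (PiTensorProduct.tprod k x) = g (PiTensorProduct.tprod k x)) : f = g := by
  refine LinearMap.ext_on (tprod_span X) ?_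
  rintro _ ⟨deg, x, hx, rfl⟩
  exact h deg x hx

/-- The tensor product of a finite sequence of graded modules. -/
@[reducible]
def pi {n : ℕ} (X : Fin n → GrMod k) : GrMod k where
  carrier := ⨂[k] i, X i
  gr m := Submodule.span k {z | ∃ (deg : Fin n → ℤ) (x : ∀ i, X i),
    (∀ i, x i ∈ (X i).gr (deg i)) ∧ ∑ i, deg i = m ∧ PiTensorProduct.tprod k x = z}
  dec := by
    classical
    refine decOf _ (Finsupp.lmapDomain _ k (fun p : Fin n → ℤ => ∑ i, p i) ∘ₗ
      (PiTensorProduct.ofFinsuppEquiv (R := k) (κ := fun _ : Fin n => ℤ)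
        (M := fun i => X i)).toLinearMap ∘ₗ PiTensorProduct.map (fun i => (X i).coact)) ?_ ?_
    · rw [eq_top_iff, ← tprod_span, Submodule.span_le]
      rintro _ ⟨deg, x, hx, rfl⟩
      exact Submodule.mem_iSup_of_mem (∑ i, deg i)
        (Submodule.subset_span ⟨deg, x, hx, rfl, rfl⟩)
    · intro m x hx
      induction hx using Submodule.span_induction with
      | zero => simp
      | add x y _ _ hx hy => rw [map_add, hx, hy, Finsupp.single_add]
      | smul c x _ hx => rw [map_smul, hx, Finsupp.smul_single]
      | mem x hx =>
        obtain ⟨deg, x, hx, rfl, rfl⟩ := hx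
        have : (fun i => (X i).coact (x i)) = fun i => Finsupp.single (deg i) (x i) :=
          funext fun i => (X i).coact_of_mem (hx i)
        simp [this, Finsupp.mapDomain_single]

/-- The direct sum of graded modules. -/
@[reducible]
def directSum {ι : Type} (X : ι → GrMod k) : GrMod k where
  carrier := ⨁ i, X i
  gr m := ⨅ i, ((X i).gr m).comap (DirectSum.component k ι (fun i => X i) i)
  dec := by
    classical
    refine decOf _ (DirectSum.toModule k ι _ fun i =>
      Finsupp.mapRange.linearMap (DirectSum.lof k ι (fun i => X i) i) ∘ₗ (X i).coact) ?_ ?_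
    · rw [eq_top_iff]
      rintro x -
      induction x using DirectSum.induction_on with
      | zero => exact zero_mem _
      | add x y hx hy => exact add_mem hx hy
      | of i a =>
        induction a using (X i).hom_ind with
        | h0 => simp
        | ha a b h1 h2 => rw [map_add]; exact add_mem h1 h2
        | hh m a ha =>
          refine Submodule.mem_iSup_of_mem m ?_
          simp only [Submodule.mem_iInf, Submodule.mem_comap]
          intro j
          by_cases hij : i = j
          · subst hij
            rw [← DirectSum.lof_eq_of k, DirectSum.component.lof_self]; exact ha
          · rw [← DirectSum.lof_eq_of k, DirectSum.component.of, dif_neg hij]; exact zero_mem _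
    · intro m x hx
      simp only [Submodule.mem_iInf, Submodule.mem_comap] at hx
      have key : x = ∑ i ∈ DFinsupp.support x, DirectSum.lof k ι (fun i => X i) i (x i) :=
        (DirectSum.sum_support_of x).symm
      rw [key, map_sum, ← Finsupp.lsingle_apply (R := k), map_sum]
      refine Finset.sum_congr rfl fun i _ => ?_
      rw [DirectSum.toModule_lof, LinearMap.comp_apply, (X i).coact_of_mem (show x i ∈ _ from hx i)]
      simp

/-- The quotient of a graded module by the span of all `T g a - a`, where the maps `T g` preserve
degrees. -/
@[reducible]
def coinv {G : Type} (A : GrMod k) (T : G → A →ₗ[k] A) (hT : ∀ g, HasDegree A A 0 (T g)) :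
    GrMod k where
  carrier := A ⧸ ⨆ g, LinearMap.range (T g - LinearMap.id)
  gr i := (A.gr i).map (Submodule.mkQ _)
  dec := by
    have hc : ∀ g a, A.coact (T g a) = Finsupp.mapRange.linearMap (T g) (A.coact a) := by
      intro g a
      refine LinearMap.congr_fun (f := A.coact ∘ₗ T g)
        (g := Finsupp.mapRange.linearMap (T g) ∘ₗ A.coact) (A.lin_ext fun i a ha => ?_) a
      have := hT g i a ha
      rw [add_zero] at this
      simp [A.coact_of_mem this, A.coact_of_mem ha]
    refine decOf _ (Submodule.liftQ _
      (Finsupp.mapRange.linearMap (Submodule.mkQ _) ∘ₗ A.coact) ?_) ?_ ?_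
    · refine iSup_le fun g => ?_
      rintro _ ⟨a, rfl⟩
      simp only [LinearMap.mem_ker, LinearMap.comp_apply, LinearMap.sub_apply, LinearMap.id_apply,
        map_sub, hc]
      ext i
      simp only [Finsupp.mapRange.linearMap_apply, Finsupp.sub_apply, Finsupp.mapRange_apply,
        Finsupp.zero_apply, ← map_sub]
      refine (Submodule.Quotient.mk_eq_zero _).2 (Submodule.mem_iSup_of_mem g ⟨A.coact a i, ?_⟩)
      simp
    · rw [← Submodule.map_iSup, DirectSum.Decomposition.isInternal A.gr |>.submodule_iSup_eq_top,
        Submodule.map_top, Submodule.range_mkQ]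
    · rintro i _ ⟨a, ha, rfl⟩
      simp [A.coact_of_mem ha]

/-- `(f ⊗ g) (a ⊗ b) = (-1) ^ (|g| |a|) f a ⊗ g b`, where `e` is the degree of `g`. -/
def tmap {A A' B B' : GrMod k} (f : A →ₗ[k] A') (e : ℤ) (g : B →ₗ[k] B') :
    A ⊗[k] B →ₗ[k] A' ⊗[k] B' :=
  TensorProduct.map (f ∘ₗ A.sg e) g

/-- The Koszul sign of the permutation `s` of `n` factors of degrees `deg`: one factor `-1` for
every inversion of `s` whose two members both have odd degree (`o i` says that the `i`-th factor is
odd). -/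
def ksign {n : ℕ} (s : Equiv.Perm (Fin n)) (o : Fin n → Bool) : ℤ :=
  ∏ i, ∏ j, if i < j ∧ s j < s i ∧ o i ∧ o j then -1 else 1

/-- The action of permutations on tensor products, with Koszul signs:
`x₁ ⊗ ⋯ ⊗ xₙ` is sent to `± y₁ ⊗ ⋯ ⊗ yₙ` with `y (s i) = x i`. -/
def koszul {n : ℕ} (s : Equiv.Perm (Fin n)) (X : Fin n → GrMod k) :
    (⨂[k] i, X i) →ₗ[k] ⨂[k] i, X (s.symm i) :=
  ∑ o : Fin n → Bool, (ksign s o : k) •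
    ((PiTensorProduct.reindex k (fun i => X i) s).toLinearMap ∘ₗ
      PiTensorProduct.map (fun i => (X i).par (o i)))

/-- `∑ 1 ⊗ ⋯ ⊗ t i ⊗ ⋯ ⊗ 1` for maps `t i` of degree `e`, with Koszul signs. -/
def piDer {n : ℕ} (X : Fin n → GrMod k) (e : ℤ) (t : ∀ i, X i →ₗ[k] X i) :
    (⨂[k] i, X i) →ₗ[k] ⨂[k] i, X i :=
  ∑ i, PiTensorProduct.map
    (fun j => if j < i then (X j).sg e else if j = i then t j else LinearMap.id)

theorem par_of_mem (A : GrMod k) (b : Bool) {i : ℤ} {a : A} (ha : a ∈ A.gr i) :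
    A.par b a = if decide (Odd i) = b then a else 0 := by
  rw [par, A.scale_of_mem _ ha]; split_ifs <;> simp

theorem sg_of_mem (A : GrMod k) (e : ℤ) {i : ℤ} {a : A} (ha : a ∈ A.gr i) :
    A.sg e a = (Int.negOnePow (e * i) : ℤ) • a := by
  rw [sg, A.scale_of_mem _ ha]

theorem koszul_tprod {n : ℕ} (s : Equiv.Perm (Fin n)) (X : Fin n → GrMod k) {deg : Fin n → ℤ}
    {x : ∀ i, X i} (hx : ∀ i, x i ∈ (X i).gr (deg i)) :
    koszul s X (PiTensorProduct.tprod k x) = (ksign s (fun i => decide (Odd (deg i))) : k) •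
      PiTensorProduct.tprod k (fun i => x (s.symm i)) := by
  rw [koszul, LinearMap.sum_apply, Finset.sum_eq_single (fun i => decide (Odd (deg i)))]
  · simp only [LinearMap.smul_apply, LinearMap.comp_apply, PiTensorProduct.map_tprod,
      LinearEquiv.coe_coe]
    rw [show (fun i => (X i).par (decide (Odd (deg i))) (x i)) = x from
      funext fun i => by simp [(X i).par_of_mem _ (hx i)], PiTensorProduct.reindex_tprod]
  · intro o _ ho
    obtain ⟨i, hi⟩ := Function.ne_iff.1 ho
    simp only [LinearMap.smul_apply, LinearMap.comp_apply, PiTensorProduct.map_tprod]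
    rw [(PiTensorProduct.tprod k).map_coord_zero i]
    · simp
    · rw [(X i).par_of_mem _ (hx i), if_neg (fun h => hi h.symm)]
  · simp

theorem degree_pi {n : ℕ} {X : Fin n → GrMod k} {B : GrMod k} {e : ℤ}
    {f : (⨂[k] i, X i) →ₗ[k] B}
    (h : ∀ (deg : Fin n → ℤ) (x : ∀ i, X i), (∀ i, x i ∈ (X i).gr (deg i)) →
      f (PiTensorProduct.tprod k x) ∈ B.gr (∑ i, deg i + e)) : HasDegree (pi X) B e f := by
  intro m z hz
  induction hz using Submodule.span_induction with
  | zero => simp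
  | add x y _ _ hx hy => rw [map_add]; exact add_mem hx hy
  | smul c x _ hx => rw [map_smul]; exact Submodule.smul_mem _ _ hx
  | mem z hz =>
    obtain ⟨deg, x, hx, rfl, rfl⟩ := hz
    exact h deg x hx

theorem tprod_mem {n : ℕ} {X : Fin n → GrMod k} {deg : Fin n → ℤ} {x : ∀ i, X i}
    (hx : ∀ i, x i ∈ (X i).gr (deg i)) {m : ℤ} (hm : ∑ i, deg i = m) :
    PiTensorProduct.tprod k x ∈ (pi X).gr m :=
  Submodule.subset_span ⟨deg, x, hx, hm, rfl⟩

theorem degree_koszul {n : ℕ} (s : Equiv.Perm (Fin n)) (X : Fin n → GrMod k) :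
    HasDegree (pi X) (pi fun i => X (s.symm i)) 0 (koszul s X) := by
  refine degree_pi fun deg x hx => ?_
  rw [koszul_tprod s X hx]
  refine Submodule.smul_mem _ _ (tprod_mem (fun i => hx (s.symm i)) ?_)
  rw [add_zero]
  exact Equiv.sum_comp s.symm deg

theorem degree_map {n : ℕ} {X Y : Fin n → GrMod k} {f : ∀ i, X i →ₗ[k] Y i}
    (hf : ∀ i, HasDegree (X i) (Y i) 0 (f i)) :
    HasDegree (pi X) (pi Y) 0 (PiTensorProduct.map f) := by
  refine degree_pi fun deg x hx => ?_
  rw [PiTensorProduct.map_tprod]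
  exact tprod_mem (fun i => hf i _ _ (hx i)) (by simp)

theorem koszul_map {n : ℕ} (s : Equiv.Perm (Fin n)) {X Y : Fin n → GrMod k}
    {f : ∀ i, X i →ₗ[k] Y i} (hf : ∀ i, HasDegree (X i) (Y i) 0 (f i)) :
    koszul s Y ∘ₗ PiTensorProduct.map f =
      PiTensorProduct.map (fun i => f (s.symm i)) ∘ₗ koszul s X := by
  refine pi_ext fun deg x hx => ?_
  have hf' : ∀ i, f i (x i) ∈ (Y i).gr (deg i) := fun i => by simpa using hf i _ _ (hx i)
  simp only [LinearMap.comp_apply, PiTensorProduct.map_tprod, koszul_tprod s X hx,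
    koszul_tprod s Y hf', map_smul]

theorem degree_piDer {n : ℕ} {X : Fin n → GrMod k} {e : ℤ} {t : ∀ i, X i →ₗ[k] X i}
    (ht : ∀ i, HasDegree (X i) (X i) e (t i)) : HasDegree (pi X) (pi X) e (piDer X e t) := by
  refine degree_pi fun deg x hx => ?_
  rw [piDer, LinearMap.sum_apply]
  refine sum_mem fun i _ => ?_
  rw [PiTensorProduct.map_tprod]
  refine tprod_mem (deg := fun j => deg j + if j = i then e else 0) (fun j => ?_) ?_
  · rcases lt_trichotomy j i with h | h | h
    · rw [if_pos h, if_neg h.ne, (X j).sg_of_mem e (hx j), add_zero]; exact zsmul_mem (hx j) _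
    · subst h; simpa using ht j _ _ (hx j)
    · rw [if_neg h.not_gt, if_neg h.ne', if_neg h.ne', add_zero]; exact hx j
  · simp [Finset.sum_add_distrib]

theorem ksign_sq {n : ℕ} (s : Equiv.Perm (Fin n)) (o : Fin n → Bool) :
    ksign s o * ksign s o = 1 := by
  rw [ksign, ← Finset.prod_mul_distrib]
  refine Finset.prod_eq_one fun i _ => ?_
  rw [← Finset.prod_mul_distrib]
  refine Finset.prod_eq_one fun j _ => ?_
  split_ifs <;> rfl

theorem ksign_flip {n : ℕ} (s : Equiv.Perm (Fin n)) (o : Fin n → Bool) (i : Fin n) :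
    ksign s o * ksign s (Function.update o i (!o i)) =
      (∏ j, if j < i ∧ o j then -1 else 1) * ∏ j, if s j < s i ∧ o j then -1 else 1 := by
  have h1 : ksign s o * ksign s (Function.update o i (!o i)) =
      ∏ a, ∏ b, ((if a = i then (if i < b ∧ s b < s i ∧ o b then -1 else 1) else 1) *
        (if b = i then (if a < i ∧ s i < s a ∧ o a then -1 else 1) else 1)) := by
    rw [ksign, ksign, ← Finset.prod_mul_distrib]
    refine Finset.prod_congr rfl fun a _ => ?_
    rw [← Finset.prod_mul_distrib]
    refine Finset.prod_congr rfl fun b _ => ?_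
    by_cases ha : a = i
    · subst ha
      by_cases hb : b = a
      · subst hb; simp
      · rw [Function.update_self, Function.update_of_ne hb, if_pos rfl, if_neg hb]
        cases o a <;> simp
    · by_cases hb : b = i
      · subst hb
        rw [Function.update_self, Function.update_of_ne ha, if_pos rfl, if_neg ha]
        cases o b <;> simp
      · rw [Function.update_of_ne hb, Function.update_of_ne ha, if_neg ha, if_neg hb]
        split_ifs <;> rfl
  rw [h1]
  simp only [Finset.prod_mul_distrib, Finset.prod_ite_eq', Finset.mem_univ, if_true]
  rw [Finset.prod_comm]
  simp only [Finset.prod_ite_eq', Finset.mem_univ, if_true]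
  rw [← Finset.prod_mul_distrib, ← Finset.prod_mul_distrib]
  refine Finset.prod_congr rfl fun b _ => ?_
  rcases lt_trichotomy b i with h | h | h
  · rcases lt_trichotomy (s b) (s i) with h' | h' | h'
    · cases o b <;> simp [h, h', h.not_gt, h'.not_gt]
    · exact absurd (s.injective h') h.ne
    · cases o b <;> simp [h, h', h.not_gt, h'.not_gt]
  · subst h; simp
  · rcases lt_trichotomy (s b) (s i) with h' | h' | h'
    · cases o b <;> simp [h, h', h.not_gt, h'.not_gt]
    · exact absurd (s.injective h') h.ne'
    · cases o b <;> simp [h, h', h.not_gt, h'.not_gt]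

theorem negOnePow_neg_one_mul (i : ℤ) :
    ((Int.negOnePow (-1 * i) : ℤˣ) : ℤ) = if decide (Odd i) then -1 else 1 := by
  by_cases h : Odd i
  · rw [Int.negOnePow_odd _ (by simpa using h)]; simp [h]
  · rw [Int.negOnePow_even _ (by simpa using h)]; simp [h]

theorem piDer_term {n : ℕ} {X : Fin n → GrMod k} {t : ∀ i, X i →ₗ[k] X i}
    {deg : Fin n → ℤ} {x : ∀ i, X i} (hx : ∀ i, x i ∈ (X i).gr (deg i)) (i : Fin n) :
    PiTensorProduct.map
      (fun j => if j < i then (X j).sg (-1) else if j = i then t j else LinearMap.id)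
      (PiTensorProduct.tprod k x) =
    ((∏ j, if j < i ∧ decide (Odd (deg j)) then -1 else 1 : ℤ) : k) •
      PiTensorProduct.tprod k (Function.update x i (t i (x i))) := by
  rw [PiTensorProduct.map_tprod, Int.cast_prod, ← MultilinearMap.map_smul_univ]
  congr 1
  funext j
  rcases lt_trichotomy j i with h | h | h
  · rw [if_pos h, (X j).sg_of_mem _ (hx j), Function.update_of_ne h.ne, negOnePow_neg_one_mul]
    simp [h]
  · subst h; simp
  · simp [h.not_gt, h.ne']

theorem koszul_piDer {n : ℕ} (s : Equiv.Perm (Fin n)) {X : Fin n → GrMod k}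
    {t : ∀ i, X i →ₗ[k] X i} (ht : ∀ i, HasDegree (X i) (X i) (-1) (t i)) :
    koszul s X ∘ₗ piDer X (-1) t =
      piDer (fun i => X (s.symm i)) (-1) (fun i => t (s.symm i)) ∘ₗ koszul s X := by
  refine pi_ext fun deg x hx => ?_
  simp only [LinearMap.comp_apply]
  rw [koszul_tprod s X hx, map_smul, piDer, piDer, LinearMap.sum_apply, LinearMap.sum_apply,
    map_sum, Finset.smul_sum, ← Equiv.sum_comp s.symm]
  refine Finset.sum_congr rfl fun i _ => ?_
  rw [piDer_term hx, piDer_term (fun i => hx (s.symm i)), map_smul,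
    koszul_tprod s X (deg := Function.update deg (s.symm i) (deg (s.symm i) + -1))]
  · rw [smul_smul, smul_smul, ← Int.cast_mul, ← Int.cast_mul]
    congr 1
    · congr 1
      set o : Fin n → Bool := fun j => decide (Odd (deg j)) with ho
      have hu : (fun j => decide (Odd (Function.update deg (s.symm i) (deg (s.symm i) + -1) j))) =
          Function.update o (s.symm i) (!o (s.symm i)) := by
        funext j
        by_cases hj : j = s.symm i
        · subst hj
          rw [Function.update_self, Function.update_self, ho]
          by_cases h : Odd (deg (s.symm i))
          · have : ¬ Odd (deg (s.symm i) + -1) := by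
              rw [Int.not_odd_iff_even]; exact h.add_odd (by decide)
            simp [h, this]
          · have : Odd (deg (s.symm i) + -1) := by
              rw [Int.not_odd_iff_even] at h; exact h.add_odd (by decide)
            simp only [h, this]; rfl
        · rw [Function.update_of_ne hj, Function.update_of_ne hj]
      rw [hu]
      have h1 := ksign_flip s o (s.symm i)
      have h2 := ksign_sq s o
      have h3 : (∏ j, if s j < s (s.symm i) ∧ o j then (-1 : ℤ) else 1) =
          ∏ j, if j < i ∧ o (s.symm j) then (-1 : ℤ) else 1 := by
        rw [← Equiv.prod_comp s.symm]; simp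
      have h4 : (∏ j, if j < s.symm i ∧ o j then (-1 : ℤ) else 1) *
          (∏ j, if j < s.symm i ∧ o j then (-1 : ℤ) else 1) = 1 := by
        rw [← Finset.prod_mul_distrib]
        exact Finset.prod_eq_one fun j _ => by split_ifs <;> rfl
      rw [h3] at h1
      change _ * _ = _ * ∏ j, if j < i ∧ o (s.symm j) then (-1 : ℤ) else 1
      generalize ksign s o = a at *
      generalize ksign s (Function.update o (s.symm i) (!o (s.symm i))) = b at *
      generalize (∏ j, if j < s.symm i ∧ o j then (-1 : ℤ) else 1) = c at *
      generalize (∏ j, if j < i ∧ o (s.symm j) then (-1 : ℤ) else 1) = d at *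
      calc c * b = (a * b) * a * c := by linear_combination (-(c * b)) * h2
        _ = a * d := by rw [h1]; linear_combination (a * d) * h4
    · congr 1
      funext j
      by_cases hj : j = i
      · subst hj; simp
      · rw [Function.update_of_ne hj, Function.update_of_ne (fun h => hj (s.symm.injective h))]
  · intro j
    by_cases hj : j = s.symm i
    · subst hj; simpa using ht _ _ _ (hx _)
    · simpa [hj] using hx j

theorem map_piDer {n : ℕ} {X Y : Fin n → GrMod k} {t : ∀ i, X i →ₗ[k] X i}
    {t' : ∀ i, Y i →ₗ[k] Y i} {f : ∀ i, X i →ₗ[k] Y i}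
    (hf : ∀ i, HasDegree (X i) (Y i) 0 (f i)) (hc : ∀ i, f i ∘ₗ t i = t' i ∘ₗ f i) :
    PiTensorProduct.map f ∘ₗ piDer X (-1) t = piDer Y (-1) t' ∘ₗ PiTensorProduct.map f := by
  refine pi_ext fun deg x hx => ?_
  have hf' : ∀ i, f i (x i) ∈ (Y i).gr (deg i) := fun i => by simpa using hf i _ _ (hx i)
  simp only [LinearMap.comp_apply]
  rw [PiTensorProduct.map_tprod, piDer, piDer, LinearMap.sum_apply, LinearMap.sum_apply, map_sum]
  refine Finset.sum_congr rfl fun i _ => ?_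
  rw [piDer_term hx, piDer_term hf', map_smul, PiTensorProduct.map_tprod]
  congr 2
  funext j
  by_cases hj : j = i
  · subst hj; simpa using LinearMap.congr_fun (hc j) (x j)
  · rw [Function.update_of_ne hj, Function.update_of_ne hj]

theorem piDer_anti {n : ℕ} {X : Fin n → GrMod k} {t : ∀ i, X i →ₗ[k] X i}
    (ht : ∀ i, HasDegree (X i) (X i) (-1) (t i)) {i j : Fin n} (hij : j < i) :
    (PiTensorProduct.map
        (fun l => if l < j then (X l).sg (-1) else if l = j then t l else LinearMap.id)) ∘ₗ
      (PiTensorProduct.map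
        (fun l => if l < i then (X l).sg (-1) else if l = i then t l else LinearMap.id)) =
    -((PiTensorProduct.map
        (fun l => if l < i then (X l).sg (-1) else if l = i then t l else LinearMap.id)) ∘ₗ
      (PiTensorProduct.map
        (fun l => if l < j then (X l).sg (-1) else if l = j then t l else LinearMap.id))) := by
  refine pi_ext fun deg x hx => ?_
  simp only [LinearMap.neg_apply, LinearMap.comp_apply, PiTensorProduct.map_tprod]
  generalize hu : (fun l => (if l < i then (X l).sg (-1) else if l = i then t l else LinearMap.id)
    ((if l < j then (X l).sg (-1) else if l = j then t l else LinearMap.id) (x l))) = u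
  have hneg : -(PiTensorProduct.tprod k) u =
      PiTensorProduct.tprod k (Function.update u j (-u j)) := by
    rw [MultilinearMap.map_update_neg, Function.update_eq_self]
  rw [hneg]
  congr 1
  funext l
  rw [← hu]
  by_cases hl : l = j
  · subst hl
    have h1 : t l (x l) ∈ (X l).gr (deg l + -1) := ht l _ _ (hx l)
    simp only [hij, if_true, lt_irrefl, if_false, Function.update_self]
    rw [(X l).sg_of_mem _ (hx l), (X l).sg_of_mem _ h1, map_zsmul,
      show -1 * (deg l + -1) = -1 * deg l + 1 by ring, Int.negOnePow_succ]
    simp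
  · rw [Function.update_of_ne hl]
    by_cases h1 : l < j
    · simp [h1, h1.trans hij]
    · by_cases h2 : l = i
      · subst h2; simp [h1, hl]
      · simp [h1, hl]

theorem piDer_sq {n : ℕ} {X : Fin n → GrMod k} {t : ∀ i, X i →ₗ[k] X i}
    (ht : ∀ i, HasDegree (X i) (X i) (-1) (t i)) (h0 : ∀ i, t i ∘ₗ t i = 0) :
    piDer X (-1) t ∘ₗ piDer X (-1) t = 0 := by
  let D : Fin n → (⨂[k] i, X i) →ₗ[k] ⨂[k] i, X i := fun i => PiTensorProduct.map
    (fun l => if l < i then (X l).sg (-1) else if l = i then t l else LinearMap.id)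
  have hD : piDer X (-1) t = ∑ i, D i := rfl
  have h1 : ∀ i, D i ∘ₗ D i = 0 := by
    intro i
    refine LinearMap.ext_on (PiTensorProduct.span_tprod_eq_top) ?_
    rintro _ ⟨x, rfl⟩
    simp only [D, LinearMap.comp_apply, PiTensorProduct.map_tprod, LinearMap.zero_apply]
    refine (PiTensorProduct.tprod k).map_coord_zero i ?_
    simpa using LinearMap.congr_fun (h0 i) (x i)
  rw [hD]
  change (∑ i, D i) * (∑ i, D i) = 0
  rw [Finset.sum_mul_sum, ← Finset.sum_product']
  refine Finset.sum_involution (fun p _ => (p.2, p.1)) ?_ ?_ (by simp) (by simp)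
  · rintro ⟨i, j⟩ _
    rcases lt_trichotomy i j with h | h | h
    · have := piDer_anti ht h
      change D i ∘ₗ D j + D j ∘ₗ D i = 0
      rw [show D i ∘ₗ D j = -(D j ∘ₗ D i) from this, neg_add_cancel]
    · subst h
      change D i ∘ₗ D i + D i ∘ₗ D i = 0
      rw [h1, add_zero]
    · have := piDer_anti ht h
      change D i ∘ₗ D j + D j ∘ₗ D i = 0
      rw [show D j ∘ₗ D i = -(D i ∘ₗ D j) from this, add_neg_cancel]
  · rintro ⟨i, j⟩ _ hne heq
    obtain rfl : j = i := congrArg Prod.fst heq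
    exact hne (h1 j)

theorem degree_tensor {A B C : GrMod k} {e : ℤ} {f : A ⊗[k] B →ₗ[k] C}
    (h : ∀ i j, ∀ a ∈ A.gr i, ∀ b ∈ B.gr j, f (a ⊗ₜ b) ∈ C.gr (i + j + e)) :
    HasDegree (tensor A B) C e f := by
  intro m z hz
  induction hz using Submodule.span_induction with
  | zero => simp
  | add x y _ _ hx hy => rw [map_add]; exact add_mem hx hy
  | smul c x _ hx => rw [map_smul]; exact Submodule.smul_mem _ _ hx
  | mem z hz =>
    obtain ⟨i, j, a, ha, b, hb, rfl, rfl⟩ := hz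
    exact h i j a ha b hb

theorem tmul_mem {A B : GrMod k} {i j m : ℤ} {a : A} {b : B} (ha : a ∈ A.gr i) (hb : b ∈ B.gr j)
    (hm : i + j = m) : a ⊗ₜ[k] b ∈ (tensor A B).gr m :=
  Submodule.subset_span ⟨i, j, a, ha, b, hb, hm, rfl⟩

theorem degree_tensorMap {A A' B B' : GrMod k} {f : A →ₗ[k] A'} {g : B →ₗ[k] B'}
    (hf : HasDegree A A' 0 f) (hg : HasDegree B B' 0 g) :
    HasDegree (tensor A B) (tensor A' B') 0 (TensorProduct.map f g) :=
  degree_tensor fun i j a ha b hb =>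
    tmul_mem (hf i a ha) (hg j b hb) (by ring)

theorem tensor_ext {A B : GrMod k} {M : Type*} [AddCommMonoid M] [Module k M]
    {f g : A ⊗[k] B →ₗ[k] M}
    (h : ∀ i j, ∀ a ∈ A.gr i, ∀ b ∈ B.gr j, f (a ⊗ₜ b) = g (a ⊗ₜ b)) : f = g := by
  refine TensorProduct.ext (A.lin_ext fun i a ha => B.lin_ext fun j b hb => h i j a ha b hb)

/-- The inclusion of a summand. -/
def inj {ι : Type} [DecidableEq ι] (X : ι → GrMod k) (i : ι) : X i →ₗ[k] directSum X :=
  DirectSum.lof k ι (fun i => X i) i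

/-- The map out of a direct sum defined by its values on the summands. -/
def desc {ι : Type} [DecidableEq ι] {X : ι → GrMod k} {M : Type u} [AddCommGroup M] [Module k M]
    (f : ∀ i, X i →ₗ[k] M) : directSum X →ₗ[k] M :=
  DirectSum.toModule k ι M f

theorem desc_inj {ι : Type} [DecidableEq ι] {X : ι → GrMod k} {M : Type u} [AddCommGroup M]
    [Module k M] (f : ∀ i, X i →ₗ[k] M) (i : ι) (x : X i) : desc f (inj X i x) = f i x :=
  DirectSum.toModule_lof (R := k) (M := fun i => (X i).carrier) (φ := f) i x

theorem directSum_ext {ι : Type} [DecidableEq ι] {X : ι → GrMod k} {M : Type u} [AddCommGroup M]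
    [Module k M] {f g : directSum X →ₗ[k] M} (h : ∀ i x, f (inj X i x) = g (inj X i x)) : f = g :=
  DirectSum.linearMap_ext k fun i => LinearMap.ext fun x => h i x

theorem inj_mem {ι : Type} [DecidableEq ι] {X : ι → GrMod k} {i : ι} {m : ℤ} {a : X i}
    (ha : a ∈ (X i).gr m) : inj X i a ∈ (directSum X).gr m := by
  simp only [Submodule.mem_iInf, Submodule.mem_comap, inj]
  intro j
  by_cases hij : i = j
  · subst hij
    rw [DirectSum.component.lof_self]; exact ha
  · rw [DirectSum.component.of, dif_neg hij]; exact zero_mem _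

theorem degree_directSum {ι : Type} [DecidableEq ι] {X : ι → GrMod k} {B : GrMod k} {e : ℤ}
    {f : directSum X →ₗ[k] B} (h : ∀ i, HasDegree (X i) B e (f ∘ₗ inj X i)) :
    HasDegree (directSum X) B e f := by
  classical
  intro m x hx
  simp only [Submodule.mem_iInf, Submodule.mem_comap] at hx
  have key : x = ∑ i ∈ DFinsupp.support x, inj X i (x i) := (DirectSum.sum_support_of x).symm
  rw [key, map_sum]
  exact sum_mem fun i _ => h i m _ (hx i)

/-- The direct sum of linear maps. -/
def dmap {ι : Type} [DecidableEq ι] {X Y : ι → GrMod k} (f : ∀ i, X i →ₗ[k] Y i) :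
    directSum X →ₗ[k] directSum Y :=
  desc fun i => inj Y i ∘ₗ f i

theorem dmap_inj {ι : Type} [DecidableEq ι] {X Y : ι → GrMod k} (f : ∀ i, X i →ₗ[k] Y i) (i : ι)
    (x : X i) : dmap f (inj X i x) = inj Y i (f i x) :=
  desc_inj _ i x

theorem degree_dmap {ι : Type} [DecidableEq ι] {X Y : ι → GrMod k} {f : ∀ i, X i →ₗ[k] Y i}
    {e : ℤ} (h : ∀ i, HasDegree (X i) (Y i) e (f i)) :
    HasDegree (directSum X) (directSum Y) e (dmap f) :=
  degree_directSum fun i m a ha => by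
    rw [LinearMap.comp_apply, dmap_inj]; exact inj_mem (h i m a ha)

/-- The projection to the quotient. -/
def coinvMk {G : Type} (A : GrMod k) (T : G → A →ₗ[k] A) (hT : ∀ g, HasDegree A A 0 (T g)) :
    A →ₗ[k] coinv A T hT :=
  Submodule.mkQ _

theorem coinv_ext {G : Type} {A : GrMod k} {T : G → A →ₗ[k] A} {hT : ∀ g, HasDegree A A 0 (T g)}
    {M : Type u} [AddCommGroup M] [Module k M] {f g : coinv A T hT →ₗ[k] M}
    (h : ∀ x, f (coinvMk A T hT x) = g (coinvMk A T hT x)) : f = g :=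
  Submodule.linearMap_qext _ (LinearMap.ext h)

theorem coinvMk_mem {G : Type} {A : GrMod k} {T : G → A →ₗ[k] A}
    {hT : ∀ g, HasDegree A A 0 (T g)} {i : ℤ} {a : A} (ha : a ∈ A.gr i) :
    coinvMk A T hT a ∈ (coinv A T hT).gr i :=
  ⟨a, ha, rfl⟩

/-- The map induced on quotients by a map compatible with the operators. -/
def coinvMap {G : Type} {A B : GrMod k} {T : G → A →ₗ[k] A} {hT : ∀ g, HasDegree A A 0 (T g)}
    {T' : G → B →ₗ[k] B} {hT' : ∀ g, HasDegree B B 0 (T' g)} (f : A →ₗ[k] B)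
    (hf : ∀ g, f ∘ₗ T g = T' g ∘ₗ f) : coinv A T hT →ₗ[k] coinv B T' hT' :=
  Submodule.mapQ _ _ f <| by
    refine iSup_le fun g => ?_
    rintro _ ⟨a, rfl⟩
    refine Submodule.mem_iSup_of_mem g ⟨f a, ?_⟩
    have := LinearMap.congr_fun (hf g) a
    simp only [LinearMap.comp_apply] at this
    simp [this]

theorem coinvMap_mk {G : Type} {A B : GrMod k} {T : G → A →ₗ[k] A}
    {hT : ∀ g, HasDegree A A 0 (T g)} {T' : G → B →ₗ[k] B} {hT' : ∀ g, HasDegree B B 0 (T' g)}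
    (f : A →ₗ[k] B) (hf : ∀ g, f ∘ₗ T g = T' g ∘ₗ f) (a : A) :
    coinvMap (hT := hT) (hT' := hT') f hf (coinvMk A T hT a) = coinvMk B T' hT' (f a) := rfl

theorem degree_coinvMap {G : Type} {A B : GrMod k} {T : G → A →ₗ[k] A}
    {hT : ∀ g, HasDegree A A 0 (T g)}
    {T' : G → B →ₗ[k] B} {hT' : ∀ g, HasDegree B B 0 (T' g)} {f : A →ₗ[k] B}
    {hf : ∀ g, f ∘ₗ T g = T' g ∘ₗ f} {e : ℤ} (h : HasDegree A B e f) :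
    HasDegree (coinv A T hT) (coinv B T' hT') e (coinvMap f hf) := by
  rintro i _ ⟨a, ha, rfl⟩
  exact ⟨f a, h i a ha, rfl⟩

end GrMod

/-- A chain complex of `k`-modules, indexed by all integers, with differential of degree `-1`. -/
structure Cx (k : Type u) [CommRing k] extends GrMod k where
  d : carrier →ₗ[k] carrier
  d_mem : HasDegree toGrMod toGrMod (-1) d
  d_d : d ∘ₗ d = 0

namespace Cx

variable {k : Type u} [CommRing k]

/-- The tensor product of chain complexes. -/
@[reducible]
def tensor (A B : Cx k) : Cx k where
  toGrMod := GrMod.tensor A.toGrMod B.toGrMod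
  d := TensorProduct.map A.d LinearMap.id +
    GrMod.tmap (LinearMap.id : A.carrier →ₗ[k] A.carrier) (-1) B.d
  d_mem := GrMod.degree_tensor fun i j a ha b hb => by
    refine add_mem (GrMod.tmul_mem (A.d_mem i a ha) hb (by ring))
      (GrMod.tmul_mem (j := j + -1) (i := i) ?_ (B.d_mem j b hb) (by ring))
    rw [LinearMap.id_comp, A.sg_of_mem _ ha]
    exact zsmul_mem ha _
  d_d := GrMod.tensor_ext fun i j a ha b hb => by
    have h1 := LinearMap.congr_fun A.d_d a
    have h2 := LinearMap.congr_fun B.d_d b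
    simp only [LinearMap.comp_apply, LinearMap.zero_apply] at h1 h2
    simp only [GrMod.tmap, LinearMap.comp_apply, LinearMap.add_apply, TensorProduct.map_tmul,
      LinearMap.id_apply, map_add, A.sg_of_mem _ ha, A.sg_of_mem _ (A.d_mem i a ha), map_zsmul,
      h1, h2, LinearMap.zero_apply]
    rw [show -1 * (i + -1) = -1 * i + 1 by ring, Int.negOnePow_succ]
    simp [TensorProduct.neg_tmul]

/-- The tensor product of a finite sequence of chain complexes. -/
@[reducible]
def pi {n : ℕ} (X : Fin n → Cx k) : Cx k where
  toGrMod := GrMod.pi fun i => (X i).toGrMod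
  d := GrMod.piDer (fun i => (X i).toGrMod) (-1) fun i => (X i).d
  d_mem := GrMod.degree_piDer fun i => (X i).d_mem
  d_d := GrMod.piDer_sq (fun i => (X i).d_mem) fun i => (X i).d_d

/-- The direct sum of chain complexes. -/
@[reducible]
def directSum {ι : Type} [DecidableEq ι] (X : ι → Cx k) : Cx k where
  toGrMod := GrMod.directSum fun i => (X i).toGrMod
  d := GrMod.dmap fun i => (X i).d
  d_mem := GrMod.degree_dmap fun i => (X i).d_mem
  d_d := GrMod.directSum_ext fun i x => by
    have h := LinearMap.congr_fun (X i).d_d x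
    simp only [LinearMap.comp_apply, LinearMap.zero_apply] at h
    rw [LinearMap.comp_apply, GrMod.dmap_inj, GrMod.dmap_inj, h, map_zero]
    rfl

/-- The quotient of a chain complex by the span of all `T g a - a`, where the `T g` are chain
maps. -/
@[reducible]
def coinv {G : Type} (A : Cx k) (T : G → A.carrier →ₗ[k] A.carrier)
    (hT : ∀ g, HasDegree A.toGrMod A.toGrMod 0 (T g)) (hd : ∀ g, A.d ∘ₗ T g = T g ∘ₗ A.d) :
    Cx k where
  toGrMod := GrMod.coinv A.toGrMod T hT
  d := GrMod.coinvMap A.d hd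
  d_mem := GrMod.degree_coinvMap A.d_mem
  d_d := by
    refine GrMod.coinv_ext fun a => ?_
    have h := LinearMap.congr_fun A.d_d a
    simp only [LinearMap.comp_apply, LinearMap.zero_apply] at h
    rw [LinearMap.comp_apply, GrMod.coinvMap_mk, GrMod.coinvMap_mk, h, map_zero]
    rfl

/-- The ground ring, in degree zero. -/
@[reducible]
def ground (k : Type u) [CommRing k] : Cx k where
  carrier := k
  gr i := if i = 0 then ⊤ else ⊥
  dec := GrMod.decOf _ (Finsupp.lsingle 0)
    (eq_top_iff.2 fun x _ => Submodule.mem_iSup_of_mem 0 (by simp))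
    (fun i m hm => by
      by_cases h : i = 0
      · subst h; rfl
      · rw [if_neg h, Submodule.mem_bot] at hm; subst hm; simp)
  d := 0
  d_mem _ _ _ := zero_mem _
  d_d := rfl

/-- The zero complex. -/
@[reducible]
def zero (k : Type u) [CommRing k] : Cx k where
  carrier := PUnit
  gr _ := ⊤
  dec := GrMod.decOf _ 0 (Subsingleton.elim _ _)
    (fun i m _ => by cases m; exact (Finsupp.single_zero i).symm)
  d := 0
  d_mem _ _ _ := zero_mem _
  d_d := rfl

theorem tensor_d_map {A A' B B' : Cx k} {f : A.carrier →ₗ[k] A'.carrier}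
    {g : B.carrier →ₗ[k] B'.carrier} (hf : HasDegree A.toGrMod A'.toGrMod 0 f)
    (hfd : A'.d ∘ₗ f = f ∘ₗ A.d) (hgd : B'.d ∘ₗ g = g ∘ₗ B.d) :
    (tensor A' B').d ∘ₗ TensorProduct.map f g = TensorProduct.map f g ∘ₗ (tensor A B).d := by
  refine GrMod.tensor_ext fun i j a ha b hb => ?_
  have h1 := LinearMap.congr_fun hfd a
  have h2 := LinearMap.congr_fun hgd b
  have h3 := hf i a ha
  rw [add_zero] at h3
  simp only [LinearMap.comp_apply] at h1 h2
  simp only [tensor, GrMod.tmap, LinearMap.comp_apply, LinearMap.add_apply, TensorProduct.map_tmul,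
    LinearMap.id_apply, map_add, A.sg_of_mem _ ha, A'.sg_of_mem _ h3, map_zsmul, h1, h2]

end Cx

/-- A symmetric sequence: chain complexes `obj n`, `n ≥ 0`, with an action of the symmetric group on
`n` letters by chain maps. -/
structure SymSeq (k : Type u) [CommRing k] where
  obj : ℕ → Cx k
  act : ∀ n, Representation k (Equiv.Perm (Fin n)) (obj n).carrier
  act_mem : ∀ n s, HasDegree (obj n).toGrMod (obj n).toGrMod 0 (act n s)
  act_d : ∀ n s, (obj n).d ∘ₗ act n s = act n s ∘ₗ (obj n).d

/-- The fibre of a map over a point. -/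
abbrev Fiber {S T : Type} (p : S → T) (t : T) : Type := {i // p i = t}

namespace SymSeq

variable {k : Type u} [CommRing k]

/-- Transport along an equality of arities. -/
def cast (P : SymSeq k) {m n : ℕ} (h : m = n) : (P.obj m).carrier →ₗ[k] (P.obj n).carrier :=
  match h with
  | rfl => LinearMap.id

/-- A symmetric sequence as a functor on the groupoid of the sets `Fin n` and their bijections. -/
def map (P : SymSeq k) {m n : ℕ} (e : Fin m ≃ Fin n) :
    (P.obj m).carrier →ₗ[k] (P.obj n).carrier :=
  P.act n ((finCongr (Fin.equiv_iff_eq.1 ⟨e⟩)).symm.trans e) ∘ₗ P.cast (Fin.equiv_iff_eq.1 ⟨e⟩)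

theorem map_perm (P : SymSeq k) {n : ℕ} (e : Equiv.Perm (Fin n)) : P.map e = P.act n e := rfl

theorem map_trans (P : SymSeq k) {l m n : ℕ} (e : Fin l ≃ Fin m) (e' : Fin m ≃ Fin n) :
    P.map (e.trans e') = P.map e' ∘ₗ P.map e := by
  obtain rfl : l = m := Fin.equiv_iff_eq.1 ⟨e⟩
  obtain rfl : l = n := Fin.equiv_iff_eq.1 ⟨e'⟩
  rw [map_perm, map_perm, map_perm]
  exact map_mul (P.act l) e' e

theorem map_refl (P : SymSeq k) (n : ℕ) : P.map (Equiv.refl (Fin n)) = LinearMap.id := by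
  rw [map_perm]; exact map_one (P.act n)

theorem map_mem (P : SymSeq k) {m n : ℕ} (e : Fin m ≃ Fin n) :
    HasDegree (P.obj m).toGrMod (P.obj n).toGrMod 0 (P.map e) := by
  obtain rfl : m = n := Fin.equiv_iff_eq.1 ⟨e⟩
  exact P.act_mem m e

theorem map_d (P : SymSeq k) {m n : ℕ} (e : Fin m ≃ Fin n) :
    (P.obj n).d ∘ₗ P.map e = P.map e ∘ₗ (P.obj m).d := by
  obtain rfl : m = n := Fin.equiv_iff_eq.1 ⟨e⟩
  exact P.act_d m e

/-- The value of a symmetric sequence at an arbitrary finite set, by means of a chosen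
enumeration. -/
@[reducible]
def on (P : SymSeq k) (S : Type) [Finite S] : Cx k := P.obj (Nat.card S)

/-- Functoriality of `on` in bijections. -/
def onMap (P : SymSeq k) {S T : Type} [Finite S] [Finite T] (e : S ≃ T) :
    (P.on S).carrier →ₗ[k] (P.on T).carrier :=
  P.map ((Finite.equivFin S).symm.trans (e.trans (Finite.equivFin T)))

/-- The isomorphism from arity `r` to a finite set induced by an enumeration of the set. -/
def ofFin (P : SymSeq k) {S : Type} [Finite S] {r : ℕ} (e : Fin r ≃ S) :
    (P.obj r).carrier →ₗ[k] (P.on S).carrier :=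
  P.map (e.trans (Finite.equivFin S))

theorem onMap_trans (P : SymSeq k) {S T U : Type} [Finite S] [Finite T] [Finite U] (e : S ≃ T)
    (e' : T ≃ U) : P.onMap (e.trans e') = P.onMap e' ∘ₗ P.onMap e := by
  rw [onMap, onMap, onMap, ← map_trans]
  congr 1
  ext x
  simp

theorem onMap_refl (P : SymSeq k) (S : Type) [Finite S] :
    P.onMap (Equiv.refl S) = LinearMap.id := by
  rw [onMap, ← map_refl]
  congr 1
  ext x
  simp

/-- A morphism of symmetric sequences. -/
structure Hom (P Q : SymSeq k) where
  app : ∀ n, (P.obj n).carrier →ₗ[k] (Q.obj n).carrier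
  app_mem : ∀ n, HasDegree (P.obj n).toGrMod (Q.obj n).toGrMod 0 (app n)
  app_d : ∀ n, (Q.obj n).d ∘ₗ app n = app n ∘ₗ (P.obj n).d
  app_act : ∀ n s, app n ∘ₗ P.act n s = Q.act n s ∘ₗ app n

theorem Hom.app_map {P Q : SymSeq k} (f : Hom P Q) {m n : ℕ} (e : Fin m ≃ Fin n) :
    f.app n ∘ₗ P.map e = Q.map e ∘ₗ f.app m := by
  obtain rfl : m = n := Fin.equiv_iff_eq.1 ⟨e⟩
  exact f.app_act m e

/-- The identity morphism. -/
def Hom.id (P : SymSeq k) : Hom P P where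
  app _ := LinearMap.id
  app_mem n i a ha := by simpa using ha
  app_d _ := rfl
  app_act _ _ := rfl

/-! ### The composition product -/

/-- The arity `m` part of the `n`-th tensor power of `P`: the sum over all `p : Fin m → Fin n` of
`P (p⁻¹ 1) ⊗ ⋯ ⊗ P (p⁻¹ n)`. -/
@[reducible]
def pow (P : SymSeq k) (m n : ℕ) : Cx k :=
  Cx.directSum fun p : Fin m → Fin n => Cx.pi fun j => P.on (Fiber p j)

/-- The bijection of fibres `p⁻¹ (s⁻¹ j) ≃ (s ∘ p)⁻¹ j`. -/
def fiberOut {m n : ℕ} (p : Fin m → Fin n) (s : Equiv.Perm (Fin n)) (j : Fin n) :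
    Fiber p (s.symm j) ≃ Fiber (fun i => s (p i)) j :=
  Equiv.subtypeEquivRight fun _ => (Equiv.eq_symm_apply s)

/-- The bijection of fibres `p⁻¹ j ≃ (p ∘ s⁻¹)⁻¹ j` given by `s`. -/
def fiberIn {m n : ℕ} (p : Fin m → Fin n) (s : Equiv.Perm (Fin m)) (j : Fin n) :
    Fiber p j ≃ Fiber (fun i => p (s.symm i)) j :=
  s.subtypeEquiv fun i => by simp

/-- The inclusion of the summand of `pow P m n` indexed by `p`. -/
def inj (P : SymSeq k) {m n : ℕ} (p : Fin m → Fin n) :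
    (Cx.pi fun j => P.on (Fiber p j)).carrier →ₗ[k] (P.pow m n).carrier :=
  GrMod.inj (fun p : Fin m → Fin n => (Cx.pi fun j => P.on (Fiber p j)).toGrMod) p

theorem pow_ext {P : SymSeq k} {m n : ℕ} {M : Type u} [AddCommGroup M] [Module k M]
    {f g : (P.pow m n).carrier →ₗ[k] M} (h : ∀ p x, f (P.inj p x) = g (P.inj p x)) : f = g :=
  GrMod.directSum_ext h

theorem degree_pow {P : SymSeq k} {m n : ℕ} {B : GrMod k} {e : ℤ}
    {f : (P.pow m n).carrier →ₗ[k] B}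
    (h : ∀ p, HasDegree (Cx.pi fun j => P.on (Fiber p j)).toGrMod B e (f ∘ₗ P.inj p)) :
    HasDegree (P.pow m n).toGrMod B e f :=
  GrMod.degree_directSum h

theorem inj_mem (P : SymSeq k) {m n : ℕ} (p : Fin m → Fin n) {i : ℤ}
    {x : (Cx.pi fun j => P.on (Fiber p j)).carrier}
    (hx : x ∈ (Cx.pi fun j => P.on (Fiber p j)).gr i) : P.inj p x ∈ (P.pow m n).gr i :=
  GrMod.inj_mem hx

theorem d_inj (P : SymSeq k) {m n : ℕ} (p : Fin m → Fin n)
    (x : (Cx.pi fun j => P.on (Fiber p j)).carrier) :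
    (P.pow m n).d (P.inj p x) = P.inj p ((Cx.pi fun j => P.on (Fiber p j)).d x) :=
  GrMod.dmap_inj (X := fun p : Fin m → Fin n => (Cx.pi fun j => P.on (Fiber p j)).toGrMod)
    (Y := fun p : Fin m → Fin n => (Cx.pi fun j => P.on (Fiber p j)).toGrMod)
    (fun p => (Cx.pi fun j => P.on (Fiber p j)).d) p x

theorem map_map_apply {n : ℕ} {X Y Z : Fin n → Cx k}
    (f : ∀ i, (X i).carrier →ₗ[k] (Y i).carrier) (g : ∀ i, (Y i).carrier →ₗ[k] (Z i).carrier)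
    (x : (Cx.pi X).carrier) :
    PiTensorProduct.map g (PiTensorProduct.map f x) =
      PiTensorProduct.map (fun i => g i ∘ₗ f i) x :=
  (LinearMap.congr_fun (PiTensorProduct.map_comp g f) x).symm

/-- The action on `pow P m n` of the permutations of the `n` tensor factors. -/
def powOut (P : SymSeq k) (m : ℕ) {n : ℕ} (s : Equiv.Perm (Fin n)) :
    (P.pow m n).carrier →ₗ[k] (P.pow m n).carrier :=
  GrMod.desc fun p =>
    P.inj (fun i => s (p i)) ∘ₗ
    PiTensorProduct.map (fun j => P.onMap (fiberOut p s j)) ∘ₗ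
    GrMod.koszul s (fun j => (P.on (Fiber p j)).toGrMod)

theorem powOut_inj (P : SymSeq k) (m : ℕ) {n : ℕ} (s : Equiv.Perm (Fin n)) (p : Fin m → Fin n)
    (x : (Cx.pi fun j => P.on (Fiber p j)).carrier) :
    P.powOut m s (P.inj p x) = P.inj (fun i => s (p i))
      (PiTensorProduct.map (fun j => P.onMap (fiberOut p s j))
        (GrMod.koszul s (fun j => (P.on (Fiber p j)).toGrMod) x)) :=
  GrMod.desc_inj (X := fun p : Fin m → Fin n => (Cx.pi fun j => P.on (Fiber p j)).toGrMod)
    (fun p => P.inj (fun i => s (p i)) ∘ₗ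
    PiTensorProduct.map (fun j => P.onMap (fiberOut p s j)) ∘ₗ
    GrMod.koszul s (fun j => (P.on (Fiber p j)).toGrMod)) p x

/-- The action on `pow P m n` of the permutations of the `m` inputs. -/
def powIn (P : SymSeq k) {m : ℕ} (n : ℕ) (s : Equiv.Perm (Fin m)) :
    (P.pow m n).carrier →ₗ[k] (P.pow m n).carrier :=
  GrMod.desc fun p =>
    P.inj (fun i => p (s.symm i)) ∘ₗ PiTensorProduct.map (fun j => P.onMap (fiberIn p s j))

theorem powIn_inj (P : SymSeq k) {m : ℕ} (n : ℕ) (s : Equiv.Perm (Fin m)) (p : Fin m → Fin n)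
    (x : (Cx.pi fun j => P.on (Fiber p j)).carrier) :
    P.powIn n s (P.inj p x) = P.inj (fun i => p (s.symm i))
      (PiTensorProduct.map (fun j => P.onMap (fiberIn p s j)) x) :=
  GrMod.desc_inj (X := fun p : Fin m → Fin n => (Cx.pi fun j => P.on (Fiber p j)).toGrMod)
    (fun p => P.inj (fun i => p (s.symm i)) ∘ₗ
    PiTensorProduct.map (fun j => P.onMap (fiberIn p s j))) p x

/-- The map on tensor powers induced by a morphism. -/
def powMap {P Q : SymSeq k} (f : Hom P Q) (m n : ℕ) :
    (P.pow m n).carrier →ₗ[k] (Q.pow m n).carrier :=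
  GrMod.desc fun p =>
    Q.inj p ∘ₗ PiTensorProduct.map fun j => f.app (Nat.card (Fiber p j))

theorem powMap_inj {P Q : SymSeq k} (f : Hom P Q) (m n : ℕ) (p : Fin m → Fin n)
    (x : (Cx.pi fun j => P.on (Fiber p j)).carrier) :
    powMap f m n (P.inj p x) =
      Q.inj p (PiTensorProduct.map (fun j => f.app (Nat.card (Fiber p j))) x) :=
  GrMod.desc_inj (X := fun p : Fin m → Fin n => (Cx.pi fun j => P.on (Fiber p j)).toGrMod)
    (fun p => Q.inj p ∘ₗ
    PiTensorProduct.map fun j => f.app (Nat.card (Fiber p j))) p x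

theorem powOut_mem (P : SymSeq k) (m : ℕ) {n : ℕ} (s : Equiv.Perm (Fin n)) :
    HasDegree (P.pow m n).toGrMod (P.pow m n).toGrMod 0 (P.powOut m s) := by
  refine degree_pow fun p i a ha => ?_
  rw [LinearMap.comp_apply, powOut_inj]
  have h1 := GrMod.degree_koszul s (fun j => (P.on (Fiber p j)).toGrMod) i a ha
  have h2 := GrMod.degree_map (f := fun j => P.onMap (fiberOut p s j))
    (fun j => P.map_mem _) _ _ h1
  rw [add_zero] at h2
  exact P.inj_mem _ h2

theorem powIn_mem (P : SymSeq k) {m : ℕ} (n : ℕ) (s : Equiv.Perm (Fin m)) :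
    HasDegree (P.pow m n).toGrMod (P.pow m n).toGrMod 0 (P.powIn n s) := by
  refine degree_pow fun p i a ha => ?_
  rw [LinearMap.comp_apply, powIn_inj]
  exact P.inj_mem _ (GrMod.degree_map (f := fun j => P.onMap (fiberIn p s j))
    (fun j => P.map_mem _) _ _ ha)

theorem powMap_mem {P Q : SymSeq k} (f : Hom P Q) (m n : ℕ) :
    HasDegree (P.pow m n).toGrMod (Q.pow m n).toGrMod 0 (powMap f m n) := by
  refine degree_pow fun p i a ha => ?_
  rw [LinearMap.comp_apply, powMap_inj]
  exact Q.inj_mem _ (GrMod.degree_map (fun j => f.app_mem _) _ _ ha)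

theorem powOut_d (P : SymSeq k) (m : ℕ) {n : ℕ} (s : Equiv.Perm (Fin n)) :
    (P.pow m n).d ∘ₗ P.powOut m s = P.powOut m s ∘ₗ (P.pow m n).d := by
  refine pow_ext fun p x => ?_
  rw [LinearMap.comp_apply, LinearMap.comp_apply, d_inj, powOut_inj, powOut_inj, d_inj]
  have h1 := LinearMap.congr_fun (GrMod.koszul_piDer s (X := fun j => (P.on (Fiber p j)).toGrMod)
    (t := fun j => (P.on (Fiber p j)).d) fun j => (P.on (Fiber p j)).d_mem) x
  have h2 := LinearMap.congr_fun (GrMod.map_piDer (f := fun j => P.onMap (fiberOut p s j))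
    (t := fun j => (P.on (Fiber p (s.symm j))).d)
    (t' := fun j => (P.on (Fiber (fun i => s (p i)) j)).d)
    (fun j => P.map_mem _) (fun j => (P.map_d _).symm))
    (GrMod.koszul s (fun j => (P.on (Fiber p j)).toGrMod) x)
  exact congrArg (P.inj _) (h2.symm.trans (congrArg _ h1.symm))

theorem powIn_d (P : SymSeq k) {m : ℕ} (n : ℕ) (s : Equiv.Perm (Fin m)) :
    (P.pow m n).d ∘ₗ P.powIn n s = P.powIn n s ∘ₗ (P.pow m n).d := by
  refine pow_ext fun p x => ?_
  rw [LinearMap.comp_apply, LinearMap.comp_apply, d_inj, powIn_inj, powIn_inj, d_inj]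
  have h2 := LinearMap.congr_fun (GrMod.map_piDer (f := fun j => P.onMap (fiberIn p s j))
    (t := fun j => (P.on (Fiber p j)).d)
    (t' := fun j => (P.on (Fiber (fun i => p (s.symm i)) j)).d)
    (fun j => P.map_mem _) (fun j => (P.map_d _).symm)) x
  exact congrArg (P.inj _) h2.symm

theorem powMap_d {P Q : SymSeq k} (f : Hom P Q) (m n : ℕ) :
    (Q.pow m n).d ∘ₗ powMap f m n = powMap f m n ∘ₗ (P.pow m n).d := by
  refine pow_ext fun p x => ?_
  rw [LinearMap.comp_apply, LinearMap.comp_apply, d_inj, powMap_inj, powMap_inj, d_inj]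
  exact congrArg (Q.inj _) (LinearMap.congr_fun (GrMod.map_piDer (fun j => f.app_mem _)
    (fun j => (f.app_d _).symm)) x).symm

theorem powIn_powOut (P : SymSeq k) {m n : ℕ} (s : Equiv.Perm (Fin m)) (s' : Equiv.Perm (Fin n)) :
    P.powIn n s ∘ₗ P.powOut m s' = P.powOut m s' ∘ₗ P.powIn n s := by
  refine pow_ext fun p x => ?_
  rw [LinearMap.comp_apply, LinearMap.comp_apply, powIn_inj, powOut_inj, powIn_inj, powOut_inj]
  refine congrArg (P.inj _) ?_
  have h1 := LinearMap.congr_fun (GrMod.koszul_map s'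
    (f := fun j => P.onMap (fiberIn p s j)) (fun j => P.map_mem _)) x
  refine Eq.trans ?_ (congrArg _ h1.symm)
  rw [LinearMap.comp_apply, map_map_apply, map_map_apply]
  refine congrArg (fun f => PiTensorProduct.map f _) (funext fun j => ?_)
  rw [← onMap_trans, ← onMap_trans]
  rfl

theorem powMap_powOut {P Q : SymSeq k} (f : Hom P Q) (m : ℕ) {n : ℕ} (s : Equiv.Perm (Fin n)) :
    powMap f m n ∘ₗ P.powOut m s = Q.powOut m s ∘ₗ powMap f m n := by
  refine pow_ext fun p x => ?_
  rw [LinearMap.comp_apply, LinearMap.comp_apply, powMap_inj, powOut_inj, powMap_inj, powOut_inj]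
  refine congrArg (Q.inj _) ?_
  have h1 := LinearMap.congr_fun (GrMod.koszul_map s
    (f := fun j => f.app (Nat.card (Fiber p j))) (fun j => f.app_mem _)) x
  refine Eq.trans ?_ (congrArg _ h1.symm)
  rw [LinearMap.comp_apply, map_map_apply, map_map_apply]
  exact congrArg (fun f => PiTensorProduct.map f _) (funext fun j => f.app_map _)

theorem powMap_powIn {P Q : SymSeq k} (f : Hom P Q) {m : ℕ} (n : ℕ) (s : Equiv.Perm (Fin m)) :
    powMap f m n ∘ₗ P.powIn n s = Q.powIn n s ∘ₗ powMap f m n := by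
  refine pow_ext fun p x => ?_
  rw [LinearMap.comp_apply, LinearMap.comp_apply, powMap_inj, powIn_inj, powMap_inj, powIn_inj,
    map_map_apply, map_map_apply]
  exact congrArg (fun f => Q.inj _ (PiTensorProduct.map f _)) (funext fun j => f.app_map _)

theorem powIn_one (P : SymSeq k) (m n : ℕ) :
    P.powIn n (1 : Equiv.Perm (Fin m)) = LinearMap.id := by
  refine pow_ext fun p x => ?_
  rw [powIn_inj]
  have : (fun j => P.onMap (fiberIn p (1 : Equiv.Perm (Fin m)) j)) = fun j => LinearMap.id :=
    funext fun j => P.onMap_refl _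
  exact congrArg (P.inj p) ((congrArg (fun f => PiTensorProduct.map f x) this).trans
    (LinearMap.congr_fun PiTensorProduct.map_id x))

theorem powIn_mul (P : SymSeq k) {m : ℕ} (n : ℕ) (s s' : Equiv.Perm (Fin m)) :
    P.powIn n (s * s') = P.powIn n s ∘ₗ P.powIn n s' := by
  refine pow_ext fun p x => ?_
  rw [LinearMap.comp_apply, powIn_inj, powIn_inj, powIn_inj, map_map_apply]
  have : (fun j => P.onMap (fiberIn p (s * s') j)) = fun j =>
      P.onMap (fiberIn (fun i => p (s'.symm i)) s j) ∘ₗ P.onMap (fiberIn p s' j) :=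
    funext fun j => P.onMap_trans (fiberIn p s' j) (fiberIn (fun i => p (s'.symm i)) s j)
  exact congrArg (fun f => P.inj _ (PiTensorProduct.map f x)) this

theorem level_mem (O P : SymSeq k) (m n : ℕ) (s : Equiv.Perm (Fin n)) :
    HasDegree (Cx.tensor (O.obj n) (P.pow m n)).toGrMod (Cx.tensor (O.obj n) (P.pow m n)).toGrMod 0
      (TensorProduct.map (O.act n s) (P.powOut m s)) :=
  GrMod.degree_tensorMap (O.act_mem n s) (P.powOut_mem m s)

/-- The `n`-th summand `O n ⊗_{Σₙ} P^{⊗ n}`, in arity `m`, of the composition product. -/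
@[reducible]
def compLevel (O P : SymSeq k) (m n : ℕ) : Cx k :=
  Cx.coinv (Cx.tensor (O.obj n) (P.pow m n))
    (fun s : Equiv.Perm (Fin n) => TensorProduct.map (O.act n s) (P.powOut m s))
    (level_mem O P m n)
    (fun s => Cx.tensor_d_map (O.act_mem n s) (O.act_d n s) (P.powOut_d m s))

theorem compLevel_comm (O P : SymSeq k) {m n : ℕ} {f : (P.pow m n).carrier →ₗ[k] (P.pow m n).carrier}
    (hf : ∀ s : Equiv.Perm (Fin n), f ∘ₗ P.powOut m s = P.powOut m s ∘ₗ f)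
    (s : Equiv.Perm (Fin n)) :
    TensorProduct.map LinearMap.id f ∘ₗ TensorProduct.map (O.act n s) (P.powOut m s) =
      TensorProduct.map (O.act n s) (P.powOut m s) ∘ₗ TensorProduct.map LinearMap.id f := by
  rw [← TensorProduct.map_comp, ← TensorProduct.map_comp, hf]
  rfl

/-- The action of the permutations of the `m` inputs on `O n ⊗_{Σₙ} P^{⊗ n}`. -/
def levelAct (O P : SymSeq k) {m : ℕ} (s : Equiv.Perm (Fin m)) (n : ℕ) :
    (compLevel O P m n).carrier →ₗ[k] (compLevel O P m n).carrier :=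
  GrMod.coinvMap (hT := level_mem O P m n) (hT' := level_mem O P m n)
    (TensorProduct.map LinearMap.id (P.powIn n s))
    (compLevel_comm O P (P.powIn_powOut s))

theorem levelAct_one (O P : SymSeq k) (m n : ℕ) :
    levelAct O P (1 : Equiv.Perm (Fin m)) n = LinearMap.id := by
  refine GrMod.coinv_ext (hT := level_mem O P m n) fun y => ?_
  rw [levelAct, GrMod.coinvMap_mk, P.powIn_one, TensorProduct.map_id]; rfl

theorem levelAct_mul (O P : SymSeq k) {m : ℕ} (s s' : Equiv.Perm (Fin m)) (n : ℕ) :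
    levelAct O P (s * s') n = levelAct O P s n ∘ₗ levelAct O P s' n := by
  refine GrMod.coinv_ext (hT := level_mem O P m n) fun y => ?_
  rw [LinearMap.comp_apply, levelAct, levelAct, levelAct, GrMod.coinvMap_mk, GrMod.coinvMap_mk,
    GrMod.coinvMap_mk]
  refine congrArg _ ?_
  rw [← LinearMap.comp_apply, ← TensorProduct.map_comp, P.powIn_mul]
  rfl

theorem levelAct_mem (O P : SymSeq k) {m : ℕ} (s : Equiv.Perm (Fin m)) (n : ℕ) :
    HasDegree (compLevel O P m n).toGrMod (compLevel O P m n).toGrMod 0 (levelAct O P s n) :=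
  GrMod.degree_coinvMap (hT := level_mem O P m n) (hT' := level_mem O P m n)
    (GrMod.degree_tensorMap (A := (O.obj n).toGrMod) (A' := (O.obj n).toGrMod)
      (f := LinearMap.id) (fun i a ha => by simpa using ha) (P.powIn_mem n s))

theorem levelAct_d (O P : SymSeq k) {m : ℕ} (s : Equiv.Perm (Fin m)) (n : ℕ) :
    (compLevel O P m n).d ∘ₗ levelAct O P s n = levelAct O P s n ∘ₗ (compLevel O P m n).d := by
  refine GrMod.coinv_ext (hT := level_mem O P m n) fun y => ?_
  rw [LinearMap.comp_apply, LinearMap.comp_apply, levelAct, GrMod.coinvMap_mk,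
    GrMod.coinvMap_mk, GrMod.coinvMap_mk, GrMod.coinvMap_mk]
  exact congrArg _ (LinearMap.congr_fun (Cx.tensor_d_map (A := O.obj n) (A' := O.obj n)
    (f := LinearMap.id) (fun i a ha => by simpa using ha) rfl (P.powIn_d n s)) y)

/-- The composition product `O ∘ P = ⨁ₙ O n ⊗_{Σₙ} P^{⊗ n}`. -/
@[reducible]
def comp (O P : SymSeq k) : SymSeq k where
  obj m := Cx.directSum fun n : ℕ => compLevel O P m n
  act m :=
    { toFun := fun s => GrMod.dmap (X := fun n : ℕ => (compLevel O P m n).toGrMod)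
        (Y := fun n : ℕ => (compLevel O P m n).toGrMod) (levelAct O P s)
      map_one' := by
        refine GrMod.directSum_ext fun n x => ?_
        rw [GrMod.dmap_inj, levelAct_one]
        rfl
      map_mul' := fun s s' => by
        refine GrMod.directSum_ext fun n x => ?_
        rw [Module.End.mul_apply, GrMod.dmap_inj, GrMod.dmap_inj, GrMod.dmap_inj, levelAct_mul]
        rfl }
  act_mem m s := GrMod.degree_dmap (levelAct_mem O P s)
  act_d m s := GrMod.directSum_ext fun n x => by
    rw [LinearMap.comp_apply, LinearMap.comp_apply]
    change GrMod.dmap _ (GrMod.dmap _ _) = GrMod.dmap _ (GrMod.dmap _ _)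
    rw [GrMod.dmap_inj, GrMod.dmap_inj, GrMod.dmap_inj, GrMod.dmap_inj]
    exact congrArg _ (LinearMap.congr_fun (levelAct_d O P s n) x)

end SymSeq

namespace SymSeq

variable {k : Type u} [CommRing k]

/-- The element `c ⊗ (x 1 ⊗ ⋯ ⊗ x n)` of the composition product in the summand indexed by `p`. -/
def compMk (O P : SymSeq k) {m n : ℕ} (c : (O.obj n).carrier) (p : Fin m → Fin n)
    (x : ∀ j, (P.on (Fiber p j)).carrier) : ((comp O P).obj m).carrier :=
  GrMod.inj (fun n : ℕ => (compLevel O P m n).toGrMod) n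
    (GrMod.coinvMk _ _ (level_mem O P m n) (c ⊗ₜ[k] P.inj p (PiTensorProduct.tprod k x)))

/-- The map `f ∘ g` on composition products induced by morphisms `f` and `g`. -/
def compMap {O O' P P' : SymSeq k} (f : Hom O O') (g : Hom P P') (m : ℕ) :
    ((comp O P).obj m).carrier →ₗ[k] ((comp O' P').obj m).carrier :=
  GrMod.dmap (X := fun n : ℕ => (compLevel O P m n).toGrMod)
    (Y := fun n : ℕ => (compLevel O' P' m n).toGrMod) fun n =>
    GrMod.coinvMap (hT := level_mem O P m n) (hT' := level_mem O' P' m n)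
      (TensorProduct.map (f.app n) (powMap g m n)) fun s => by
        rw [← TensorProduct.map_comp, ← TensorProduct.map_comp, f.app_act, powMap_powOut]

/-- The unit symmetric sequence: the ground ring in arity one and degree zero. -/
@[reducible]
def one (k : Type u) [CommRing k] : SymSeq k where
  obj
    | 1 => Cx.ground k
    | _ => Cx.zero k
  act _ := 1
  act_mem _ _ i a ha := by rw [add_zero]; exact ha
  act_d _ _ := rfl

/-- The generator of the unit symmetric sequence. -/
def oneElt (k : Type u) [CommRing k] : ((one k).obj 1).carrier := (1 : k)

/-- The sign of the rearrangement
`p 1 ⊗ ⋯ ⊗ p n ⊗ q 1 ⊗ ⋯ ⊗ q m ↦ p 1 ⊗ (q i, φ i = 1) ⊗ ⋯ ⊗ p n ⊗ (q i, φ i = n)`,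
where `p j` has degree `a j` and `q i` has degree `b i`. -/
def blockSign {m n : ℕ} (φ : Fin m → Fin n) (a : Fin n → ℤ) (b : Fin m → ℤ) : ℤ :=
  (∏ i, ∏ j, if φ i < j ∧ Odd (a j) ∧ Odd (b i) then -1 else 1) *
    ∏ i, ∏ i', if i < i' ∧ φ i' < φ i ∧ Odd (b i) ∧ Odd (b i') then -1 else 1

/-- For composable maps `ψ` and `φ` and an enumeration `e` of `φ⁻¹ j`, the map
`(φ ∘ ψ)⁻¹ j → φ⁻¹ j` induced by `ψ`, read through the enumerations. -/
def fiberMap {l m n r : ℕ} (ψ : Fin l → Fin m) (φ : Fin m → Fin n) {j : Fin n}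
    (e : Fin r ≃o Fiber φ j) (t : Fin (Nat.card (Fiber (fun i => φ (ψ i)) j))) : Fin r :=
  e.symm ⟨ψ ((Finite.equivFin (Fiber (fun i => φ (ψ i)) j)).symm t).1,
    ((Finite.equivFin (Fiber (fun i => φ (ψ i)) j)).symm t).2⟩

/-- The fibres of `fiberMap` are fibres of `ψ`. -/
def fiberMapEquiv {l m n r : ℕ} (ψ : Fin l → Fin m) (φ : Fin m → Fin n) {j : Fin n}
    (e : Fin r ≃o Fiber φ j) (i : Fin r) : Fiber ψ (e i).1 ≃ Fiber (fiberMap ψ φ e) i where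
  toFun x := ⟨Finite.equivFin _ ⟨x.1, (congrArg φ x.2).trans (e i).2⟩, by simp [fiberMap, x.2]⟩
  invFun t := ⟨((Finite.equivFin (Fiber (fun i => φ (ψ i)) j)).symm t.1).1, by
    have h := t.2
    rw [fiberMap, OrderIso.symm_apply_eq] at h
    exact congrArg Subtype.val h⟩
  left_inv x := by simp
  right_inv t := by simp

/-- The graph of the associativity isomorphism `(O ∘ P) ∘ Q ≅ O ∘ (P ∘ Q)` in arity `l`. -/
def assocGraph (O P Q : SymSeq k) (l : ℕ) : Submodule k
    (((comp (comp O P) Q).obj l).carrier × ((comp O (comp P Q)).obj l).carrier) :=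
  Submodule.span k {z | ∃ (n m : ℕ) (φ : Fin m → Fin n) (ψ : Fin l → Fin m) (r : Fin n → ℕ)
    (e : ∀ j, Fin (r j) ≃o Fiber φ j) (c : (O.obj n).carrier) (p : ∀ j, (P.obj (r j)).carrier)
    (q : ∀ i, (Q.on (Fiber ψ i)).carrier) (a : Fin n → ℤ) (b : Fin m → ℤ),
    (∀ j, p j ∈ (P.obj (r j)).gr (a j)) ∧ (∀ i, q i ∈ (Q.on (Fiber ψ i)).gr (b i)) ∧
    z = (compMk (comp O P) Q (compMk O P c φ fun j => P.ofFin (e j).toEquiv (p j)) ψ q,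
      (blockSign φ a b : k) • compMk O (comp P Q) c (fun i => φ (ψ i)) fun j =>
        compMk P Q (p j) (fiberMap ψ φ (e j)) fun i =>
          Q.onMap (fiberMapEquiv ψ φ (e j) i) (q (e j i).1))}

/-- The graph of the isomorphism `1 ∘ P ≅ P` in arity `m`. -/
def leftUnitGraph (P : SymSeq k) (m : ℕ) : Submodule k
    (((comp (one k) P).obj m).carrier × (P.obj m).carrier) :=
  Submodule.span k {z | ∃ p : (P.obj m).carrier,
    z = (compMk (n := 1) (one k) P (oneElt k) (fun _ => 0) fun j =>
      P.ofFin (Equiv.subtypeUnivEquiv fun _ => Subsingleton.elim _ j).symm p, p)}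

/-- The fibre of the identity map is a singleton. -/
def fiberId {m : ℕ} (j : Fin m) : Fin 1 ≃ Fiber (fun i : Fin m => i) j where
  toFun _ := ⟨j, rfl⟩
  invFun _ := 0
  left_inv _ := Subsingleton.elim _ _
  right_inv x := Subtype.ext x.2.symm

/-- The graph of the isomorphism `P ∘ 1 ≅ P` in arity `m`. -/
def rightUnitGraph (P : SymSeq k) (m : ℕ) : Submodule k
    (((comp P (one k)).obj m).carrier × (P.obj m).carrier) :=
  Submodule.span k {z | ∃ p : (P.obj m).carrier,
    z = (compMk P (one k) p (fun i => i) fun j =>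
      (one k).ofFin (fiberId j) (oneElt k), p)}

/-! ### Schur functors -/

theorem schur_mem (O : SymSeq k) (A : GrMod k) (n : ℕ) (s : Equiv.Perm (Fin n)) :
    HasDegree (GrMod.tensor (O.obj n).toGrMod (GrMod.pi fun _ : Fin n => A))
      (GrMod.tensor (O.obj n).toGrMod (GrMod.pi fun _ : Fin n => A)) 0
      (TensorProduct.map (O.act n s) (GrMod.koszul s fun _ => A)) :=
  GrMod.degree_tensorMap (O.act_mem n s) (GrMod.degree_koszul s fun _ => A)

/-- The `n`-th summand `O n ⊗_{Σₙ} A^{⊗ n}` of the Schur functor. -/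
@[reducible]
def schurLevel (O : SymSeq k) (A : GrMod k) (n : ℕ) : GrMod k :=
  GrMod.coinv (GrMod.tensor (O.obj n).toGrMod (GrMod.pi fun _ : Fin n => A))
    (fun s : Equiv.Perm (Fin n) => TensorProduct.map (O.act n s) (GrMod.koszul s fun _ => A))
    (schur_mem O A n)

/-- The graded module `O[A] = ⨁ₙ O n ⊗_{Σₙ} A^{⊗ n}`. -/
@[reducible]
def schurG (O : SymSeq k) (A : GrMod k) : GrMod k :=
  GrMod.directSum fun n : ℕ => schurLevel O A n

theorem koszul_d (A : Cx k) {n : ℕ} (s : Equiv.Perm (Fin n)) :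
    (Cx.pi fun _ : Fin n => A).d ∘ₗ GrMod.koszul s (fun _ => A.toGrMod) =
      GrMod.koszul s (fun _ => A.toGrMod) ∘ₗ (Cx.pi fun _ : Fin n => A).d :=
  (GrMod.koszul_piDer s (X := fun _ => A.toGrMod) (t := fun _ => A.d) fun _ => A.d_mem).symm

/-- The chain complex `O[A] = ⨁ₙ O n ⊗_{Σₙ} A^{⊗ n}`. -/
@[reducible]
def schur (O : SymSeq k) (A : Cx k) : Cx k :=
  Cx.directSum fun n : ℕ => Cx.coinv (Cx.tensor (O.obj n) (Cx.pi fun _ : Fin n => A))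
    (fun s : Equiv.Perm (Fin n) =>
      TensorProduct.map (O.act n s) (GrMod.koszul s fun _ => A.toGrMod))
    (schur_mem O A.toGrMod n)
    (fun s => Cx.tensor_d_map (O.act_mem n s) (O.act_d n s) (koszul_d A s))

/-- The element `c ⊗ (x 1 ⊗ ⋯ ⊗ x n)` of `O[A]`. -/
def schurMk (O : SymSeq k) (A : GrMod k) {n : ℕ} (c : (O.obj n).carrier) (x : Fin n → A) :
    schurG O A :=
  GrMod.inj (fun n : ℕ => schurLevel O A n) n
    (GrMod.coinvMk _ _ (schur_mem O A n) (c ⊗ₜ[k] PiTensorProduct.tprod k x))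

/-- The map `O[A] → P[A]` induced by a morphism `O → P`. -/
def schurHom {O P : SymSeq k} (f : Hom O P) (A : GrMod k) : schurG O A →ₗ[k] schurG P A :=
  GrMod.dmap (X := fun n : ℕ => schurLevel O A n) (Y := fun n : ℕ => schurLevel P A n) fun n =>
    GrMod.coinvMap (hT := schur_mem O A n) (hT' := schur_mem P A n)
      (TensorProduct.map (f.app n) LinearMap.id) fun s => by
        rw [← TensorProduct.map_comp, ← TensorProduct.map_comp, f.app_act]
        rfl

/-- The graph of the isomorphism `(O ∘ P)[A] ≅ O[P[A]]`. -/
def schurAssocGraph (O P : SymSeq k) (A : GrMod k) :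
    Submodule k (schurG (comp O P) A × schurG O (schurG P A)) :=
  Submodule.span k {z | ∃ (n m : ℕ) (φ : Fin m → Fin n) (r : Fin n → ℕ)
    (e : ∀ j, Fin (r j) ≃o Fiber φ j) (c : (O.obj n).carrier) (p : ∀ j, (P.obj (r j)).carrier)
    (x : Fin m → A) (a : Fin n → ℤ) (b : Fin m → ℤ),
    (∀ j, p j ∈ (P.obj (r j)).gr (a j)) ∧ (∀ i, x i ∈ A.gr (b i)) ∧
    z = (schurMk (comp O P) A (compMk O P c φ fun j => P.ofFin (e j).toEquiv (p j)) x,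
      (blockSign φ a b : k) • schurMk O (schurG P A) c fun j =>
        schurMk P A (p j) fun i => x (e j i).1)}

/-- The graph of the isomorphism `1[A] ≅ A`. -/
def schurUnitGraph (A : GrMod k) : Submodule k (schurG (one k) A × A) :=
  Submodule.span k {z | ∃ a : A, z = (schurMk (n := 1) (one k) A (oneElt k) fun _ => a, a)}

end SymSeq

/-- A cooperad: a comonoid in symmetric sequences with the composition product. -/
structure Cooperad (k : Type u) [CommRing k] extends SymSeq k where
  Δ : SymSeq.Hom toSymSeq (SymSeq.comp toSymSeq toSymSeq)
  ε : SymSeq.Hom toSymSeq (SymSeq.one k)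
  coassoc : ∀ n (x : (obj n).carrier),
    (SymSeq.compMap Δ (SymSeq.Hom.id toSymSeq) n (Δ.app n x),
      SymSeq.compMap (SymSeq.Hom.id toSymSeq) Δ n (Δ.app n x)) ∈
        SymSeq.assocGraph toSymSeq toSymSeq toSymSeq n
  counit_left : ∀ n (x : (obj n).carrier),
    (SymSeq.compMap ε (SymSeq.Hom.id toSymSeq) n (Δ.app n x), x) ∈
      SymSeq.leftUnitGraph toSymSeq n
  counit_right : ∀ n (x : (obj n).carrier),
    (SymSeq.compMap (SymSeq.Hom.id toSymSeq) ε n (Δ.app n x), x) ∈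
      SymSeq.rightUnitGraph toSymSeq n

/-! ### Thick maps -/

/-- A thick map of degree `e`: a sequence of maps `A^{⊗ n} → B^{⊗ n}`, `n ≥ 0`, of degree `e`. -/
structure ThickMap {k : Type u} [CommRing k] (A B : GrMod k) (e : ℤ) where
  app : ∀ n, GrMod.pi (fun _ : Fin n => A) →ₗ[k] GrMod.pi (fun _ : Fin n => B)
  app_mem : ∀ n, HasDegree (GrMod.pi fun _ : Fin n => A) (GrMod.pi fun _ : Fin n => B) e (app n)

namespace ThickMap

variable {k : Type u} [CommRing k]

/-- The first component of a thick map. -/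
def one {A B : GrMod k} {e : ℤ} (F : ThickMap A B e) : A →ₗ[k] B :=
  (PiTensorProduct.subsingletonEquiv (R := k) (s := fun _ : Fin 1 => B.carrier) 0).toLinearMap ∘ₗ
    F.app 1 ∘ₗ
      (PiTensorProduct.subsingletonEquiv (R := k) (s := fun _ : Fin 1 => A.carrier) 0).symm.toLinearMap

/-- A thick map is symmetric if its components commute with the permutations of tensor factors. -/
def IsSymmetric {A B : GrMod k} {e : ℤ} (F : ThickMap A B e) : Prop :=
  ∀ n (s : Equiv.Perm (Fin n)),
    F.app n ∘ₗ GrMod.koszul s (fun _ => A) = GrMod.koszul s (fun _ => B) ∘ₗ F.app n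

/-- The thick map with components `f^{⊗ n}`. -/
def tpow {A B : GrMod k} (f : A →ₗ[k] B) (hf : HasDegree A B 0 f) : ThickMap A B 0 where
  app _ := PiTensorProduct.map fun _ => f
  app_mem _ := GrMod.degree_map fun _ => hf

theorem tpow_symm {A B : GrMod k} (f : A →ₗ[k] B) (hf : HasDegree A B 0 f) :
    (tpow f hf).IsSymmetric :=
  fun _ s => (GrMod.koszul_map s (X := fun _ => A) (Y := fun _ => B) (f := fun _ => f)
    fun _ => hf).symm

/-- The thick map with components `∑ 1 ⊗ ⋯ ⊗ t ⊗ ⋯ ⊗ 1`, for `t` of degree `-1`. -/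
def der {A : GrMod k} (t : A →ₗ[k] A) (ht : HasDegree A A (-1) t) : ThickMap A A (-1) where
  app n := GrMod.piDer (fun _ : Fin n => A) (-1) fun _ => t
  app_mem _ := GrMod.degree_piDer fun _ => ht

theorem der_symm {A : GrMod k} (t : A →ₗ[k] A) (ht : HasDegree A A (-1) t) :
    (der t ht).IsSymmetric :=
  fun _ s => (GrMod.koszul_piDer s (X := fun _ => A) (t := fun _ => t) fun _ => ht).symm

/-- A thick map is a morphism if its `n`-th component is the `n`-th tensor power of the first. -/
def IsMorphism {A B : GrMod k} (F : ThickMap A B 0) : Prop :=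
  ∀ n, F.app n = PiTensorProduct.map fun _ : Fin n => F.one

/-- An endomorphism of `A^{⊗ p} ⊗ A^{⊗ q}` as an endomorphism of `A^{⊗ (p + q)}`. -/
def juxt {A : GrMod k} (p q : ℕ)
    (φ : (⨂[k]^p A.carrier) ⊗[k] (⨂[k]^q A.carrier) →ₗ[k]
      (⨂[k]^p A.carrier) ⊗[k] (⨂[k]^q A.carrier)) :
    GrMod.pi (fun _ : Fin (p + q) => A) →ₗ[k] GrMod.pi (fun _ : Fin (p + q) => A) :=
  (TensorPower.mulEquiv (R := k) (M := A.carrier) (n := p) (m := q)).toLinearMap ∘ₗ φ ∘ₗ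
    (TensorPower.mulEquiv (R := k) (M := A.carrier) (n := p) (m := q)).symm.toLinearMap

/-- `h p ⊗ 1 - 1 ⊗ h q`, on `A^{⊗ (p + q)}`. -/
def diff {A : GrMod k} (H : ThickMap A A 1) (p q : ℕ) :
    GrMod.pi (fun _ : Fin (p + q) => A) →ₗ[k] GrMod.pi (fun _ : Fin (p + q) => A) :=
  juxt p q (TensorProduct.map (H.app p) LinearMap.id -
    GrMod.tmap (A := GrMod.pi fun _ : Fin p => A) (A' := GrMod.pi fun _ : Fin p => A)
      (B := GrMod.pi fun _ : Fin q => A) (B' := GrMod.pi fun _ : Fin q => A)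
      LinearMap.id 1 (H.app q))

/-- `h p ⊗ h q`, on `A^{⊗ (p + q)}`. -/
def prod {A : GrMod k} (H : ThickMap A A 1) (p q : ℕ) :
    GrMod.pi (fun _ : Fin (p + q) => A) →ₗ[k] GrMod.pi (fun _ : Fin (p + q) => A) :=
  juxt p q (GrMod.tmap (A := GrMod.pi fun _ : Fin p => A) (A' := GrMod.pi fun _ : Fin p => A)
      (B := GrMod.pi fun _ : Fin q => A) (B' := GrMod.pi fun _ : Fin q => A)
      (H.app p) 1 (H.app q))

/-- Pseudo-derivations of degree `1`:
`(h p ⊗ 1 - 1 ⊗ h q) h (p + q) = - h (p + q) (h p ⊗ 1 - 1 ⊗ h q) = h p ⊗ h q`. -/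
def IsPseudoDerivation {A : GrMod k} (H : ThickMap A A 1) : Prop :=
  ∀ p q, H.diff p q ∘ₗ H.app (p + q) = H.prod p q ∧
    -(H.app (p + q) ∘ₗ H.diff p q) = H.prod p q

/-- The map `O[A] → O[B]` induced by a symmetric thick map. -/
def schurMap (O : SymSeq k) {A B : GrMod k} {e : ℤ} (F : ThickMap A B e) (hF : F.IsSymmetric) :
    SymSeq.schurG O A →ₗ[k] SymSeq.schurG O B :=
  GrMod.dmap (X := fun n : ℕ => SymSeq.schurLevel O A n)
    (Y := fun n : ℕ => SymSeq.schurLevel O B n) fun n =>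
    GrMod.coinvMap (hT := SymSeq.schur_mem O A n) (hT' := SymSeq.schur_mem O B n)
      (GrMod.tmap (A := (O.obj n).toGrMod) (A' := (O.obj n).toGrMod)
        (B := GrMod.pi fun _ : Fin n => A) (B' := GrMod.pi fun _ : Fin n => B)
        LinearMap.id e (F.app n)) fun s => by
      refine GrMod.tensor_ext (A := (O.obj n).toGrMod) (B := GrMod.pi fun _ : Fin n => A)
        fun i j c hc x hx => ?_
      have h1 := O.act_mem n s i c hc
      rw [add_zero] at h1
      have h2 := LinearMap.congr_fun (hF n s) x
      simp only [LinearMap.comp_apply] at h2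
      simp only [GrMod.tmap, LinearMap.comp_apply, TensorProduct.map_tmul, LinearMap.id_apply,
        (O.obj n).sg_of_mem _ hc, (O.obj n).sg_of_mem _ h1, map_zsmul, h2]

end ThickMap

/-! ### Coalgebras over a cooperad -/

section Coalgebra

variable {k : Type u} [CommRing k]

/-- The map `Δ : A → C[A]` makes the chain complex `A` a coalgebra over the comonad `C[-]`. -/
structure IsCoalgebra (C : Cooperad k) (A : Cx k)
    (Δ : A.toGrMod →ₗ[k] SymSeq.schurG C.toSymSeq A.toGrMod) : Prop where
  degree : HasDegree A.toGrMod (SymSeq.schurG C.toSymSeq A.toGrMod) 0 Δ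
  chain : (SymSeq.schur C.toSymSeq A).d ∘ₗ Δ = Δ ∘ₗ A.d
  coassoc : ∀ a, (SymSeq.schurHom C.Δ A.toGrMod (Δ a),
    ThickMap.schurMap C.toSymSeq (ThickMap.tpow Δ degree) (ThickMap.tpow_symm Δ degree) (Δ a)) ∈
      SymSeq.schurAssocGraph C.toSymSeq C.toSymSeq A.toGrMod
  counit : ∀ a, (SymSeq.schurHom C.ε A.toGrMod (Δ a), a) ∈ SymSeq.schurUnitGraph A.toGrMod

/-- `F` is a thick map of `C`-coalgebras, for coalgebras with structure maps `ΔA` and `ΔB`. -/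
def IsThickCoalgebraMap (C : Cooperad k) {A B : GrMod k}
    (ΔA : A →ₗ[k] SymSeq.schurG C.toSymSeq A) (ΔB : B →ₗ[k] SymSeq.schurG C.toSymSeq B) {e : ℤ}
    (F : ThickMap A B e) : Prop :=
  ∃ hF : F.IsSymmetric, ΔB ∘ₗ F.one = F.schurMap C.toSymSeq hF ∘ₗ ΔA

/-- `f` is a morphism of `C`-coalgebras: a chain map of degree `0` with `ΔB f = C[f] ΔA`. -/
structure IsCoalgebraHom (C : Cooperad k) (A B : Cx k)
    (ΔA : A.toGrMod →ₗ[k] SymSeq.schurG C.toSymSeq A.toGrMod)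
    (ΔB : B.toGrMod →ₗ[k] SymSeq.schurG C.toSymSeq B.toGrMod)
    (f : A.toGrMod →ₗ[k] B.toGrMod) : Prop where
  degree : HasDegree A.toGrMod B.toGrMod 0 f
  chain : B.d ∘ₗ f = f ∘ₗ A.d
  comm : ΔB ∘ₗ f =
    ThickMap.schurMap C.toSymSeq (ThickMap.tpow f degree) (ThickMap.tpow_symm f degree) ∘ₗ ΔA

/-- `t` is a coderivation of degree `-1` of the `C`-coalgebra `A`: on the summand
`C n ⊗_{Σₙ} A^{⊗ n}`, the map `Δ t` is `∑ 1 ⊗ (1 ⊗ ⋯ ⊗ t ⊗ ⋯ ⊗ 1)` applied to `Δ`. -/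
structure IsCoderivation (C : Cooperad k) (A : GrMod k)
    (Δ : A →ₗ[k] SymSeq.schurG C.toSymSeq A) (t : A →ₗ[k] A) : Prop where
  degree : HasDegree A A (-1) t
  comm : Δ ∘ₗ t =
    ThickMap.schurMap C.toSymSeq (ThickMap.der t degree) (ThickMap.der_symm t degree) ∘ₗ Δ

/-! ### Contractions, filtrations and perturbations -/

/-- A contraction of chain complexes. -/
structure IsContraction (A B : Cx k) (f : A.toGrMod →ₗ[k] B.toGrMod)
    (g : B.toGrMod →ₗ[k] A.toGrMod) (h : A.toGrMod →ₗ[k] A.toGrMod) : Prop where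
  f_mem : HasDegree A.toGrMod B.toGrMod 0 f
  g_mem : HasDegree B.toGrMod A.toGrMod 0 g
  h_mem : HasDegree A.toGrMod A.toGrMod 1 h
  f_d : B.d ∘ₗ f = f ∘ₗ A.d
  g_d : A.d ∘ₗ g = g ∘ₗ B.d
  h_d : A.d ∘ₗ h + h ∘ₗ A.d = g ∘ₗ f - LinearMap.id
  f_g : f ∘ₗ g = LinearMap.id
  f_h : f ∘ₗ h = 0
  h_h : h ∘ₗ h = 0
  h_g : h ∘ₗ g = 0

/-- An increasing filtration of a chain complex by subcomplexes, exhaustive and bounded below. -/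
structure IsComplexFiltration (A : Cx k) (F : ℤ → Submodule k A.carrier) : Prop where
  mono : Monotone F
  graded : ∀ p, ∀ a ∈ F p, ∀ i, A.proj i a ∈ F p
  d_mem : ∀ p, ∀ a ∈ F p, A.d a ∈ F p
  exhaustive : ∀ a, ∃ p, a ∈ F p
  bounded : ∃ p, F p = ⊥

/-- The `p`-th level of the induced filtration on `A^{⊗ n}`: the span of the images of
`F i₁ ⊗ ⋯ ⊗ F iₙ` with `i₁ + ⋯ + iₙ = p`. -/
def tensorFiltration {A : GrMod k} (F : ℤ → Submodule k A.carrier) (n : ℕ) (p : ℤ) :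
    Submodule k (GrMod.pi fun _ : Fin n => A).carrier :=
  Submodule.span k {z | ∃ (i : Fin n → ℤ) (x : Fin n → A), (∀ j, x j ∈ F (i j)) ∧
    ∑ j, i j = p ∧ PiTensorProduct.tprod k x = z}

/-- `f` preserves filtrations. -/
def Preserves {M N : Type u} [AddCommGroup M] [Module k M] [AddCommGroup N] [Module k N]
    (F : ℤ → Submodule k M) (G : ℤ → Submodule k N) (f : M →ₗ[k] N) : Prop :=
  ∀ p, ∀ a ∈ F p, f a ∈ G p

/-- A thick contraction of `C`-coalgebras, for coalgebras with structure maps `ΔA` and `ΔB`. -/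
structure IsThickCoalgebraContraction (C : Cooperad k) (A B : Cx k)
    (ΔA : A.toGrMod →ₗ[k] SymSeq.schurG C.toSymSeq A.toGrMod)
    (ΔB : B.toGrMod →ₗ[k] SymSeq.schurG C.toSymSeq B.toGrMod)
    (F : ThickMap A.toGrMod B.toGrMod 0) (G : ThickMap B.toGrMod A.toGrMod 0)
    (H : ThickMap A.toGrMod A.toGrMod 1) : Prop where
  contraction : ∀ n, IsContraction (Cx.pi fun _ : Fin n => A) (Cx.pi fun _ : Fin n => B)
    (F.app n) (G.app n) (H.app n)
  f_morphism : F.IsMorphism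
  g_morphism : G.IsMorphism
  h_pseudo : H.IsPseudoDerivation
  coalgebra_A : IsCoalgebra C A ΔA
  coalgebra_B : IsCoalgebra C B ΔB
  f_thick : IsThickCoalgebraMap C ΔA ΔB F
  g_thick : IsThickCoalgebraMap C ΔB ΔA G
  h_thick : IsThickCoalgebraMap C ΔA ΔA H

/-- A filtered contraction of `C`-coalgebras: a filtered contraction that extends to a thick
contraction of `C`-coalgebras preserving the induced filtrations on the tensor powers. -/
structure IsFilteredCoalgebraContraction (C : Cooperad k) (A B : Cx k)
    (ΔA : A.toGrMod →ₗ[k] SymSeq.schurG C.toSymSeq A.toGrMod)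
    (ΔB : B.toGrMod →ₗ[k] SymSeq.schurG C.toSymSeq B.toGrMod)
    (FA : ℤ → Submodule k A.carrier) (FB : ℤ → Submodule k B.carrier)
    (f : A.toGrMod →ₗ[k] B.toGrMod) (g : B.toGrMod →ₗ[k] A.toGrMod)
    (h : A.toGrMod →ₗ[k] A.toGrMod) : Prop where
  contraction : IsContraction A B f g h
  filtration_A : IsComplexFiltration A FA
  filtration_B : IsComplexFiltration B FB
  f_preserves : Preserves FA FB f
  g_preserves : Preserves FB FA g
  h_preserves : Preserves FA FA h
  thick : ∃ (F : ThickMap A.toGrMod B.toGrMod 0) (G : ThickMap B.toGrMod A.toGrMod 0)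
    (H : ThickMap A.toGrMod A.toGrMod 1),
    F.one = f ∧ G.one = g ∧ H.one = h ∧
    IsThickCoalgebraContraction C A B ΔA ΔB F G H ∧
    ∀ n, Preserves (tensorFiltration FA n) (tensorFiltration FB n) (F.app n) ∧
      Preserves (tensorFiltration FB n) (tensorFiltration FA n) (G.app n) ∧
      Preserves (tensorFiltration FA n) (tensorFiltration FA n) (H.app n)

/-- A perturbation of `A`: a map `t` of degree `-1` with `(d + t) ^ 2 = 0`. -/
structure IsPerturbation (A : Cx k) (t : A.toGrMod →ₗ[k] A.toGrMod) : Prop where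
  degree : HasDegree A.toGrMod A.toGrMod (-1) t
  sq : (A.d + t) ∘ₗ (A.d + t) = 0

/-- The chain complex `A` with the differential `d + t`. -/
@[reducible]
def Cx.perturb (A : Cx k) (t : A.toGrMod →ₗ[k] A.toGrMod) (ht : IsPerturbation A t) : Cx k where
  toGrMod := A.toGrMod
  d := A.d + t
  d_mem i a ha := add_mem (A.d_mem i a ha) (ht.degree i a ha)
  d_d := ht.sq

/-- `Σ = t (1 - h t)⁻¹`. -/
def pertSigma {A : Cx k} (h t : A.toGrMod →ₗ[k] A.toGrMod) : A.toGrMod →ₗ[k] A.toGrMod :=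
  t ∘ₗ Ring.inverse (1 - h * t : Module.End k A.carrier)

/-- `f' = f + f Σ h`. -/
def pertF {A B : Cx k} (f : A.toGrMod →ₗ[k] B.toGrMod) (h t : A.toGrMod →ₗ[k] A.toGrMod) :
    A.toGrMod →ₗ[k] B.toGrMod :=
  f + f ∘ₗ pertSigma h t ∘ₗ h

/-- `g' = g + h Σ g`. -/
def pertG {A B : Cx k} (g : B.toGrMod →ₗ[k] A.toGrMod) (h t : A.toGrMod →ₗ[k] A.toGrMod) :
    B.toGrMod →ₗ[k] A.toGrMod :=
  g + h ∘ₗ pertSigma h t ∘ₗ g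

/-- `h' = h + h Σ h`. -/
def pertH {A : Cx k} (h t : A.toGrMod →ₗ[k] A.toGrMod) : A.toGrMod →ₗ[k] A.toGrMod :=
  h + h ∘ₗ pertSigma h t ∘ₗ h

/-- `t' = f Σ g`. -/
def pertT {A B : Cx k} (f : A.toGrMod →ₗ[k] B.toGrMod) (g : B.toGrMod →ₗ[k] A.toGrMod)
    (h t : A.toGrMod →ₗ[k] A.toGrMod) : B.toGrMod →ₗ[k] B.toGrMod :=
  f ∘ₗ pertSigma h t ∘ₗ g

end Coalgebra

end

noncomputable section

/-! ### The linear algebra of the perturbation lemma -/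

section Ring

variable {R : Type*} [Ring R]

/-! The perturbation is carried out on all tensor powers at once. Let T_n be the extension of t to
A^{⊗n} as a derivation. T_n lowers the induced filtration and H_n preserves it, so H_n T_n is
locally nilpotent and S_n = T_n (1 - H_n T_n)⁻¹ exists. The classical perturbation lemma
(`LinearContraction.perturb`), applied in each arity, gives F'_n = F_n + F_n S_n H_n, and likewise
G'_n, H'_n and T'_n = F_n S_n G_n, with all the equations of a contraction. It remains to compare
different arities and to check compatibility with the coalgebra structures.

Compatibility is formal. Thick coalgebra maps are closed under sums, differences, compositions and
inverses (`IsThickCoalgebraMap.inverse`); H is one by hypothesis and T because t is a coderivation,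
hence so are (1 - HT)⁻¹, S, F', G', H' and T'.

Multiplicativity of F' comes from a uniqueness principle: a map φ that intertwines d with some
operator on the target, satisfies φ g = 1 and kills h must be f, as one sees by applying φ to dh +
hd = gf - 1 (`LinearContraction.eq_f`). For φ = F'_p ⊗ F'_q the hard point is φ H_{p+q} = 0. Since
F'_n (1 - T_n H_n) = F_n, composing φ with (1 - T_p H_p ⊗ 1)(1 - 1 ⊗ T_q H_q) gives F_p ⊗ F_q =
F_{p+q}, which kills H_{p+q}; the pseudo-derivation identity shows that all the correction terms
vanish (`comp_eq_zero_of_pseudo`). The argument for G' is dual.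

Both T'_{p+q} and T'_p ⊗ 1 + 1 ⊗ T'_q, added to the differential of B^{⊗(p+q)}, are intertwined with
d + T_{p+q} by F'_{p+q}, which has a right inverse; so they agree, and T'_n is the derivation
extending t'. The two identities for H' become consequences of those for H once the invertible
factors 1 - HT and 1 - TH are cleared (`perturb_diff_mul`, `perturb_mul_diff`). Thus the
contractions obtained arity by arity form a thick contraction between the perturbed complexes, whose
first components are f', g', h'. -/

theorem sigma_anticomm {d h t S p : R} (hd : d * h + h * d = p - 1)
    (ht : d * t + t * d + t * t = 0) (hS : S = t + S * h * t) (hS' : S = t + t * h * S) :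
    d * S + S * d + S * p * S = 0 := by
  have h1 : S * (1 - h * t) = t := by
    rw [mul_sub, mul_one, ← mul_assoc, sub_eq_iff_eq_add]; exact hS
  have h2 : (1 - t * h) * S = t := by rw [sub_mul, one_mul, sub_eq_iff_eq_add]; exact hS'
  -- These are the one-sided inverses used at the end: 1 + S h on the left of 1 - t h, and 1 + h S
  -- on the right of 1 - h t.
  have h3 : (1 + S * h) * (1 - t * h) = 1 := by
    have : (1 + S * h) * (1 - t * h) = 1 + (S - (t + S * h * t)) * h := by noncomm_ring
    rw [this, ← hS, sub_self, zero_mul, add_zero]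
  have h4 : (1 - h * t) * (1 + h * S) = 1 := by
    have : (1 - h * t) * (1 + h * S) = 1 + h * (S - (t + t * h * S)) := by noncomm_ring
    rw [this, ← hS', sub_self, mul_zero, add_zero]
  -- Since S = (1 - t h)⁻¹ t = t (1 - h t)⁻¹, these two factors turn S back into t. Substituting p =
  -- d h + h d + 1 cancels the extra terms and leaves the Maurer–Cartan equation for t.
  have h5 : (1 - t * h) * (d * S + S * d + S * p * S) * (1 - h * t) = 0 := by
    have hp : p = d * h + h * d + 1 := by rw [hd, sub_add_cancel]
    calc _ = (1 - t * h) * d * (S * (1 - h * t)) + ((1 - t * h) * S) * d * (1 - h * t) +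
          ((1 - t * h) * S) * p * (S * (1 - h * t)) := by noncomm_ring
      _ = d * t + t * d + t * t := by rw [h1, h2, hp]; noncomm_ring
      _ = 0 := ht
  calc _ = ((1 + S * h) * (1 - t * h)) * (d * S + S * d + S * p * S) *
        ((1 - h * t) * (1 + h * S)) := by rw [h3, h4, one_mul, mul_one]
    _ = (1 + S * h) * ((1 - t * h) * (d * S + S * d + S * p * S) * (1 - h * t)) *
        (1 + h * S) := by noncomm_ring
    _ = 0 := by rw [h5, mul_zero, zero_mul]

/-- The first identity of a pseudo-derivation is preserved by perturbation. -/
theorem perturb_diff_mul {a b s r H a' b' H' : R} (hDH : (a - b) * H = a * b)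
    (hba : b * a = -(a * b)) (hra : r * a = -(a * r)) (hsb : s * b = -(b * s))
    (ha : (1 - a * s) * a' = a) (hb : (1 - b * r) * b' = b) (hH : H' * (1 - (s + r) * H) = H)
    (hc : a * s * (b * r) = b * r * (a * s)) (hca : b * r * a' = a' * (b * r))
    (hua : IsUnit (1 - a * s)) (hub : IsUnit (1 - b * r)) (huH : IsUnit (1 - (s + r) * H)) :
    (a' - b') * H' = a' * b' := by
  have hc' : (1 - a * s) * (1 - b * r) = (1 - b * r) * (1 - a * s) := by
    have : (1 - a * s) * (1 - b * r) - (1 - b * r) * (1 - a * s) =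
      a * s * (b * r) - b * r * (a * s) := by noncomm_ring
    rwa [← sub_eq_zero, this, sub_eq_zero]
  have hca' : (1 - b * r) * a' = a' * (1 - b * r) := by
    rw [sub_mul, mul_sub, hca, one_mul, mul_one]
  -- In the application a, b are H_p ⊗ 1, 1 ⊗ H_q and s, r are T_p ⊗ 1, 1 ⊗ T_q. The three units
  -- turn a', b', H' into a, b, H; what remains is the unperturbed identity together with terms
  -- matched by the anticommutation relations.
  refine hua.mul_left_cancel (hub.mul_left_cancel (huH.mul_right_cancel ?_))
  calc (1 - b * r) * ((1 - a * s) * ((a' - b') * H')) * (1 - (s + r) * H)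
      = ((1 - b * r) * ((1 - a * s) * a') - ((1 - b * r) * (1 - a * s)) * b') *
        (H' * (1 - (s + r) * H)) := by noncomm_ring
    _ = ((1 - b * r) * a - (1 - a * s) * b) * H := by
        rw [ha, ← hc', mul_assoc (1 - a * s), hb, hH]
    _ = a * b * (1 - (s + r) * H) := by
        calc _ = (a - b) * H - b * (r * a) * H + a * (s * b) * H := by noncomm_ring
          _ = (a - b) * H + (b * a) * r * H - a * b * s * H := by rw [hra, hsb]; noncomm_ring
          _ = _ := by rw [hDH, hba]; noncomm_ring
    _ = ((1 - a * s) * a') * ((1 - b * r) * b') * (1 - (s + r) * H) := by rw [ha, hb]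
    _ = (1 - a * s) * (a' * (1 - b * r)) * b' * (1 - (s + r) * H) := by noncomm_ring
    _ = ((1 - a * s) * (1 - b * r)) * (a' * b') * (1 - (s + r) * H) := by
        rw [← hca']; noncomm_ring
    _ = _ := by rw [hc']; noncomm_ring

/-- The second identity of a pseudo-derivation is preserved by perturbation. -/
theorem perturb_mul_diff {a b s r H a' b' H' : R} (hHD : H * (a - b) = -(a * b))
    (hba : b * a = -(a * b)) (hra : r * a = -(a * r)) (hsb : s * b = -(b * s))
    (ha : a' * (1 - s * a) = a) (hb : b' * (1 - r * b) = b) (hH : (1 - H * (s + r)) * H' = H)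
    (hc : s * a * (r * b) = r * b * (s * a)) (hca : r * b * a' = a' * (r * b))
    (hua : IsUnit (1 - s * a)) (hub : IsUnit (1 - r * b)) (huH : IsUnit (1 - H * (s + r))) :
    H' * (a' - b') = -(a' * b') := by
  have hc' : (1 - s * a) * (1 - r * b) = (1 - r * b) * (1 - s * a) := by
    have : (1 - s * a) * (1 - r * b) - (1 - r * b) * (1 - s * a) =
      s * a * (r * b) - r * b * (s * a) := by noncomm_ring
    rwa [← sub_eq_zero, this, sub_eq_zero]
  have hca' : (1 - r * b) * a' = a' * (1 - r * b) := by
    rw [sub_mul, mul_sub, hca, one_mul, mul_one]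
  have hbsa : b * (s * a) = s * a * b := by
    calc b * (s * a) = b * s * a := by noncomm_ring
      _ = -(s * (b * a)) := by rw [← neg_eq_iff_eq_neg.2 hsb]; noncomm_ring
      _ = _ := by rw [hba]; noncomm_ring
  -- The mirror image of the preceding cancellation: the factors now stand to the right of a' and b'
  -- and to the left of H'. Here b commutes with s a because it anticommutes with both letters.
  refine hub.mul_right_cancel (hua.mul_right_cancel (huH.mul_left_cancel ?_))
  calc (1 - H * (s + r)) * (H' * (a' - b') * (1 - r * b) * (1 - s * a))
      = ((1 - H * (s + r)) * H') * (a' * ((1 - r * b) * (1 - s * a)) -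
        (b' * (1 - r * b)) * (1 - s * a)) := by noncomm_ring
    _ = H * (a * (1 - r * b) - b * (1 - s * a)) := by
        rw [hb, ← hc', ← mul_assoc a', ha, hH]
    _ = H * (a - b) - H * (a * r) * b + H * (b * s) * a := by noncomm_ring
    _ = H * (a - b) + H * r * (a * b) - H * s * (b * a) := by
        rw [← neg_eq_iff_eq_neg.2 hra, ← neg_eq_iff_eq_neg.2 hsb]; noncomm_ring
    _ = -((1 - H * (s + r)) * (a * b)) := by rw [hHD, hba]; noncomm_ring
    _ = -((1 - H * (s + r)) * ((a' * (1 - s * a)) * b)) := by rw [ha]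
    _ = -((1 - H * (s + r)) * (a' * (b * (1 - s * a)))) := by
        rw [mul_assoc a', sub_mul 1 (s * a), mul_sub b, hbsa, one_mul, mul_one]
    _ = -((1 - H * (s + r)) * (a' * ((b' * (1 - r * b)) * (1 - s * a)))) := by rw [hb]
    _ = _ := by noncomm_ring

end Ring

/-! ### Contractions of modules: perturbation and uniqueness -/

section Linear

variable {k : Type*} [CommRing k] {M N : Type*} [AddCommGroup M] [Module k M] [AddCommGroup N]
  [Module k N]

/-- The equations of a contraction, for linear maps that need not be homogeneous. -/
structure LinearContraction (d : M →ₗ[k] M) (d' : N →ₗ[k] N) (f : M →ₗ[k] N) (g : N →ₗ[k] M)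
    (h : M →ₗ[k] M) : Prop where
  f_d : d' ∘ₗ f = f ∘ₗ d
  g_d : d ∘ₗ g = g ∘ₗ d'
  h_d : d ∘ₗ h + h ∘ₗ d = g ∘ₗ f - LinearMap.id
  f_g : f ∘ₗ g = LinearMap.id
  f_h : f ∘ₗ h = 0
  h_h : h ∘ₗ h = 0
  h_g : h ∘ₗ g = 0

namespace LinearContraction

variable {d : M →ₗ[k] M} {d' : N →ₗ[k] N} {f : M →ₗ[k] N} {g : N →ₗ[k] M} {h : M →ₗ[k] M}

/-- The basic perturbation lemma. -/
theorem perturb (hc : LinearContraction d d' f g h) {t S : M →ₗ[k] M}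
    (ht : d ∘ₗ t + t ∘ₗ d + t ∘ₗ t = 0) (hS : S = t + S ∘ₗ h ∘ₗ t)
    (hS' : S = t + t ∘ₗ h ∘ₗ S) :
    LinearContraction (d + t) (d' + f ∘ₗ S ∘ₗ g) (f + f ∘ₗ S ∘ₗ h) (g + h ∘ₗ S ∘ₗ g)
      (h + h ∘ₗ S ∘ₗ h) := by
  have h0 : d ∘ₗ S + S ∘ₗ d + (S ∘ₗ (g ∘ₗ f)) ∘ₗ S = 0 :=
    sigma_anticomm (R := Module.End k M) hc.h_d ht hS hS'
  -- The relations are oriented as rewriting rules: the differential of M moves to the left past S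
  -- and h, d' is traded for d, and the side conditions and the equations for S shorten words. Each
  -- equation of the new contraction then becomes an identity between normal forms.
  have e0 : ∀ x, S (d x) = -d (S x) - S (g (f (S x))) := fun x => by
    have := LinearMap.congr_fun h0 x
    simp only [LinearMap.add_apply, LinearMap.comp_apply, LinearMap.zero_apply] at this
    rw [← sub_eq_zero, ← this]; abel
  have e1 : ∀ x, d' (f x) = f (d x) := LinearMap.congr_fun hc.f_d
  have e2 : ∀ x, g (d' x) = d (g x) := fun x => (LinearMap.congr_fun hc.g_d x).symm
  have e3 : ∀ x, h (d x) = g (f x) - x - d (h x) := fun x => by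
    rw [eq_sub_iff_add_eq, add_comm]; exact LinearMap.congr_fun hc.h_d x
  have e4 : ∀ x, f (g x) = x := LinearMap.congr_fun hc.f_g
  have e5 : ∀ x, f (h x) = 0 := LinearMap.congr_fun hc.f_h
  have e6 : ∀ x, h (h x) = 0 := LinearMap.congr_fun hc.h_h
  have e7 : ∀ x, h (g x) = 0 := LinearMap.congr_fun hc.h_g
  have e8 : ∀ x, S (h (t x)) = S x - t x := fun x => by
    rw [eq_sub_iff_add_eq, add_comm]; exact (LinearMap.congr_fun hS x).symm
  have e9 : ∀ x, t (h (S x)) = S x - t x := fun x => by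
    rw [eq_sub_iff_add_eq, add_comm]; exact (LinearMap.congr_fun hS' x).symm
  constructor <;> ext x <;>
    simp only [LinearMap.add_apply, LinearMap.sub_apply, LinearMap.comp_apply, map_add, map_sub,
      map_neg, map_zero, e0, e1, e2, e3, e4, e5, e6, e7, e8, e9, LinearMap.id_apply,
      LinearMap.zero_apply] <;> try abel

/-- By d' f = f d and g d' = d g, the square is f (d S + S d + S g f S) g, whose middle factor
vanishes by `sigma_anticomm`. -/
theorem perturb_sq (hc : LinearContraction d d' f g h) (hd' : d' ∘ₗ d' = 0) {t S : M →ₗ[k] M}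
    (ht : d ∘ₗ t + t ∘ₗ d + t ∘ₗ t = 0) (hS : S = t + S ∘ₗ h ∘ₗ t)
    (hS' : S = t + t ∘ₗ h ∘ₗ S) :
    (d' + f ∘ₗ S ∘ₗ g) ∘ₗ (d' + f ∘ₗ S ∘ₗ g) = 0 := by
  have h0 : d ∘ₗ S + S ∘ₗ d + (S ∘ₗ (g ∘ₗ f)) ∘ₗ S = 0 :=
    sigma_anticomm (R := Module.End k M) hc.h_d ht hS hS'
  have e0 : ∀ x, S (d x) = -d (S x) - S (g (f (S x))) := fun x => by
    have := LinearMap.congr_fun h0 x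
    simp only [LinearMap.add_apply, LinearMap.comp_apply, LinearMap.zero_apply] at this
    rw [← sub_eq_zero, ← this]; abel
  have e1 : ∀ x, d' (f x) = f (d x) := LinearMap.congr_fun hc.f_d
  have e2 : ∀ x, g (d' x) = d (g x) := fun x => (LinearMap.congr_fun hc.g_d x).symm
  have e3 : ∀ x, d' (d' x) = 0 := LinearMap.congr_fun hd'
  ext x
  simp only [LinearMap.add_apply, LinearMap.comp_apply, map_add, map_sub, map_neg, e0, e1, e2, e3,
    LinearMap.zero_apply]
  abel

/-- A chain map that splits `g` and annihilates `h` is `f`. -/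
theorem eq_f (hc : LinearContraction d d' f g h) {φ : M →ₗ[k] N} {d'' : N →ₗ[k] N}
    (hd : d'' ∘ₗ φ = φ ∘ₗ d) (hg : φ ∘ₗ g = LinearMap.id) (hh : φ ∘ₗ h = 0) : φ = f := by
  have e1 : ∀ x, φ (d x) = d'' (φ x) := fun x => (LinearMap.congr_fun hd x).symm
  have e2 : ∀ x, φ (g x) = x := LinearMap.congr_fun hg
  have e3 : ∀ x, φ (h x) = 0 := LinearMap.congr_fun hh
  ext x
  have e4 : d (h x) + h (d x) = g (f x) - x := LinearMap.congr_fun hc.h_d x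
  -- Here φ d h = d'' φ h = 0 and φ h d = 0, so the homotopy equation collapses to 0 = f - φ.
  -- Nothing is asked of d'', not even that it be the differential d'.
  have e5 := congrArg φ e4
  simp only [map_add, map_sub, e1, e2, e3, map_zero, add_zero] at e5
  exact (sub_eq_zero.1 e5.symm).symm

/-- A chain map that is split by `f` and annihilated by `h` is `g`. -/
theorem eq_g (hc : LinearContraction d d' f g h) {γ : N →ₗ[k] M} {d'' : N →ₗ[k] N}
    (hd : d ∘ₗ γ = γ ∘ₗ d'') (hf : f ∘ₗ γ = LinearMap.id) (hh : h ∘ₗ γ = 0) : γ = g := by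
  have e1 : ∀ x, d (γ x) = γ (d'' x) := LinearMap.congr_fun hd
  have e2 : ∀ x, f (γ x) = x := LinearMap.congr_fun hf
  have e3 : ∀ x, h (γ x) = 0 := LinearMap.congr_fun hh
  ext x
  -- On the image of γ both terms on the left vanish, the second one because d maps this image into
  -- itself through d''.
  have e4 : d (h (γ x)) + h (d (γ x)) = g (f (γ x)) - γ x := LinearMap.congr_fun hc.h_d (γ x)
  simp only [map_zero, e1, e2, e3, add_zero] at e4
  exact (sub_eq_zero.1 e4.symm).symm

end LinearContraction

/-- If `φ` annihilates `a` and `b`, and `φ (1 - s a) (1 - r b)` annihilates `H`, then `φ`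
annihilates `H`. -/
theorem comp_eq_zero_of_pseudo {a b s r H : M →ₗ[k] M} {φ : M →ₗ[k] N}
    (hDH : (a - b) ∘ₗ H = a ∘ₗ b) (hba : b ∘ₗ a = -(a ∘ₗ b)) (hsb : s ∘ₗ b = -(b ∘ₗ s)) (hra : r ∘ₗ a = -(a ∘ₗ r))
    (haa : a ∘ₗ a = 0) (ha : φ ∘ₗ a = 0) (hb : φ ∘ₗ b = 0)
    (h0 : (φ ∘ₗ (LinearMap.id - s ∘ₗ a) ∘ₗ (LinearMap.id - r ∘ₗ b)) ∘ₗ H = 0) : φ ∘ₗ H = 0 := by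
  have e1 : ∀ x, s (b x) = -b (s x) := LinearMap.congr_fun hsb
  have e2 : ∀ x, r (a x) = -a (r x) := LinearMap.congr_fun hra
  have e3 : ∀ x, a (a x) = 0 := LinearMap.congr_fun haa
  have e4 : ∀ x, φ (a x) = 0 := LinearMap.congr_fun ha
  have e5 : ∀ x, φ (b x) = 0 := LinearMap.congr_fun hb
  ext x
  have e6 : a (H x) - b (H x) = a (b x) := LinearMap.congr_fun hDH x
  have e7 : a (H x) = b (H x) + a (b x) := by rw [← e6]; abel
  have e8 : b (H x) = a (H x) - a (b x) := by rw [← e6]; abel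
  have e9 := LinearMap.congr_fun h0 x
  -- This exhibits r b H as a multiple of a from the left. So φ kills it, and a kills it as well
  -- because a a = 0; this disposes of the term r b H and of the mixed term s a r b H.
  have e10 : r (b (H x)) = -a (r (H x)) + a (r (b x)) := by
    rw [e8]; simp only [map_sub, e2]; abel
  -- Replacing a H by b H + a b and moving s past b leaves a term starting with b, which φ kills.
  -- The remaining term s a b = -(s b a) = b s a starts with b too.
  have e11 : φ (s (a (H x))) = φ (s (a (b x))) := by
    rw [e7, map_add, map_add, e1, map_neg, e5]; simp
  have e12 : φ (s (a (b x))) = 0 := by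
    have : a (b x) = -b (a x) := neg_eq_iff_eq_neg.1 (LinearMap.congr_fun hba x).symm
    rw [this, map_neg, e1, map_neg, map_neg, e5, neg_zero, neg_zero]
  simp only [LinearMap.comp_apply, LinearMap.sub_apply, LinearMap.id_apply, map_sub, e10, map_add,
    map_neg, e3, e4, e11, e12, map_zero] at e9
  simpa using e9

/-- If `a` and `b` annihilate `γ`, and `H` annihilates `(1 - a s) (1 - b r) γ`, then `H`
annihilates `γ`. -/
theorem pseudo_comp_eq_zero {a b s r H : M →ₗ[k] M} {γ : N →ₗ[k] M}
    (hHD : H ∘ₗ (a - b) = -(a ∘ₗ b)) (hba : b ∘ₗ a = -(a ∘ₗ b)) (hsb : s ∘ₗ b = -(b ∘ₗ s))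
    (hra : r ∘ₗ a = -(a ∘ₗ r)) (hbb : b ∘ₗ b = 0) (ha : a ∘ₗ γ = 0) (hb : b ∘ₗ γ = 0)
    (h0 : H ∘ₗ (LinearMap.id - a ∘ₗ s) ∘ₗ (LinearMap.id - b ∘ₗ r) ∘ₗ γ = 0) : H ∘ₗ γ = 0 := by
  have e1 : ∀ x, b (s x) = -s (b x) := fun x => by
    have := LinearMap.congr_fun hsb x
    simp only [LinearMap.comp_apply, LinearMap.neg_apply] at this
    rw [this, neg_neg]
  have e2 : ∀ x, a (r x) = -r (a x) := fun x => by
    have := LinearMap.congr_fun hra x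
    simp only [LinearMap.comp_apply, LinearMap.neg_apply] at this
    rw [this, neg_neg]
  have e3 : ∀ x, b (b x) = 0 := LinearMap.congr_fun hbb
  have e4 : ∀ x, a (γ x) = 0 := LinearMap.congr_fun ha
  have e5 : ∀ x, b (γ x) = 0 := LinearMap.congr_fun hb
  have e6 : ∀ x, H (a x) = H (b x) - a (b x) := fun x => by
    have := LinearMap.congr_fun hHD x
    simp only [LinearMap.comp_apply, LinearMap.neg_apply, LinearMap.sub_apply, map_sub] at this
    rw [← sub_eq_zero, sub_eq_iff_eq_add.1 this]; abel
  have e7 : ∀ x, b (a x) = -a (b x) := LinearMap.congr_fun hba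
  have e8 : ∀ x, H (b x) = H (a x) + a (b x) := fun x => by rw [e6]; abel
  ext x
  have e9 := LinearMap.congr_fun h0 x
  -- Each correction term is treated by trading H a for H b, or conversely. This produces b s γ, a r
  -- γ or b s b, which vanish because the letters anticommute, a and b kill γ, and b b = 0.
  have e10 : H (a (s (γ x))) = 0 := by rw [e6, e1, e5]; simp
  have e11 : H (b (r (γ x))) = 0 := by
    rw [e8, e2, e4, map_zero, neg_zero, map_zero, zero_add]
    have := e7 (r (γ x))
    rw [e2, e4, map_zero, neg_zero, map_zero] at this
    exact neg_eq_zero.1 this.symm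
  have e12 : H (a (s (b (r (γ x))))) = 0 := by
    rw [e6, e1, e3]; simp
  simpa [LinearMap.comp_apply, map_sub, e10, e11, e12] using e9

end Linear

namespace GrMod

variable {k : Type u} [CommRing k]

/-! ### Signs -/

theorem sg_zero (A : GrMod k) : A.sg 0 = LinearMap.id :=
  A.lin_ext fun i a ha => by simp [A.sg_of_mem _ ha]

theorem sg_comp_sg (A : GrMod k) (e e' : ℤ) : A.sg e ∘ₗ A.sg e' = A.sg (e + e') :=
  A.lin_ext fun i a ha => by
    rw [LinearMap.comp_apply, A.sg_of_mem _ ha, map_zsmul, A.sg_of_mem _ ha, A.sg_of_mem _ ha,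
      smul_smul, add_mul, Int.negOnePow_add, Units.val_mul, mul_comm]

/-- Identifies the sign carried by an extension of t, of degree -1, with that carried by 1 ⊗ H_q, of
degree 1. The signs then cancel in the products of the two operators. -/
theorem sg_neg_one (A : GrMod k) : A.sg (-1) = A.sg 1 :=
  A.lin_ext fun i a ha => by
    rw [A.sg_of_mem _ ha, A.sg_of_mem _ ha, neg_mul, Int.negOnePow_neg]

theorem sg_one_comp_sg_one (A : GrMod k) : A.sg 1 ∘ₗ A.sg 1 = LinearMap.id := by
  nth_rewrite 1 [← sg_neg_one]
  rw [sg_comp_sg, neg_add_cancel, sg_zero]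

theorem sg_comp {A B : GrMod k} {e : ℤ} {f : A →ₗ[k] B} (hf : HasDegree A B e f) (e' : ℤ) :
    B.sg e' ∘ₗ f = (Int.negOnePow (e' * e) : ℤ) • f ∘ₗ A.sg e' :=
  A.lin_ext fun i a ha => by
    rw [LinearMap.comp_apply, B.sg_of_mem _ (hf i a ha), LinearMap.smul_apply, LinearMap.comp_apply,
      A.sg_of_mem _ ha, map_zsmul, smul_smul, mul_add, Int.negOnePow_add, Units.val_mul, mul_comm]

theorem sg_comp_of_zero {A B : GrMod k} {f : A →ₗ[k] B} (hf : HasDegree A B 0 f) (e' : ℤ) :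
    B.sg e' ∘ₗ f = f ∘ₗ A.sg e' := by
  simp [sg_comp hf]

theorem sg_one_comp {A B : GrMod k} {e : ℤ} {f : A →ₗ[k] B} (hf : HasDegree A B e f)
    (he : Odd e) : B.sg 1 ∘ₗ f = -(f ∘ₗ A.sg 1) := by
  rw [sg_comp hf, one_mul, Int.negOnePow_odd _ he]; simp

/-- Degrees add under tensor product, so signs multiply. This gathers the signs standing before the
active slot in `piDer` into one sign on the whole first block. -/
theorem sg_pi {n : ℕ} (X : Fin n → GrMod k) (e : ℤ) :
    (pi X).sg e = PiTensorProduct.map fun i => (X i).sg e := by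
  refine pi_ext fun deg x hx => ?_
  rw [(pi X).sg_of_mem e (tprod_mem hx rfl), PiTensorProduct.map_tprod]
  have : (fun i => (X i).sg e (x i)) = fun i => ((Int.negOnePow (e * deg i) : ℤ) : k) • x i :=
    funext fun i => by rw [(X i).sg_of_mem e (hx i), Int.cast_smul_eq_zsmul]
  rw [this, MultilinearMap.map_smul_univ, ← Int.cast_prod, Int.cast_smul_eq_zsmul, Finset.mul_sum]
  congr 1
  have : ∀ s : Finset (Fin n), ((Int.negOnePow (∑ i ∈ s, e * deg i) : ℤˣ) : ℤ) =
      ∏ i ∈ s, ((Int.negOnePow (e * deg i) : ℤˣ) : ℤ) := fun s => by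
    induction s using Finset.induction_on with
    | empty => simp
    | insert i s hi ih =>
      rw [Finset.sum_insert hi, Finset.prod_insert hi, Int.negOnePow_add, Units.val_mul, ih]
  exact this _

theorem HasDegree.comp {A B C : GrMod k} {e e' e'' : ℤ} {g : B →ₗ[k] C} {f : A →ₗ[k] B}
    (hg : HasDegree B C e g) (hf : HasDegree A B e' f) (h : e' + e = e'') :
    HasDegree A C e'' (g ∘ₗ f) := fun i a ha => by
  rw [← h, ← add_assoc]; exact hg _ _ (hf i a ha)

/-! ### Juxtaposition of maps between tensor powers -/

/-- The map `φ ⊗ ψ : A^{⊗ (p + q)} → B^{⊗ (p + q)}`, without signs. -/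
def jx {A B : GrMod k} {p q : ℕ}
    (φ : pi (fun _ : Fin p => A) →ₗ[k] pi (fun _ : Fin p => B))
    (ψ : pi (fun _ : Fin q => A) →ₗ[k] pi (fun _ : Fin q => B)) :
    pi (fun _ : Fin (p + q) => A) →ₗ[k] pi (fun _ : Fin (p + q) => B) :=
  (TensorPower.mulEquiv (R := k) (M := B.carrier) (n := p) (m := q)).toLinearMap ∘ₗ
    TensorProduct.map φ ψ ∘ₗ
    (TensorPower.mulEquiv (R := k) (M := A.carrier) (n := p) (m := q)).symm.toLinearMap

section Jx

variable {A B C : GrMod k} {p q : ℕ}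

/-- The concatenation of tensors. -/
def cat (A : GrMod k) (p q : ℕ) :
    pi (fun _ : Fin p => A) →ₗ[k] pi (fun _ : Fin q => A) →ₗ[k] pi (fun _ : Fin (p + q) => A) :=
  (TensorProduct.mk k _ _).compr₂
    (TensorPower.mulEquiv (R := k) (M := A.carrier) (n := p) (m := q)).toLinearMap

theorem cat_tprod (x : Fin p → A) (y : Fin q → A) :
    cat A p q (PiTensorProduct.tprod k x) (PiTensorProduct.tprod k y) =
      PiTensorProduct.tprod k (Fin.append x y) :=
  TensorPower.tprod_mul_tprod k x y

theorem jx_cat (φ : pi (fun _ : Fin p => A) →ₗ[k] pi (fun _ : Fin p => B))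
    (ψ : pi (fun _ : Fin q => A) →ₗ[k] pi (fun _ : Fin q => B))
    (x : pi (fun _ : Fin p => A)) (y : pi (fun _ : Fin q => A)) :
    jx φ ψ (cat A p q x y) = cat B p q (φ x) (ψ y) := by
  simp only [jx, cat, LinearMap.comp_apply, LinearMap.compr₂_apply, TensorProduct.mk_apply,
    LinearEquiv.coe_coe]
  erw [LinearEquiv.symm_apply_apply]
  rfl

theorem cat_ext {M : Type*} [AddCommGroup M] [Module k M]
    {F G : pi (fun _ : Fin (p + q) => A) →ₗ[k] M}
    (h : ∀ (x : Fin p → A) (y : Fin q → A),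
      F (cat A p q (PiTensorProduct.tprod k x) (PiTensorProduct.tprod k y)) =
      G (cat A p q (PiTensorProduct.tprod k x) (PiTensorProduct.tprod k y))) :
    F = G := by
  refine PiTensorProduct.ext (MultilinearMap.ext fun z => ?_)
  have := h (fun i => z (Fin.castAdd q i)) (fun i => z (Fin.natAdd p i))
  rwa [cat_tprod, Fin.append_castAdd_natAdd] at this

/-- No sign appears because `jx` is the naive tensor product of maps. All Koszul signs are kept
explicit as factors `sg` in the first block. -/
theorem jx_comp (φ : pi (fun _ : Fin p => B) →ₗ[k] pi (fun _ : Fin p => C))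
    (ψ : pi (fun _ : Fin q => B) →ₗ[k] pi (fun _ : Fin q => C))
    (φ' : pi (fun _ : Fin p => A) →ₗ[k] pi (fun _ : Fin p => B))
    (ψ' : pi (fun _ : Fin q => A) →ₗ[k] pi (fun _ : Fin q => B)) :
    jx φ ψ ∘ₗ jx φ' ψ' = jx (φ ∘ₗ φ') (ψ ∘ₗ ψ') :=
  cat_ext fun x y => by rw [LinearMap.comp_apply, jx_cat, jx_cat, jx_cat]; rfl

theorem jx_add_left (φ φ' : pi (fun _ : Fin p => A) →ₗ[k] pi (fun _ : Fin p => B))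
    (ψ : pi (fun _ : Fin q => A) →ₗ[k] pi (fun _ : Fin q => B)) :
    jx (φ + φ') ψ = jx φ ψ + jx φ' ψ := by
  simp [jx, TensorProduct.map_add_left, LinearMap.add_comp, LinearMap.comp_add]

theorem jx_add_right (φ : pi (fun _ : Fin p => A) →ₗ[k] pi (fun _ : Fin p => B))
    (ψ ψ' : pi (fun _ : Fin q => A) →ₗ[k] pi (fun _ : Fin q => B)) :
    jx φ (ψ + ψ') = jx φ ψ + jx φ ψ' := by
  simp [jx, TensorProduct.map_add_right, LinearMap.add_comp, LinearMap.comp_add]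

theorem jx_neg_left (φ : pi (fun _ : Fin p => A) →ₗ[k] pi (fun _ : Fin p => B))
    (ψ : pi (fun _ : Fin q => A) →ₗ[k] pi (fun _ : Fin q => B)) :
    jx (-φ) ψ = -jx φ ψ :=
  cat_ext fun x y => by
    rw [LinearMap.neg_apply, jx_cat, jx_cat]; exact LinearMap.map_neg₂ _ _ _

theorem jx_neg_right (φ : pi (fun _ : Fin p => A) →ₗ[k] pi (fun _ : Fin p => B))
    (ψ : pi (fun _ : Fin q => A) →ₗ[k] pi (fun _ : Fin q => B)) :
    jx φ (-ψ) = -jx φ ψ :=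
  cat_ext fun x y => by
    rw [LinearMap.neg_apply, jx_cat, jx_cat]; exact map_neg _ _

theorem jx_zero_left (ψ : pi (fun _ : Fin q => A) →ₗ[k] pi (fun _ : Fin q => B)) :
    jx (0 : pi (fun _ : Fin p => A) →ₗ[k] pi (fun _ : Fin p => B)) ψ = 0 :=
  cat_ext fun x y => by
    rw [jx_cat]; exact LinearMap.map_zero₂ _ _

theorem jx_zero_right (φ : pi (fun _ : Fin p => A) →ₗ[k] pi (fun _ : Fin p => B)) :
    jx φ (0 : pi (fun _ : Fin q => A) →ₗ[k] pi (fun _ : Fin q => B)) = 0 :=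
  cat_ext fun x y => by
    rw [jx_cat]; exact map_zero _

theorem jx_sub_left (φ φ' : pi (fun _ : Fin p => A) →ₗ[k] pi (fun _ : Fin p => B))
    (ψ : pi (fun _ : Fin q => A) →ₗ[k] pi (fun _ : Fin q => B)) :
    jx (φ - φ') ψ = jx φ ψ - jx φ' ψ := by
  rw [sub_eq_add_neg, jx_add_left, jx_neg_left, ← sub_eq_add_neg]

theorem jx_sub_right (φ : pi (fun _ : Fin p => A) →ₗ[k] pi (fun _ : Fin p => B))
    (ψ ψ' : pi (fun _ : Fin q => A) →ₗ[k] pi (fun _ : Fin q => B)) :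
    jx φ (ψ - ψ') = jx φ ψ - jx φ ψ' := by
  rw [sub_eq_add_neg, jx_add_right, jx_neg_right, ← sub_eq_add_neg]

theorem jx_id : jx (A := A) (p := p) (q := q) LinearMap.id LinearMap.id = LinearMap.id :=
  cat_ext fun x y => by rw [jx_cat]; rfl

theorem jx_map (f : A →ₗ[k] B) :
    jx (p := p) (q := q) (PiTensorProduct.map fun _ => f) (PiTensorProduct.map fun _ => f) =
      PiTensorProduct.map fun _ => f :=
  cat_ext fun x y => by
    rw [jx_cat, PiTensorProduct.map_tprod, PiTensorProduct.map_tprod, cat_tprod, cat_tprod,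
      PiTensorProduct.map_tprod]
    congr 1
    funext i
    refine Fin.addCases (fun i => ?_) (fun i => ?_) i <;> simp

/-- The sum splits according to whether the active slot lies among the first p or the last q. In the
second case every slot of the first block carries a sign, and together these form the sign operator
of A^{⊗p}. -/
theorem piDer_eq_jx (e : ℤ) (t : A →ₗ[k] A) :
    piDer (fun _ : Fin (p + q) => A) e (fun _ => t) =
      jx (piDer (fun _ : Fin p => A) e fun _ => t) LinearMap.id +
      jx ((pi fun _ : Fin p => A).sg e) (piDer (fun _ : Fin q => A) e fun _ => t) :=
  cat_ext fun x y => by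
    rw [LinearMap.add_apply, jx_cat, jx_cat, sg_pi, cat_tprod, piDer, piDer, piDer,
      LinearMap.sum_apply, LinearMap.sum_apply, LinearMap.sum_apply, Fin.sum_univ_add, map_sum,
      map_sum, LinearMap.sum_apply]
    refine congrArg₂ (· + ·) (Finset.sum_congr rfl fun i _ => ?_)
      (Finset.sum_congr rfl fun i _ => ?_)
    · rw [PiTensorProduct.map_tprod, PiTensorProduct.map_tprod, LinearMap.id_apply, cat_tprod]
      refine congrArg (PiTensorProduct.tprod k) (funext fun j => ?_)
      refine Fin.addCases (fun j => ?_) (fun j => ?_) j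
      · have h1 : Fin.castAdd q j < Fin.castAdd q i ↔ j < i := Iff.rfl
        have h2 : Fin.castAdd q j = Fin.castAdd q i ↔ j = i := by simp
        rw [Fin.append_left, Fin.append_left]
        simp only [h1, h2]
      · have h1 : ¬ Fin.natAdd p j < Fin.castAdd q i := by
          rw [Fin.lt_def, Fin.val_natAdd, Fin.val_castAdd]; omega
        have h2 : ¬ Fin.natAdd p j = Fin.castAdd q i := by
          rw [Fin.ext_iff, Fin.val_natAdd, Fin.val_castAdd]; omega
        rw [Fin.append_right, Fin.append_right, if_neg h1, if_neg h2]; rfl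
    · rw [PiTensorProduct.map_tprod, PiTensorProduct.map_tprod, PiTensorProduct.map_tprod,
        cat_tprod]
      refine congrArg (PiTensorProduct.tprod k) (funext fun j => ?_)
      refine Fin.addCases (fun j => ?_) (fun j => ?_) j
      · have h1 : Fin.castAdd q j < Fin.natAdd p i := by
          rw [Fin.lt_def, Fin.val_natAdd, Fin.val_castAdd]; omega
        rw [Fin.append_left, Fin.append_left, if_pos h1]
      · have h1 : Fin.natAdd p j < Fin.natAdd p i ↔ j < i := by
          rw [Fin.lt_def, Fin.val_natAdd, Fin.val_natAdd, Fin.lt_def]; omega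
        have h2 : Fin.natAdd p j = Fin.natAdd p i ↔ j = i := by
          rw [Fin.ext_iff, Fin.val_natAdd, Fin.val_natAdd, Fin.ext_iff]; omega
        rw [Fin.append_right, Fin.append_right]
        simp only [h1, h2]

end Jx

/-- Each summand is additive in the entry of its active slot, the other slots being independent of
t. -/
theorem piDer_add {n : ℕ} (X : Fin n → GrMod k) (e : ℤ) (t t' : ∀ i, X i →ₗ[k] X i) :
    piDer X e (fun i => t i + t' i) = piDer X e t + piDer X e t' := by
  simp only [piDer, ← Finset.sum_add_distrib]
  refine Finset.sum_congr rfl fun i _ => ?_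
  let c : ∀ j, X j →ₗ[k] X j := fun j => if j < i then (X j).sg e else LinearMap.id
  have h : ∀ u : ∀ i, X i →ₗ[k] X i, PiTensorProduct.map
      (fun j => if j < i then (X j).sg e else if j = i then u j else LinearMap.id) =
      PiTensorProduct.map (Function.update c i (u i)) := by
    intro u
    congr 1
    funext j
    by_cases hj : j = i
    · subst hj; simp
    · simp [hj, c]
  have := PiTensorProduct.map_update_add c i (t i) (t' i)
  rw [← h t, ← h t'] at this
  rw [← this]
  exact h _

end GrMod

namespace ThickMap

variable {k : Type u} [CommRing k] {A B C : GrMod k}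

/-! ### Operations on thick maps -/

/-- The composition of thick maps. -/
def comp {e e' : ℤ} (F : ThickMap B C e) (G : ThickMap A B e') {e'' : ℤ} (h : e' + e = e'') :
    ThickMap A C e'' where
  app n := F.app n ∘ₗ G.app n
  app_mem n := GrMod.HasDegree.comp (F.app_mem n) (G.app_mem n) h

/-- The sum of thick maps. -/
def add {e : ℤ} (F G : ThickMap A B e) : ThickMap A B e where
  app n := F.app n + G.app n
  app_mem n i a ha := add_mem (F.app_mem n i a ha) (G.app_mem n i a ha)

/-- The difference of thick maps. -/
def sub {e : ℤ} (F G : ThickMap A B e) : ThickMap A B e where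
  app n := F.app n - G.app n
  app_mem n i a ha := sub_mem (F.app_mem n i a ha) (G.app_mem n i a ha)

theorem app_one {e : ℤ} (F : ThickMap A B e) :
    F.app 1 = (PiTensorProduct.subsingletonEquiv (R := k)
      (s := fun _ : Fin 1 => B.carrier) 0).symm.toLinearMap ∘ₗ F.one ∘ₗ
      (PiTensorProduct.subsingletonEquiv (R := k)
        (s := fun _ : Fin 1 => A.carrier) 0).toLinearMap := by
  ext x
  have : (fun _ => x 0) = x := funext fun i => congrArg x (Subsingleton.elim 0 i)
  simp [one, this]

theorem one_comp {e e' : ℤ} (F : ThickMap B C e) (G : ThickMap A B e') {e'' : ℤ}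
    (h : e' + e = e'') : (F.comp G h).one = F.one ∘ₗ G.one := by
  ext x
  simp [one, comp]

theorem one_add {e : ℤ} (F G : ThickMap A B e) : (F.add G).one = F.one + G.one := by
  ext x
  simp [one, add]

theorem one_sub {e : ℤ} (F G : ThickMap A B e) : (F.sub G).one = F.one - G.one := by
  ext x
  simp [one, sub]

theorem one_der (t : A →ₗ[k] A) (ht : HasDegree A A (-1) t) : (der t ht).one = t := by
  ext x
  simp [one, der, GrMod.piDer, PiTensorProduct.subsingletonEquiv_symm_apply',
    PiTensorProduct.map_tprod, PiTensorProduct.subsingletonEquiv_apply_tprod]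

theorem one_tpow (f : A →ₗ[k] B) (hf : HasDegree A B 0 f) : (tpow f hf).one = f := by
  ext x
  simp [one, tpow, PiTensorProduct.subsingletonEquiv_symm_apply',
    PiTensorProduct.map_tprod, PiTensorProduct.subsingletonEquiv_apply_tprod]

theorem IsSymmetric.comp {e e' : ℤ} {F : ThickMap B C e} {G : ThickMap A B e'}
    (hF : F.IsSymmetric) (hG : G.IsSymmetric) {e'' : ℤ} (h : e' + e = e'') :
    (F.comp G h).IsSymmetric := fun n s => by
  change (F.app n ∘ₗ G.app n) ∘ₗ _ = _ ∘ₗ (F.app n ∘ₗ G.app n)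
  rw [LinearMap.comp_assoc, hG n s, ← LinearMap.comp_assoc, hF n s, LinearMap.comp_assoc]

theorem IsSymmetric.add {e : ℤ} {F G : ThickMap A B e}
    (hF : F.IsSymmetric) (hG : G.IsSymmetric) : (F.add G).IsSymmetric := fun n s => by
  change (F.app n + G.app n) ∘ₗ _ = _ ∘ₗ (F.app n + G.app n)
  rw [LinearMap.add_comp, LinearMap.comp_add, hF n s, hG n s]

theorem IsSymmetric.sub {e : ℤ} {F G : ThickMap A B e}
    (hF : F.IsSymmetric) (hG : G.IsSymmetric) : (F.sub G).IsSymmetric := fun n s => by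
  change (F.app n - G.app n) ∘ₗ _ = _ ∘ₗ (F.app n - G.app n)
  rw [LinearMap.sub_comp, LinearMap.comp_sub, hF n s, hG n s]

theorem IsSymmetric.inverse {P U : ThickMap A A 0} (hP : P.IsSymmetric)
    (h1 : ∀ n, P.app n ∘ₗ U.app n = LinearMap.id) (h2 : ∀ n, U.app n ∘ₗ P.app n = LinearMap.id) :
    U.IsSymmetric := fun n s => by
  calc U.app n ∘ₗ GrMod.koszul s (fun _ => A)
      = U.app n ∘ₗ (GrMod.koszul s (fun _ => A) ∘ₗ P.app n) ∘ₗ U.app n := by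
        rw [LinearMap.comp_assoc, h1]; rfl
    _ = (U.app n ∘ₗ P.app n) ∘ₗ GrMod.koszul s (fun _ => A) ∘ₗ U.app n := by
        rw [← hP n s]; rfl
    _ = _ := by rw [h2]; rfl

theorem schurMap_inj (O : SymSeq k) {e : ℤ} (F : ThickMap A B e) (hF : F.IsSymmetric) (n : ℕ)
    (x : (O.obj n).carrier ⊗[k] (GrMod.pi fun _ : Fin n => A).carrier) :
    F.schurMap O hF (GrMod.inj (fun n : ℕ => SymSeq.schurLevel O A n) n
      (GrMod.coinvMk _ _ (SymSeq.schur_mem O A n) x)) =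
    GrMod.inj (fun n : ℕ => SymSeq.schurLevel O B n) n
      (GrMod.coinvMk _ _ (SymSeq.schur_mem O B n)
        (GrMod.tmap (A := (O.obj n).toGrMod) (A' := (O.obj n).toGrMod)
        (B := GrMod.pi fun _ : Fin n => A) (B' := GrMod.pi fun _ : Fin n => B)
        LinearMap.id e (F.app n) x)) := by
  rw [schurMap, GrMod.dmap_inj, GrMod.coinvMap_mk]

theorem schur_ext (O : SymSeq k) {M : Type u} [AddCommGroup M] [Module k M]
    {φ ψ : SymSeq.schurG O A →ₗ[k] M}
    (h : ∀ n (x : (O.obj n).carrier ⊗[k] (GrMod.pi fun _ : Fin n => A).carrier),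
      φ (GrMod.inj (fun n : ℕ => SymSeq.schurLevel O A n) n
        (GrMod.coinvMk _ _ (SymSeq.schur_mem O A n) x)) =
      ψ (GrMod.inj (fun n : ℕ => SymSeq.schurLevel O A n) n
        (GrMod.coinvMk _ _ (SymSeq.schur_mem O A n) x))) : φ = ψ := by
  refine GrMod.directSum_ext fun n x => ?_
  obtain ⟨x, rfl⟩ := Submodule.mkQ_surjective _ x
  exact h n x

theorem schurMap_comp (O : SymSeq k) {e e' : ℤ} {F : ThickMap B C e} {G : ThickMap A B e'}
    (hF : F.IsSymmetric) (hG : G.IsSymmetric) {e'' : ℤ} (h : e' + e = e'') :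
    (F.comp G h).schurMap O (hF.comp hG h) = F.schurMap O hF ∘ₗ G.schurMap O hG := by
  refine schur_ext O fun n x => ?_
  rw [LinearMap.comp_apply, schurMap_inj, schurMap_inj, schurMap_inj]
  congr 2
  rw [← LinearMap.comp_apply]
  refine LinearMap.congr_fun ?_ x
  rw [GrMod.tmap, GrMod.tmap, GrMod.tmap, ← TensorProduct.map_comp]
  congr 1
  -- Moving both maps past the same element c of C(n) gives the signs of e and e' in |c|, whose
  -- product is the sign of e + e'.
  rw [LinearMap.id_comp, LinearMap.id_comp, LinearMap.id_comp, GrMod.sg_comp_sg, ← h, add_comm]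

theorem schurMap_add (O : SymSeq k) {e : ℤ} {F G : ThickMap A B e}
    (hF : F.IsSymmetric) (hG : G.IsSymmetric) :
    (F.add G).schurMap O (hF.add hG) = F.schurMap O hF + G.schurMap O hG := by
  refine schur_ext O fun n x => ?_
  rw [LinearMap.add_apply, schurMap_inj, schurMap_inj, schurMap_inj, ← map_add, ← map_add]
  congr 2
  rw [← LinearMap.add_apply]
  refine LinearMap.congr_fun ?_ x
  rw [GrMod.tmap, GrMod.tmap, GrMod.tmap]
  exact TensorProduct.map_add_right _ _ _

theorem schurMap_congr (O : SymSeq k) {e : ℤ} {F G : ThickMap A B e} (hF : F.IsSymmetric)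
    (hG : G.IsSymmetric) (h : ∀ n, F.app n = G.app n) : F.schurMap O hF = G.schurMap O hG := by
  obtain ⟨f, hf⟩ := F
  obtain ⟨g, hg⟩ := G
  obtain rfl : f = g := funext h
  rfl

theorem schurMap_sub (O : SymSeq k) {e : ℤ} {F G : ThickMap A B e}
    (hF : F.IsSymmetric) (hG : G.IsSymmetric) :
    (F.sub G).schurMap O (hF.sub hG) = F.schurMap O hF - G.schurMap O hG := by
  rw [eq_sub_iff_add_eq, ← schurMap_add]
  exact schurMap_congr _ _ _ fun n => sub_add_cancel (F.app n) (G.app n)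

theorem schurMap_of_app_eq_id (O : SymSeq k) {F : ThickMap A A 0} (hF : F.IsSymmetric)
    (h : ∀ n, F.app n = LinearMap.id) : F.schurMap O hF = LinearMap.id := by
  refine schur_ext O fun n x => ?_
  rw [schurMap_inj, h n, GrMod.tmap, GrMod.sg_zero]
  exact congrArg (fun y => GrMod.inj (fun n : ℕ => SymSeq.schurLevel O A n) n
    (GrMod.coinvMk _ _ (SymSeq.schur_mem O A n) y)) (LinearMap.congr_fun TensorProduct.map_id x)

end ThickMap

/-! ### Closure properties of thick coalgebra maps -/

namespace IsThickCoalgebraMap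

variable {k : Type u} [CommRing k] {C : Cooperad k} {A B D : GrMod k}
  {ΔA : A →ₗ[k] SymSeq.schurG C.toSymSeq A} {ΔB : B →ₗ[k] SymSeq.schurG C.toSymSeq B}
  {ΔD : D →ₗ[k] SymSeq.schurG C.toSymSeq D}

theorem comp {e e' : ℤ} {F : ThickMap B D e} {G : ThickMap A B e'}
    (hF : IsThickCoalgebraMap C ΔB ΔD F) (hG : IsThickCoalgebraMap C ΔA ΔB G) {e'' : ℤ}
    (h : e' + e = e'') : IsThickCoalgebraMap C ΔA ΔD (F.comp G h) := by
  obtain ⟨sF, hF⟩ := hF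
  obtain ⟨sG, hG⟩ := hG
  refine ⟨sF.comp sG h, ?_⟩
  rw [ThickMap.one_comp, ThickMap.schurMap_comp, ← LinearMap.comp_assoc, hF, LinearMap.comp_assoc,
    hG, LinearMap.comp_assoc]

theorem add {e : ℤ} {F G : ThickMap A B e}
    (hF : IsThickCoalgebraMap C ΔA ΔB F) (hG : IsThickCoalgebraMap C ΔA ΔB G) :
    IsThickCoalgebraMap C ΔA ΔB (F.add G) := by
  obtain ⟨sF, hF⟩ := hF
  obtain ⟨sG, hG⟩ := hG
  refine ⟨sF.add sG, ?_⟩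
  rw [ThickMap.one_add, ThickMap.schurMap_add, LinearMap.comp_add, LinearMap.add_comp, hF, hG]

theorem sub {e : ℤ} {F G : ThickMap A B e}
    (hF : IsThickCoalgebraMap C ΔA ΔB F) (hG : IsThickCoalgebraMap C ΔA ΔB G) :
    IsThickCoalgebraMap C ΔA ΔB (F.sub G) := by
  obtain ⟨sF, hF⟩ := hF
  obtain ⟨sG, hG⟩ := hG
  refine ⟨sF.sub sG, ?_⟩
  rw [ThickMap.one_sub, ThickMap.schurMap_sub, LinearMap.comp_sub, LinearMap.sub_comp, hF, hG]

theorem id (h : HasDegree A A 0 (LinearMap.id : A →ₗ[k] A)) :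
    IsThickCoalgebraMap C ΔA ΔA (ThickMap.tpow LinearMap.id h) := by
  refine ⟨ThickMap.tpow_symm _ h, ?_⟩
  rw [ThickMap.one_tpow, ThickMap.schurMap_of_app_eq_id]
  · rfl
  · exact fun n => PiTensorProduct.map_id

/-- Because C[-] respects composition of thick maps, C[U] is a left inverse of C[P], and Δ U₁ = C[U]
C[P] Δ U₁ = C[U] Δ P₁ U₁ = C[U] Δ. This is what makes the resolvent of H T a thick coalgebra map. -/
theorem inverse {P U : ThickMap A A 0} (hP : IsThickCoalgebraMap C ΔA ΔA P)
    (h1 : ∀ n, P.app n ∘ₗ U.app n = LinearMap.id) (h2 : ∀ n, U.app n ∘ₗ P.app n = LinearMap.id) :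
    IsThickCoalgebraMap C ΔA ΔA U := by
  obtain ⟨sP, hP⟩ := hP
  have sU := sP.inverse h1 h2
  refine ⟨sU, ?_⟩
  have h3 : U.schurMap C.toSymSeq sU ∘ₗ P.schurMap C.toSymSeq sP = LinearMap.id := by
    rw [← ThickMap.schurMap_comp C.toSymSeq sU sP (add_zero 0)]
    exact ThickMap.schurMap_of_app_eq_id _ _ h2
  have h4 : P.one ∘ₗ U.one = LinearMap.id := by
    rw [← ThickMap.one_comp P U (add_zero 0)]
    have : (P.comp U (add_zero 0)).app 1 = LinearMap.id := h1 1
    ext x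
    simp [ThickMap.one, this]
  calc ΔA ∘ₗ U.one = (U.schurMap C.toSymSeq sU ∘ₗ P.schurMap C.toSymSeq sP) ∘ₗ ΔA ∘ₗ U.one := by
        rw [h3]; rfl
    _ = U.schurMap C.toSymSeq sU ∘ₗ (P.schurMap C.toSymSeq sP ∘ₗ ΔA) ∘ₗ U.one := rfl
    _ = U.schurMap C.toSymSeq sU ∘ₗ (ΔA ∘ₗ P.one) ∘ₗ U.one := by rw [hP]
    _ = U.schurMap C.toSymSeq sU ∘ₗ ΔA ∘ₗ (P.one ∘ₗ U.one) := rfl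
    _ = _ := by rw [h4]; rfl

end IsThickCoalgebraMap

/-! ### Perturbation of thick contractions -/

/-! ### The operator t (1 - h t)⁻¹ -/

section IsSigma

variable {k : Type*} [CommRing k] {M N : Type*} [AddCommGroup M] [Module k M] [AddCommGroup N]
  [Module k N]

/-- The equations that characterise `S = t (1 - h t)⁻¹`. -/
structure IsSigma (h t S : M →ₗ[k] M) : Prop where
  left : S = t + S ∘ₗ h ∘ₗ t
  right : S = t + t ∘ₗ h ∘ₗ S

namespace IsSigma

variable {h t S : M →ₗ[k] M}

theorem S_h_t (hS : IsSigma h t S) (x : M) : S (h (t x)) = S x - t x := by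
  rw [eq_sub_iff_add_eq, add_comm]; exact (LinearMap.congr_fun hS.left x).symm

theorem t_h_S (hS : IsSigma h t S) (x : M) : t (h (S x)) = S x - t x := by
  rw [eq_sub_iff_add_eq, add_comm]; exact (LinearMap.congr_fun hS.right x).symm

/-- The operator 1 + S h is inverse to 1 - t h, so f + f S h is f (1 - t h)⁻¹. In this form the
unperturbed map is recovered from the perturbed one; it is also applied with h in place of f. -/
theorem comp_one_sub (hS : IsSigma h t S) (f : M →ₗ[k] N) :
    (f + f ∘ₗ S ∘ₗ h) ∘ₗ (LinearMap.id - t ∘ₗ h) = f := by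
  ext x
  simp [hS.S_h_t]

/-- Dually, 1 + h S is inverse to 1 - h t, so g + h S g is (1 - h t)⁻¹ g. -/
theorem one_sub_comp (hS : IsSigma h t S) (g : N →ₗ[k] M) :
    (LinearMap.id - h ∘ₗ t) ∘ₗ (g + h ∘ₗ S ∘ₗ g) = g := by
  ext x
  simp [hS.t_h_S]

theorem isUnit_one_sub_h_t (hS : IsSigma h t S) : IsUnit (1 - h * t : Module.End k M) :=
  isUnit_iff_exists.2 ⟨1 + h * S, LinearMap.ext fun x => by simp [hS.t_h_S],
    LinearMap.ext fun x => by simp [hS.S_h_t]⟩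

theorem isUnit_one_sub_t_h (hS : IsSigma h t S) : IsUnit (1 - t * h : Module.End k M) :=
  isUnit_iff_exists.2 ⟨1 + S * h, LinearMap.ext fun x => by simp [hS.t_h_S],
    LinearMap.ext fun x => by simp [hS.S_h_t]⟩

/-- The two inverse equations read U = 1 + U h t and U = 1 + h t U; apply t on the left. -/
theorem of_inverse {U : M →ₗ[k] M} (h1 : U ∘ₗ (LinearMap.id - h ∘ₗ t) = LinearMap.id)
    (h2 : (LinearMap.id - h ∘ₗ t) ∘ₗ U = LinearMap.id) : IsSigma h t (t ∘ₗ U) := by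
  constructor <;> ext x
  · have := LinearMap.congr_fun h1 x
    simp only [LinearMap.comp_apply, LinearMap.sub_apply, LinearMap.id_apply, map_sub] at this
    simp [← map_add, ← sub_eq_iff_eq_add.1 this]
  · have := LinearMap.congr_fun h2 x
    simp only [LinearMap.comp_apply, LinearMap.sub_apply, LinearMap.id_apply] at this
    simp [← map_add, ← sub_eq_iff_eq_add.1 this]

end IsSigma

end IsSigma

section Thick

variable {k : Type u} [CommRing k]

theorem IsContraction.linear {A B : Cx k} {f : A.toGrMod →ₗ[k] B.toGrMod}
    {g : B.toGrMod →ₗ[k] A.toGrMod} {h : A.toGrMod →ₗ[k] A.toGrMod} (hc : IsContraction A B f g h) :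
    LinearContraction A.d B.d f g h :=
  ⟨hc.f_d, hc.g_d, hc.h_d, hc.f_g, hc.f_h, hc.h_h, hc.h_g⟩

theorem GrMod.isUnit_jx {A : GrMod k} {p q : ℕ}
    {x : pi (fun _ : Fin p => A) →ₗ[k] pi (fun _ : Fin p => A)}
    {y : pi (fun _ : Fin q => A) →ₗ[k] pi (fun _ : Fin q => A)}
    (hx : IsUnit (M := Module.End k (pi fun _ : Fin p => A).carrier) x)
    (hy : IsUnit (M := Module.End k (pi fun _ : Fin q => A).carrier) y) :
    IsUnit (M := Module.End k (pi fun _ : Fin (p + q) => A).carrier) (jx x y) := by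
  obtain ⟨x', h1, h2⟩ := isUnit_iff_exists.1 hx
  obtain ⟨y', h3, h4⟩ := isUnit_iff_exists.1 hy
  refine isUnit_iff_exists.2 ⟨jx x' y', ?_, ?_⟩
  · exact (jx_comp _ _ _ _).trans ((congrArg₂ (fun x y => jx x y) h1 h3).trans jx_id)
  · exact (jx_comp _ _ _ _).trans ((congrArg₂ (fun x y => jx x y) h2 h4).trans jx_id)

/-! ### Thick maps determined by their first component -/

namespace ThickMap

open GrMod

variable {A B : GrMod k}

/-- Writes the Koszul sign of 1 ⊗ H_q as a sign operator on the first block, so that the identities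
can be computed with the sign-free `jx`. -/
theorem diff_eq (H : ThickMap A A 1) (p q : ℕ) :
    H.diff p q = jx (H.app p) LinearMap.id - jx ((pi fun _ : Fin p => A).sg 1) (H.app q) := by
  rw [diff, juxt, LinearMap.sub_comp, LinearMap.comp_sub]
  rfl

theorem prod_eq (H : ThickMap A A 1) (p q : ℕ) :
    H.prod p q = jx (H.app p ∘ₗ (pi fun _ : Fin p => A).sg 1) (H.app q) := rfl

theorem app_one_tprod {e : ℤ} (F : ThickMap A B e) (x : Fin 1 → A) :
    F.app 1 (PiTensorProduct.tprod k x) = PiTensorProduct.tprod k fun _ => F.one (x 0) := by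
  rw [F.app_one]
  simp [PiTensorProduct.subsingletonEquiv_apply_tprod,
    PiTensorProduct.subsingletonEquiv_symm_apply']

theorem app_one_eq_map {F : ThickMap A B 0} : F.app 1 = PiTensorProduct.map fun _ => F.one := by
  refine PiTensorProduct.ext (MultilinearMap.ext fun x => ?_)
  refine (F.app_one_tprod x).trans ?_
  refine Eq.trans ?_ (PiTensorProduct.map_tprod _ _).symm
  exact congrArg (PiTensorProduct.tprod k) (funext fun i => by rw [Subsingleton.elim i 0])

theorem app_one_eq_piDer {e : ℤ} {F : ThickMap A A e} :
    F.app 1 = piDer (fun _ => A) e fun _ => F.one := by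
  refine PiTensorProduct.ext (MultilinearMap.ext fun x => ?_)
  refine (F.app_one_tprod x).trans ?_
  rw [LinearMap.compMultilinearMap_apply, piDer, Fin.sum_univ_one]
  refine Eq.trans ?_ (PiTensorProduct.map_tprod _ _).symm
  exact congrArg (PiTensorProduct.tprod k) (funext fun i => by rw [Subsingleton.elim i 0]; simp)

theorem IsMorphism.jx {F : ThickMap A B 0} (hF : F.IsMorphism) (p q : ℕ) :
    F.app (p + q) = jx (F.app p) (F.app q) := by
  rw [hF, hF, hF, jx_map]

/-- Splitting off the last tensor factor reduces everything to arities 0 and 1. Arity 0 is a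
separate hypothesis, since multiplicativity only makes that component an idempotent scalar. -/
theorem isMorphism_of_jx {F : ThickMap A B 0} (h0 : F.app 0 = PiTensorProduct.map fun _ => F.one)
    (h : ∀ p q, F.app (p + q) = GrMod.jx (F.app p) (F.app q)) : F.IsMorphism := by
  intro n
  induction n with
  | zero => exact h0
  | succ n ih => rw [h n 1, ih, app_one_eq_map, jx_map]

theorem app_eq_piDer_of_jx {e : ℤ} {F : ThickMap A A e} (h0 : F.app 0 = 0)
    (h : ∀ p q, F.app (p + q) = GrMod.jx (F.app p) LinearMap.id +
      GrMod.jx ((pi fun _ : Fin p => A).sg e) (F.app q)) (n : ℕ) :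
    F.app n = piDer (fun _ => A) e fun _ => F.one := by
  induction n with
  | zero => rw [h0, piDer, Fin.sum_univ_zero]
  | succ n ih => rw [h n 1, ih, app_one_eq_piDer, piDer_eq_jx]

/-- The thick map `F + F S H`. -/
def pertF (F : ThickMap A B 0) (H : ThickMap A A 1) (S : ThickMap A A (-1)) : ThickMap A B 0 :=
  F.add (F.comp (S.comp H (e'' := 0) (by norm_num)) (by norm_num))

/-- The thick map `G + H S G`. -/
def pertG (G : ThickMap B A 0) (H : ThickMap A A 1) (S : ThickMap A A (-1)) : ThickMap B A 0 :=
  G.add (H.comp (S.comp G (e'' := -1) (by norm_num)) (by norm_num))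

/-- The thick map `H + H S H`. -/
def pertH (H : ThickMap A A 1) (S : ThickMap A A (-1)) : ThickMap A A 1 :=
  H.add (H.comp (S.comp H (e'' := 0) (by norm_num)) (by norm_num))

/-- The thick map `F S G`. -/
def pertT (F : ThickMap A B 0) (G : ThickMap B A 0) (S : ThickMap A A (-1)) : ThickMap B B (-1) :=
  F.comp (S.comp G (e'' := -1) (by norm_num)) (by norm_num)

end ThickMap

/-- A thick contraction of chain complexes. -/
structure IsThickContraction (A B : Cx k) (F : ThickMap A.toGrMod B.toGrMod 0)
    (G : ThickMap B.toGrMod A.toGrMod 0) (H : ThickMap A.toGrMod A.toGrMod 1) : Prop where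
  contraction : ∀ n, IsContraction (Cx.pi fun _ : Fin n => A) (Cx.pi fun _ : Fin n => B)
    (F.app n) (G.app n) (H.app n)
  f_morphism : F.IsMorphism
  g_morphism : G.IsMorphism
  h_pseudo : H.IsPseudoDerivation

/-! ### Perturbed components on A^{⊗(p+q)} -/

namespace IsThickContraction

open GrMod

variable {A B : Cx k} {F : ThickMap A.toGrMod B.toGrMod 0}
    {G : ThickMap B.toGrMod A.toGrMod 0} {H : ThickMap A.toGrMod A.toGrMod 1}
    {t : A.toGrMod →ₗ[k] A.toGrMod} {S : ThickMap A.toGrMod A.toGrMod (-1)}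

/-- The classical perturbation lemma in arity n. The operator on B^{⊗n} is kept as d + T'_n, because
T'_n is identified as a derivation only in `pertT_app`, by means of these very contractions. -/
theorem perturb_linear (hc : IsThickContraction A B F G H) (ht : IsPerturbation A t) (n : ℕ)
    (hS : IsSigma (H.app n) (piDer (fun _ : Fin n => A.toGrMod) (-1) fun _ => t) (S.app n)) :
    LinearContraction (piDer (fun _ : Fin n => A.toGrMod) (-1) fun _ => A.d + t)
      ((piDer (fun _ : Fin n => B.toGrMod) (-1) fun _ => B.d) + (F.pertT G S).app n)
      ((F.pertF H S).app n) ((G.pertG H S).app n) ((H.pertH S).app n) := by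
  rw [piDer_add (fun _ : Fin n => A.toGrMod) (-1) (fun _ => A.d) (fun _ => t)]
  refine (hc.contraction n).linear.perturb ?_ hS.left hS.right
  -- The derivation extending d + t squares to zero because d + t does. Removing the square of the
  -- part from d leaves the Maurer–Cartan equation for T_n.
  have h1 := piDer_sq (X := fun _ : Fin n => A.toGrMod) (t := fun _ => A.d + t)
    (fun _ => (A.perturb t ht).d_mem) (fun _ => ht.sq)
  have h2 := (Cx.pi fun _ : Fin n => A).d_d
  change piDer _ _ _ ∘ₗ piDer _ _ _ = 0 at h2
  rw [piDer_add (fun _ : Fin n => A.toGrMod) (-1) (fun _ => A.d) (fun _ => t), LinearMap.comp_add,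
    LinearMap.add_comp, LinearMap.add_comp, h2, zero_add] at h1
  rw [← h1]
  abel

/-- The correction term of F' ends in H, so H H = 0 removes it. The side conditions of F' with the
unperturbed H, and similarly with G, are what the comparison of arities uses. -/
theorem pertF_comp_H (hc : IsThickContraction A B F G H) (n : ℕ) :
    (F.pertF H S).app n ∘ₗ H.app n = 0 := by
  change (F.app n + F.app n ∘ₗ S.app n ∘ₗ H.app n) ∘ₗ H.app n = 0
  rw [LinearMap.add_comp, LinearMap.comp_assoc, LinearMap.comp_assoc, (hc.contraction n).h_h,
    (hc.contraction n).f_h]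
  simp

theorem pertF_comp_G (hc : IsThickContraction A B F G H) (n : ℕ) :
    (F.pertF H S).app n ∘ₗ G.app n = LinearMap.id := by
  change (F.app n + F.app n ∘ₗ S.app n ∘ₗ H.app n) ∘ₗ G.app n = _
  rw [LinearMap.add_comp, LinearMap.comp_assoc, LinearMap.comp_assoc, (hc.contraction n).h_g,
    (hc.contraction n).f_g]
  simp

theorem H_comp_pertG (hc : IsThickContraction A B F G H) (n : ℕ) :
    H.app n ∘ₗ (G.pertG H S).app n = 0 := by
  change H.app n ∘ₗ (G.app n + H.app n ∘ₗ S.app n ∘ₗ G.app n) = 0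
  rw [LinearMap.comp_add, ← LinearMap.comp_assoc, (hc.contraction n).h_h,
    (hc.contraction n).h_g]
  simp

/-- A map of odd degree anticommutes with the sign operator; hence H_p ⊗ 1 and 1 ⊗ H_q anticommute.
-/
theorem H_anti (H : ThickMap A.toGrMod A.toGrMod 1) (p : ℕ) :
    (pi fun _ : Fin p => A.toGrMod).sg 1 ∘ₗ H.app p =
      -(H.app p ∘ₗ (pi fun _ : Fin p => A.toGrMod).sg 1) :=
  sg_one_comp (H.app_mem p) odd_one

theorem t_anti (ht : IsPerturbation A t) (p : ℕ) :
    (pi fun _ : Fin p => A.toGrMod).sg 1 ∘ₗ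
        piDer (fun _ : Fin p => A.toGrMod) (-1) (fun _ => t) =
      -(piDer (fun _ : Fin p => A.toGrMod) (-1) (fun _ => t) ∘ₗ
        (pi fun _ : Fin p => A.toGrMod).sg 1) :=
  sg_one_comp (degree_piDer fun _ => ht.degree) (by decide)

/-- Uniqueness of the projection in the perturbed contraction of arity p + q: F'_p ⊗ F'_q has the
properties that characterise F'_{p+q}. The only one that needs the pseudo-derivation identity is
that it annihilates H_{p+q}. -/
theorem pertF_jx (hc : IsThickContraction A B F G H) (ht : IsPerturbation A t)
    (hS : ∀ n, IsSigma (H.app n) (piDer (fun _ : Fin n => A.toGrMod) (-1) fun _ => t) (S.app n))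
    (p q : ℕ) :
    (F.pertF H S).app (p + q) = jx ((F.pertF H S).app p) ((F.pertF H S).app q) := by
  have hp := hc.perturb_linear ht p (hS p)
  have hq := hc.perturb_linear ht q (hS q)
  symm
  have hF := (F.pertF H S).app_mem
  have key : jx ((F.pertF H S).app p) ((F.pertF H S).app q) ∘ₗ H.app (p + q) = 0 := by
    refine comp_eq_zero_of_pseudo (a := jx (H.app p) LinearMap.id)
      (b := jx ((pi fun _ : Fin p => A.toGrMod).sg 1) (H.app q))
      (s := jx (piDer (fun _ : Fin p => A.toGrMod) (-1) fun _ => t) LinearMap.id)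
      (r := jx ((pi fun _ : Fin p => A.toGrMod).sg 1)
        (piDer (fun _ : Fin q => A.toGrMod) (-1) fun _ => t)) ?_ ?_ ?_ ?_ ?_ ?_ ?_ ?_
    · rw [← ThickMap.diff_eq, (hc.h_pseudo p q).1, ThickMap.prod_eq, jx_comp, LinearMap.id_comp]
    · rw [jx_comp, jx_comp, H_anti, jx_neg_left]; rfl
    · rw [jx_comp, jx_comp, t_anti ht, jx_neg_left, neg_neg]; rfl
    · rw [jx_comp, jx_comp, H_anti, jx_neg_left]; rfl
    · rw [jx_comp, (hc.contraction p).h_h, jx_zero_left]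
    · rw [jx_comp, hc.pertF_comp_H, jx_zero_left]
    · rw [jx_comp, hc.pertF_comp_H, jx_zero_right]
    -- The signs in r b cancel, so the factors act blockwise as 1 - T_p H_p and 1 - T_q H_q. They
    -- turn F'_p ⊗ F'_q into F_p ⊗ F_q = F_{p+q}, which kills H_{p+q}.
    · rw [← jx_id, jx_comp, jx_comp, LinearMap.id_comp, ← jx_sub_left, sg_one_comp_sg_one,
        ← jx_sub_right, jx_comp, jx_comp, LinearMap.comp_id]
      have h1 := (hS p).comp_one_sub (F.app p)
      have h2 := (hS q).comp_one_sub (F.app q)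
      change jx _ (_ ∘ₗ _) ∘ₗ _ = 0
      rw [LinearMap.id_comp]
      refine Eq.trans ?_ (hc.contraction (p + q)).f_h
      rw [hc.f_morphism.jx]
      exact congrArg₂ (fun x y => jx x y ∘ₗ H.app (p + q)) h1 h2
  -- The operator d'' is the tensor product differential built from arities p and q. Its agreement
  -- with d + T'_{p+q} is not yet available, which is why the uniqueness principle must allow an
  -- arbitrary d''.
  refine (hc.perturb_linear ht (p + q) (hS (p + q))).eq_f
    (d'' := jx ((piDer (fun _ : Fin p => B.toGrMod) (-1) fun _ => B.d) + (F.pertT G S).app p)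
        LinearMap.id +
      jx ((pi fun _ : Fin p => B.toGrMod).sg (-1))
        ((piDer (fun _ : Fin q => B.toGrMod) (-1) fun _ => B.d) + (F.pertT G S).app q)) ?_ ?_ ?_
  · rw [piDer_eq_jx, LinearMap.add_comp, LinearMap.comp_add, jx_comp, jx_comp, jx_comp, jx_comp,
      hp.f_d, hq.f_d, sg_comp_of_zero (hF p)]
    rfl
  -- G' differs from G by a term beginning with H, which `key` kills; the same remark applies to H'
  -- below.
  · change _ ∘ₗ (G.app (p + q) + H.app (p + q) ∘ₗ S.app (p + q) ∘ₗ G.app (p + q)) = _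
    rw [LinearMap.comp_add, ← LinearMap.comp_assoc, key, hc.g_morphism.jx, jx_comp,
      hc.pertF_comp_G, hc.pertF_comp_G, jx_id]
    simp
  · change _ ∘ₗ (H.app (p + q) + H.app (p + q) ∘ₗ S.app (p + q) ∘ₗ H.app (p + q)) = _
    rw [LinearMap.comp_add, ← LinearMap.comp_assoc, key]
    simp

/-- Dual to `pertF_jx`, by the uniqueness of the inclusion in a contraction. -/
theorem pertG_jx (hc : IsThickContraction A B F G H) (ht : IsPerturbation A t)
    (hS : ∀ n, IsSigma (H.app n) (piDer (fun _ : Fin n => A.toGrMod) (-1) fun _ => t) (S.app n))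
    (p q : ℕ) :
    (G.pertG H S).app (p + q) = jx ((G.pertG H S).app p) ((G.pertG H S).app q) := by
  have hp := hc.perturb_linear ht p (hS p)
  have hq := hc.perturb_linear ht q (hS q)
  symm
  have hG := (G.pertG H S).app_mem
  have key : H.app (p + q) ∘ₗ jx ((G.pertG H S).app p) ((G.pertG H S).app q) = 0 := by
    refine pseudo_comp_eq_zero (a := jx (H.app p) LinearMap.id)
      (b := jx ((pi fun _ : Fin p => A.toGrMod).sg 1) (H.app q))
      (s := jx (piDer (fun _ : Fin p => A.toGrMod) (-1) fun _ => t) LinearMap.id)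
      (r := jx ((pi fun _ : Fin p => A.toGrMod).sg 1)
        (piDer (fun _ : Fin q => A.toGrMod) (-1) fun _ => t)) ?_ ?_ ?_ ?_ ?_ ?_ ?_ ?_
    · rw [← ThickMap.diff_eq, eq_neg_iff_add_eq_zero, ← neg_eq_iff_add_eq_zero,
        (hc.h_pseudo p q).2, ThickMap.prod_eq, jx_comp, LinearMap.id_comp]
    · rw [jx_comp, jx_comp, H_anti, jx_neg_left]; rfl
    · rw [jx_comp, jx_comp, t_anti ht, jx_neg_left, neg_neg]; rfl
    · rw [jx_comp, jx_comp, H_anti, jx_neg_left]; rfl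
    · rw [jx_comp, (hc.contraction q).h_h, jx_zero_right]
    · rw [jx_comp, hc.H_comp_pertG, jx_zero_left]
    · rw [jx_comp, hc.H_comp_pertG, jx_zero_right]
    · rw [← jx_id, jx_comp, jx_comp, LinearMap.id_comp, ← jx_sub_left, sg_one_comp_sg_one,
        ← jx_sub_right, jx_comp, jx_comp, LinearMap.id_comp]
      have h1 := (hS p).one_sub_comp (G.app p)
      have h2 := (hS q).one_sub_comp (G.app q)
      refine Eq.trans ?_ (hc.contraction (p + q)).h_g
      rw [hc.g_morphism.jx]
      exact congrArg₂ (fun x y => H.app (p + q) ∘ₗ jx x y) h1 h2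
  refine (hc.perturb_linear ht (p + q) (hS (p + q))).eq_g
    (d'' := jx ((piDer (fun _ : Fin p => B.toGrMod) (-1) fun _ => B.d) + (F.pertT G S).app p)
        LinearMap.id +
      jx ((pi fun _ : Fin p => B.toGrMod).sg (-1))
        ((piDer (fun _ : Fin q => B.toGrMod) (-1) fun _ => B.d) + (F.pertT G S).app q)) ?_ ?_ ?_
  · rw [piDer_eq_jx, LinearMap.add_comp, LinearMap.comp_add, jx_comp, jx_comp, jx_comp, jx_comp,
      hp.g_d, hq.g_d, sg_comp_of_zero (hG p)]
    rfl
  -- The multiplicativity of F' is needed here: it reduces F'_{p+q} (G'_p ⊗ G'_q) = 1 to F' G' = 1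
  -- in arities p and q.
  · rw [hc.pertF_jx ht hS, jx_comp, hp.f_g, hq.f_g, jx_id]
  · change (H.app (p + q) + H.app (p + q) ∘ₗ S.app (p + q) ∘ₗ H.app (p + q)) ∘ₗ _ = _
    rw [LinearMap.add_comp, LinearMap.comp_assoc, LinearMap.comp_assoc, key]
    simp

/-- F'_{p+q} intertwines d + T_{p+q} both with d + T'_{p+q} and with the differential built from
arities p and q. Composing with the right inverse G'_{p+q} identifies the two, and the unperturbed
parts cancel. -/
theorem pertT_jx (hc : IsThickContraction A B F G H) (ht : IsPerturbation A t)
    (hS : ∀ n, IsSigma (H.app n) (piDer (fun _ : Fin n => A.toGrMod) (-1) fun _ => t) (S.app n))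
    (p q : ℕ) :
    (F.pertT G S).app (p + q) = jx ((F.pertT G S).app p) LinearMap.id +
      jx ((pi fun _ : Fin p => B.toGrMod).sg (-1)) ((F.pertT G S).app q) := by
  have hp := hc.perturb_linear ht p (hS p)
  have hq := hc.perturb_linear ht q (hS q)
  have hpq := hc.perturb_linear ht (p + q) (hS (p + q))
  have hF := (F.pertF H S).app_mem
  have h1 : ((piDer (fun _ : Fin (p + q) => B.toGrMod) (-1) fun _ => B.d) +
      (F.pertT G S).app (p + q)) ∘ₗ (F.pertF H S).app (p + q) =
      (jx ((piDer (fun _ : Fin p => B.toGrMod) (-1) fun _ => B.d) + (F.pertT G S).app p)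
        LinearMap.id +
      jx ((pi fun _ : Fin p => B.toGrMod).sg (-1))
        ((piDer (fun _ : Fin q => B.toGrMod) (-1) fun _ => B.d) + (F.pertT G S).app q)) ∘ₗ
        (F.pertF H S).app (p + q) := by
    rw [hpq.f_d, hc.pertF_jx ht hS, piDer_eq_jx, LinearMap.add_comp, LinearMap.comp_add, jx_comp,
      jx_comp, jx_comp, jx_comp, hp.f_d, hq.f_d, sg_comp_of_zero (hF p)]
    rfl
  have h2 := congrArg (fun x => x ∘ₗ (G.pertG H S).app (p + q)) h1
  simp only [LinearMap.comp_assoc, hpq.f_g, LinearMap.comp_id] at h2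
  rw [piDer_eq_jx, jx_add_left, jx_add_right] at h2
  rw [← sub_eq_zero] at h2 ⊢
  rw [← h2]
  abel

/-- T_0 is an empty sum, so arity 0 is not perturbed. -/
theorem sigma_app_zero
    (hS : IsSigma (H.app 0) (piDer (fun _ : Fin 0 => A.toGrMod) (-1) fun _ => t) (S.app 0)) :
    S.app 0 = 0 := by
  have h0 : piDer (fun _ : Fin 0 => A.toGrMod) (-1) (fun _ => t) = 0 := Fin.sum_univ_zero _
  have := hS.left
  rwa [h0, LinearMap.comp_zero, LinearMap.comp_zero, add_zero] at this

theorem pertF_isMorphism (hc : IsThickContraction A B F G H) (ht : IsPerturbation A t)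
    (hS : ∀ n, IsSigma (H.app n) (piDer (fun _ : Fin n => A.toGrMod) (-1) fun _ => t) (S.app n)) :
    (F.pertF H S).IsMorphism := by
  refine ThickMap.isMorphism_of_jx ?_ (hc.pertF_jx ht hS)
  change F.app 0 + F.app 0 ∘ₗ S.app 0 ∘ₗ H.app 0 = _
  rw [sigma_app_zero (hS 0), hc.f_morphism 0]
  refine PiTensorProduct.ext (MultilinearMap.ext fun x => ?_)
  simp only [LinearMap.compMultilinearMap_apply, LinearMap.zero_comp, LinearMap.comp_zero, add_zero]
  rw [PiTensorProduct.map_tprod, PiTensorProduct.map_tprod]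
  exact congrArg _ (Subsingleton.elim _ _)

theorem pertG_isMorphism (hc : IsThickContraction A B F G H) (ht : IsPerturbation A t)
    (hS : ∀ n, IsSigma (H.app n) (piDer (fun _ : Fin n => A.toGrMod) (-1) fun _ => t) (S.app n)) :
    (G.pertG H S).IsMorphism := by
  refine ThickMap.isMorphism_of_jx ?_ (hc.pertG_jx ht hS)
  change G.app 0 + H.app 0 ∘ₗ S.app 0 ∘ₗ G.app 0 = _
  rw [sigma_app_zero (hS 0), hc.g_morphism 0]
  refine PiTensorProduct.ext (MultilinearMap.ext fun x => ?_)
  simp only [LinearMap.compMultilinearMap_apply, LinearMap.zero_comp, LinearMap.comp_zero, add_zero]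
  rw [PiTensorProduct.map_tprod, PiTensorProduct.map_tprod]
  exact congrArg _ (Subsingleton.elim _ _)

/-- With this, d + T'_n becomes the differential of the n-th tensor power of B with differential d +
t'. -/
theorem pertT_app (hc : IsThickContraction A B F G H) (ht : IsPerturbation A t)
    (hS : ∀ n, IsSigma (H.app n) (piDer (fun _ : Fin n => A.toGrMod) (-1) fun _ => t) (S.app n))
    (n : ℕ) :
    (F.pertT G S).app n = piDer (fun _ : Fin n => B.toGrMod) (-1) fun _ => (F.pertT G S).one := by
  refine ThickMap.app_eq_piDer_of_jx ?_ (hc.pertT_jx ht hS) n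
  change F.app 0 ∘ₗ S.app 0 ∘ₗ G.app 0 = 0
  rw [sigma_app_zero (hS 0), LinearMap.zero_comp, LinearMap.comp_zero]

/-- In every arity H' = H (1 - T H)⁻¹ = (1 - H T)⁻¹ H, and T_{p+q} is the sum of the extensions of
T_p and T_q. The claim is then an identity in the endomorphism ring of A^{⊗(p+q)}. -/
theorem pertH_pseudo (hc : IsThickContraction A B F G H) (ht : IsPerturbation A t)
    (hS : ∀ n, IsSigma (H.app n) (piDer (fun _ : Fin n => A.toGrMod) (-1) fun _ => t) (S.app n)) :
    (H.pertH S).IsPseudoDerivation := by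
  intro p q
  let a := jx (H.app p) (LinearMap.id (R := k) (M := (pi fun _ : Fin q => A.toGrMod).carrier))
  let b := jx ((pi fun _ : Fin p => A.toGrMod).sg 1) (H.app q)
  let a' := jx ((H.pertH S).app p)
    (LinearMap.id (R := k) (M := (pi fun _ : Fin q => A.toGrMod).carrier))
  let b' := jx ((pi fun _ : Fin p => A.toGrMod).sg 1) ((H.pertH S).app q)
  let s := jx (piDer (fun _ : Fin p => A.toGrMod) (-1) fun _ => t)
    (LinearMap.id (R := k) (M := (pi fun _ : Fin q => A.toGrMod).carrier))
  let r := jx ((pi fun _ : Fin p => A.toGrMod).sg 1)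
    (piDer (fun _ : Fin q => A.toGrMod) (-1) fun _ => t)
  have hba : b ∘ₗ a = -(a ∘ₗ b) := by
    simp only [a, b]; rw [jx_comp, jx_comp, H_anti, jx_neg_left]; rfl
  have hsb : s ∘ₗ b = -(b ∘ₗ s) := by
    simp only [s, b]; rw [jx_comp, jx_comp, t_anti ht, jx_neg_left, neg_neg]; rfl
  have hra : r ∘ₗ a = -(a ∘ₗ r) := by
    simp only [r, a]; rw [jx_comp, jx_comp, H_anti, jx_neg_left]; rfl
  have hsr : s + r = piDer (fun _ : Fin (p + q) => A.toGrMod) (-1) fun _ => t := by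
    rw [piDer_eq_jx, sg_neg_one]
  have hab : a ∘ₗ b = H.prod p q := by
    simp only [a, b]; rw [jx_comp, ThickMap.prod_eq, LinearMap.id_comp]
  have hab' : a' ∘ₗ b' = (H.pertH S).prod p q := by
    simp only [a', b']; rw [jx_comp, ThickMap.prod_eq, LinearMap.id_comp]
  have has : LinearMap.id - a ∘ₗ s = jx (LinearMap.id - H.app p ∘ₗ
      piDer (fun _ : Fin p => A.toGrMod) (-1) fun _ => t) LinearMap.id := by
    simp only [a, s]; rw [jx_comp, LinearMap.id_comp, ← jx_id, ← jx_sub_left]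
  have hsa : LinearMap.id - s ∘ₗ a = jx (LinearMap.id -
      piDer (fun _ : Fin p => A.toGrMod) (-1) (fun _ => t) ∘ₗ H.app p) LinearMap.id := by
    simp only [a, s]; rw [jx_comp, LinearMap.id_comp, ← jx_id, ← jx_sub_left]
  have hbr0 : b ∘ₗ r = jx LinearMap.id
      (H.app q ∘ₗ piDer (fun _ : Fin q => A.toGrMod) (-1) fun _ => t) := by
    simp only [b, r]; rw [jx_comp, sg_one_comp_sg_one]
  have hrb0 : r ∘ₗ b = jx LinearMap.id
      (piDer (fun _ : Fin q => A.toGrMod) (-1) (fun _ => t) ∘ₗ H.app q) := by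
    simp only [b, r]; rw [jx_comp, sg_one_comp_sg_one]
  have hbr : LinearMap.id - b ∘ₗ r = jx LinearMap.id (LinearMap.id - H.app q ∘ₗ
      piDer (fun _ : Fin q => A.toGrMod) (-1) fun _ => t) := by
    rw [hbr0, ← jx_id, ← jx_sub_right]
  have hrb : LinearMap.id - r ∘ₗ b = jx LinearMap.id (LinearMap.id -
      piDer (fun _ : Fin q => A.toGrMod) (-1) (fun _ => t) ∘ₗ H.app q) := by
    rw [hrb0, ← jx_id, ← jx_sub_right]
  -- In b r and r b the two signs square to 1, so these operators have the form 1 ⊗ y with no sign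
  -- and commute strictly with everything of the form x ⊗ 1.
  have hcomm : ∀ (x : pi (fun _ : Fin p => A.toGrMod) →ₗ[k] pi (fun _ : Fin p => A.toGrMod))
      (y : pi (fun _ : Fin q => A.toGrMod) →ₗ[k] pi (fun _ : Fin q => A.toGrMod)),
      jx x LinearMap.id ∘ₗ jx LinearMap.id y = jx LinearMap.id y ∘ₗ jx x LinearMap.id :=
    fun x y => by rw [jx_comp, jx_comp]; rfl
  have hS' := hS (p + q)
  rw [← hsr] at hS'
  have key1 : (a' - b') ∘ₗ (H.pertH S).app (p + q) = a' ∘ₗ b' := by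
    refine perturb_diff_mul (R := Module.End k (pi fun _ : Fin (p + q) => A.toGrMod).carrier)
      (a := a) (b := b) (s := s) (r := r) (H := H.app (p + q)) ?_ hba hra hsb ?_ ?_ ?_ ?_ ?_ ?_ ?_
      hS'.isUnit_one_sub_t_h
    · exact (congrArg (· ∘ₗ H.app (p + q)) (H.diff_eq p q).symm).trans
        ((hc.h_pseudo p q).1.trans hab.symm)
    · change (LinearMap.id - a ∘ₗ s) ∘ₗ a' = a
      rw [has, jx_comp]
      exact congrArg₂ (fun x y => jx x y) ((hS p).one_sub_comp (H.app p)) rfl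
    · change (LinearMap.id - b ∘ₗ r) ∘ₗ b' = b
      rw [hbr, jx_comp]
      exact congrArg₂ (fun x y => jx x y) rfl ((hS q).one_sub_comp (H.app q))
    · exact hS'.comp_one_sub (H.app (p + q))
    · change (a ∘ₗ s) ∘ₗ (b ∘ₗ r) = (b ∘ₗ r) ∘ₗ (a ∘ₗ s)
      rw [hbr0]
      simp only [a, s]
      rw [jx_comp _ _ _ LinearMap.id, LinearMap.id_comp, hcomm]
    · change (b ∘ₗ r) ∘ₗ a' = a' ∘ₗ (b ∘ₗ r)
      rw [hbr0, hcomm]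
    · change IsUnit (LinearMap.id - a ∘ₗ s)
      rw [has]
      exact isUnit_jx (hS p).isUnit_one_sub_h_t isUnit_one
    · change IsUnit (LinearMap.id - b ∘ₗ r)
      rw [hbr]
      exact isUnit_jx isUnit_one (hS q).isUnit_one_sub_h_t
  have key2 : (H.pertH S).app (p + q) ∘ₗ (a' - b') = -(a' ∘ₗ b') := by
    refine perturb_mul_diff (R := Module.End k (pi fun _ : Fin (p + q) => A.toGrMod).carrier)
      (a := a) (b := b) (s := s) (r := r) (H := H.app (p + q)) ?_ hba hra hsb ?_ ?_ ?_ ?_ ?_ ?_ ?_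
      hS'.isUnit_one_sub_h_t
    · rw [eq_neg_iff_add_eq_zero, ← neg_eq_iff_add_eq_zero]
      exact (congrArg (fun x => -(H.app (p + q) ∘ₗ x)) (H.diff_eq p q).symm).trans
        ((hc.h_pseudo p q).2.trans hab.symm)
    · change a' ∘ₗ (LinearMap.id - s ∘ₗ a) = a
      rw [hsa, jx_comp]
      exact congrArg₂ (fun x y => jx x y) ((hS p).comp_one_sub (H.app p)) rfl
    · change b' ∘ₗ (LinearMap.id - r ∘ₗ b) = b
      rw [hrb, jx_comp]
      exact congrArg₂ (fun x y => jx x y) rfl ((hS q).comp_one_sub (H.app q))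
    · exact hS'.one_sub_comp (H.app (p + q))
    · change (s ∘ₗ a) ∘ₗ (r ∘ₗ b) = (r ∘ₗ b) ∘ₗ (s ∘ₗ a)
      rw [hrb0]
      simp only [a, s]
      rw [jx_comp _ _ _ LinearMap.id, LinearMap.id_comp, hcomm]
    · change (r ∘ₗ b) ∘ₗ a' = a' ∘ₗ (r ∘ₗ b)
      rw [hrb0, hcomm]
    · change IsUnit (LinearMap.id - s ∘ₗ a)
      rw [hsa]
      exact isUnit_jx (hS p).isUnit_one_sub_t_h isUnit_one
    · change IsUnit (LinearMap.id - r ∘ₗ b)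
      rw [hrb]
      exact isUnit_jx isUnit_one (hS q).isUnit_one_sub_t_h
  constructor
  · rw [ThickMap.diff_eq, ← hab']
    exact key1
  · rw [ThickMap.diff_eq, ← hab', ← neg_eq_iff_eq_neg.2 key2]

/-- The perturbation lemma for thick contractions of chain complexes. -/
theorem perturb (hc : IsThickContraction A B F G H) (ht : IsPerturbation A t)
    (hS : ∀ n, IsSigma (H.app n) (piDer (fun _ : Fin n => A.toGrMod) (-1) fun _ => t) (S.app n))
    (ht' : IsPerturbation B (F.pertT G S).one) :
    IsThickContraction (A.perturb t ht) (B.perturb (F.pertT G S).one ht') (F.pertF H S)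
      (G.pertG H S) (H.pertH S) where
  contraction n := by
    have h := hc.perturb_linear ht n (hS n)
    -- The target operator is now recognised as the derivation extending d + t', that is, as the
    -- differential of a tensor power of the perturbed complex.
    rw [hc.pertT_app ht hS,
      ← piDer_add (fun _ : Fin n => B.toGrMod) (-1) (fun _ => B.d) (fun _ => _)] at h
    exact ⟨(F.pertF H S).app_mem n, (G.pertG H S).app_mem n, (H.pertH S).app_mem n, h.f_d, h.g_d,
      h.h_d, h.f_g, h.f_h, h.h_h, h.h_g⟩
  f_morphism := hc.pertF_isMorphism ht hS
  g_morphism := hc.pertG_isMorphism ht hS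
  h_pseudo := hc.pertH_pseudo ht hS

end IsThickContraction

end Thick

/-! ### Filtrations and local nilpotence -/

section Nilpotent

variable {k : Type*} [CommRing k] {M : Type*} [AddCommGroup M] [Module k M] {N : Module.End k M}

/-- A vector killed by 1 - N is fixed by all powers of N, hence zero; the geometric series, finite
on each vector, gives preimages. No uniform bound on the order of nilpotency is needed. -/
theorem isUnit_one_sub_of_locally_nilpotent (h : ∀ x, ∃ n, (N ^ n) x = 0) : IsUnit (1 - N) := by
  rw [Module.End.isUnit_iff]
  refine ⟨(injective_iff_map_eq_zero _).2 fun x hx => ?_, fun x => ?_⟩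
  · obtain ⟨n, hn⟩ := h x
    have h1 : N x = x := (sub_eq_zero.1 hx).symm
    have h2 : ∀ n, (N ^ n) x = x := fun n => by
      induction n with
      | zero => simp
      | succ n ih => rw [pow_succ, Module.End.mul_apply, h1, ih]
    rw [← h2 n, hn]
  · obtain ⟨n, hn⟩ := h x
    refine ⟨(∑ m ∈ Finset.range n, N ^ m) x, ?_⟩
    rw [← Module.End.mul_apply, mul_neg_geom_sum, LinearMap.sub_apply, hn, sub_zero]
    rfl

theorem inverse_one_sub_apply (h : IsUnit (1 - N)) {x : M} {n : ℕ} (hn : (N ^ n) x = 0) :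
    Ring.inverse (1 - N) x = ∑ m ∈ Finset.range n, (N ^ m) x := by
  have h1 : (1 - N) ((∑ m ∈ Finset.range n, N ^ m) x) = x := by
    rw [← Module.End.mul_apply, mul_neg_geom_sum, LinearMap.sub_apply, hn, sub_zero]
    rfl
  rw [← LinearMap.sum_apply]
  nth_rewrite 1 [← h1]
  rw [← Module.End.mul_apply, Ring.inverse_mul_cancel _ h]
  rfl

variable {W : ℤ → Submodule k M}

theorem pow_mem_filtration (hN : ∀ p, ∀ x ∈ W p, N x ∈ W (p - 1)) (n : ℕ) {p : ℤ} {x : M}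
    (hx : x ∈ W p) : (N ^ n) x ∈ W (p - n) := by
  induction n with
  | zero => simpa using hx
  | succ n ih =>
    rw [pow_succ', Module.End.mul_apply, Nat.cast_succ, ← sub_sub]
    exact hN _ _ ih

/-- Each application of N lowers the level by one, so p - p₀ + 1 applications take level p below p₀.
The levels only need to span and need not be nested, which covers the tensor power of arity 0. -/
theorem locally_nilpotent_of_filtration (hN : ∀ p, ∀ x ∈ W p, N x ∈ W (p - 1)) {p₀ : ℤ}
    (hb : ∀ p < p₀, W p = ⊥) (he : ⨆ p, W p = ⊤) (x : M) : ∃ n, (N ^ n) x = 0 := by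
  have hx : x ∈ ⨆ p, W p := he ▸ Submodule.mem_top
  induction hx using Submodule.iSup_induction' with
  | mem p x hx =>
    refine ⟨(p - p₀ + 1).toNat, ?_⟩
    have h1 := pow_mem_filtration hN (p - p₀ + 1).toNat hx
    rwa [hb _ (by omega), Submodule.mem_bot] at h1
  | zero => exact ⟨0, map_zero _⟩
  | add x y _ _ hx hy =>
    obtain ⟨m, hm⟩ := hx
    obtain ⟨n, hn⟩ := hy
    refine ⟨m + n, ?_⟩
    rw [map_add, pow_add, Module.End.mul_apply, Module.End.mul_apply, hn, map_zero, add_zero,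
      ← Module.End.mul_apply, ← pow_add, add_comm, pow_add, Module.End.mul_apply, hm, map_zero]

/-- The inverse is a finite geometric sum on each vector. With P a homogeneous component this gives
the degree of the resolvent; with P a filtration level it gives preservation of the filtration. -/
theorem inverse_one_sub_mem (h : ∀ x, ∃ n, (N ^ n) x = 0) {P : Submodule k M} {x : M}
    (hx : ∀ n, (N ^ n) x ∈ P) : Ring.inverse (1 - N) x ∈ P := by
  obtain ⟨n, hn⟩ := h x
  rw [inverse_one_sub_apply (isUnit_one_sub_of_locally_nilpotent h) hn]
  exact sum_mem fun m _ => hx m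

end Nilpotent

/-! ### Induced filtrations on tensor powers -/

section TensorFiltration

variable {k : Type u} [CommRing k] {A : Cx k} {FA : ℤ → Submodule k A.carrier}

/-- A rescaling is a combination of the homogeneous components. For filtrations by graded submodules
this shows that Koszul signs do no harm. -/
theorem GrMod.scale_mem (A : GrMod k) {P : Submodule k A.carrier} {a : A}
    (h : ∀ i, A.proj i a ∈ P) (c : ℤ → ℤ) : A.scale c a ∈ P := by
  have h1 : ∀ i, A.proj i a = A.coact a i := fun i => by
    refine LinearMap.congr_fun (f := A.proj i) (g := Finsupp.lapply i ∘ₗ A.coact)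
      (A.lin_ext fun j b hb => ?_) a
    rw [proj, A.scale_of_mem _ hb, LinearMap.comp_apply, A.coact_of_mem hb, Finsupp.lapply_apply,
      Finsupp.single_apply]
    split_ifs <;> simp
  rw [← A.coact_sum a, Finsupp.lsum_apply, Finsupp.sum, map_sum]
  refine sum_mem fun i _ => ?_
  rw [LinearMap.id_apply, A.scale_of_mem c (A.coact_mem a i), ← h1]
  exact zsmul_mem (h i) _

theorem IsComplexFiltration.sg_mem (hF : IsComplexFiltration A FA) {p : ℤ} {a : A.toGrMod}
    (ha : a ∈ FA p) (e : ℤ) : A.sg e a ∈ FA p :=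
  A.scale_mem (hF.graded p a ha) _

/-- The surplus p' - p is added to the index of the first factor. In arity 0 there is no factor to
absorb it: level 0 is everything and all other levels vanish. -/
theorem tensorFiltration_mono (hF : IsComplexFiltration A FA) {n : ℕ} (hn : n ≠ 0) :
    Monotone (tensorFiltration FA n) := by
  intro p p' hp
  refine Submodule.span_le.2 ?_
  rintro _ ⟨i, x, hx, rfl, rfl⟩
  let j₀ : Fin n := ⟨0, Nat.pos_of_ne_zero hn⟩
  refine Submodule.subset_span ⟨fun j => i j + if j = j₀ then p' - ∑ j, i j else 0, x,
    fun j => hF.mono ?_ (hx j), ?_, rfl⟩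
  · change i j ≤ i j + ite _ _ _
    split_ifs <;> linarith
  · simp [Finset.sum_add_distrib]

/-- If F_q = 0, indices with sum below n (q + 1) include one that is at most q, so the corresponding
factor is zero. All p < p₀ are covered explicitly, since monotonicity fails in arity 0. -/
theorem tensorFiltration_bounded (hF : IsComplexFiltration A FA) (n : ℕ) :
    ∃ p₀, ∀ p < p₀, tensorFiltration FA n p = ⊥ := by
  obtain ⟨q, hq⟩ := hF.bounded
  refine ⟨∑ _j : Fin n, (q + 1), fun p hp => ?_⟩
  rw [tensorFiltration, Submodule.span_eq_bot]
  rintro _ ⟨i, x, hx, rfl, rfl⟩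
  obtain ⟨j, -, hj⟩ := Finset.exists_lt_of_sum_lt hp
  refine (PiTensorProduct.tprod k).map_coord_zero j ?_
  have := hF.mono (Int.lt_add_one_iff.1 hj) (hx j)
  rwa [hq, Submodule.mem_bot] at this

theorem tensorFiltration_exhaustive (hF : IsComplexFiltration A FA) (n : ℕ) :
    ⨆ p, tensorFiltration FA n p = ⊤ := by
  rw [eq_top_iff, ← PiTensorProduct.span_tprod_eq_top, Submodule.span_le]
  rintro _ ⟨x, rfl⟩
  choose i hi using fun j => hF.exhaustive (x j)
  exact Submodule.mem_iSup_of_mem (∑ j, i j) (Submodule.subset_span ⟨i, x, hi, rfl, rfl⟩)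

/-- Each summand lowers the index of its active factor by one and changes the others at most by a
sign operator. -/
theorem piDer_mem_tensorFiltration (hF : IsComplexFiltration A FA) {t : A.toGrMod →ₗ[k] A.toGrMod}
    (ht : ∀ p, ∀ a ∈ FA p, t a ∈ FA (p - 1)) (n : ℕ) (p : ℤ)
    (x : (GrMod.pi fun _ : Fin n => A.toGrMod).carrier) (hx : x ∈ tensorFiltration FA n p) :
    GrMod.piDer (fun _ : Fin n => A.toGrMod) (-1) (fun _ => t) x ∈
      tensorFiltration FA n (p - 1) := by
  induction hx using Submodule.span_induction with
  | zero => rw [map_zero]; exact zero_mem _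
  | add x y _ _ hx hy => rw [map_add]; exact add_mem hx hy
  | smul c x _ hx => rw [map_smul]; exact Submodule.smul_mem _ _ hx
  | mem x hx =>
    obtain ⟨i, x, hx, rfl, rfl⟩ := hx
    rw [GrMod.piDer, LinearMap.sum_apply]
    refine sum_mem fun l _ => ?_
    rw [PiTensorProduct.map_tprod]
    refine Submodule.subset_span ⟨fun j => i j + if j = l then -1 else 0, _, fun j => ?_, ?_, rfl⟩
    · change _ ∈ FA (i j + ite _ _ _)
      rcases lt_trichotomy j l with h | h | h
      · rw [if_pos h, if_neg h.ne, add_zero]; exact hF.sg_mem (hx j) _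
      · subst h; simpa [sub_eq_add_neg] using ht _ _ (hx j)
      · rw [if_neg h.not_gt, if_neg h.ne', if_neg h.ne', add_zero]; exact hx j
    · simp [Finset.sum_add_distrib, sub_eq_add_neg]

end TensorFiltration

/-! ### Coalgebra structures under a change of differential -/

section Coalgebra

variable {k : Type u} [CommRing k]

theorem ThickMap.one_mem {A B : GrMod k} {e : ℤ} (F : ThickMap A B e) : HasDegree A B e F.one := by
  intro i a ha
  have h1 : PiTensorProduct.tprod k (fun _ : Fin 1 => a) ∈ (GrMod.pi fun _ : Fin 1 => A).gr i :=
    GrMod.tprod_mem (deg := fun _ => i) (fun _ => ha) (by simp)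
  have h2 := F.app_mem 1 i _ h1
  rw [F.app_one_tprod] at h2
  have h3 : ∀ m, ∀ z ∈ (GrMod.pi fun _ : Fin 1 => B).gr m,
      PiTensorProduct.subsingletonEquiv (R := k) (s := fun _ : Fin 1 => B.carrier) 0 z ∈ B.gr m := by
    intro m z hz
    induction hz using Submodule.span_induction with
    | zero => rw [map_zero]; exact zero_mem _
    | add x y _ _ hx hy => rw [map_add]; exact add_mem hx hy
    | smul c x _ hx => rw [map_smul]; exact Submodule.smul_mem _ _ hx
    | mem z hz =>
      obtain ⟨deg, x, hx, rfl, rfl⟩ := hz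
      rw [PiTensorProduct.subsingletonEquiv_apply_tprod]
      simpa using hx 0
  have h4 := h3 _ _ h2
  rwa [PiTensorProduct.subsingletonEquiv_apply_tprod] at h4

theorem IsCoderivation.isThick {C : Cooperad k} {A : GrMod k}
    {Δ : A →ₗ[k] SymSeq.schurG C.toSymSeq A} {t : A →ₗ[k] A} (ht : IsCoderivation C A Δ t) :
    IsThickCoalgebraMap C Δ Δ (ThickMap.der t ht.degree) :=
  ⟨ThickMap.der_symm t ht.degree, by rw [ThickMap.one_der]; exact ht.comm⟩

theorem Cx.tensor_perturb_d (X A : Cx k) {t : A.toGrMod →ₗ[k] A.toGrMod}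
    (ht : IsPerturbation A t) (n : ℕ) :
    (Cx.tensor X (Cx.pi fun _ : Fin n => A.perturb t ht)).d =
      (Cx.tensor X (Cx.pi fun _ : Fin n => A)).d +
      GrMod.tmap (A := X.toGrMod) (A' := X.toGrMod) (B := GrMod.pi fun _ : Fin n => A.toGrMod)
        (B' := GrMod.pi fun _ : Fin n => A.toGrMod) LinearMap.id (-1)
        ((ThickMap.der t ht.degree).app n) := by
  have h : (Cx.pi fun _ : Fin n => A.perturb t ht).d = 
    (Cx.pi fun _ : Fin n => A).d + (ThickMap.der t ht.degree).app n :=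
   GrMod.piDer_add (fun _ : Fin n => A.toGrMod) (-1) (fun _ => A.d) fun _ => t
  change _ + GrMod.tmap _ _ _ = (_ + GrMod.tmap _ _ _) + _
  rw [h, add_assoc]
  refine congrArg _ ?_
  exact TensorProduct.map_add_right _ _ _

/-- The differential of `O[A]`. -/
def SymSeq.schurD (O : SymSeq k) (A : Cx k) :
    SymSeq.schurG O A.toGrMod →ₗ[k] SymSeq.schurG O A.toGrMod := (SymSeq.schur O A).d

theorem SymSeq.schurD_inj (O : SymSeq k) (A : Cx k) (n : ℕ)
    (x : (O.obj n).carrier ⊗[k] (GrMod.pi fun _ : Fin n => A.toGrMod).carrier) :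
    SymSeq.schurD O A (GrMod.inj (fun n : ℕ => SymSeq.schurLevel O A.toGrMod n) n
      (GrMod.coinvMk _ _ (SymSeq.schur_mem O A.toGrMod n) x)) =
    GrMod.inj (fun n : ℕ => SymSeq.schurLevel O A.toGrMod n) n
      (GrMod.coinvMk _ _ (SymSeq.schur_mem O A.toGrMod n)
        ((Cx.tensor (O.obj n) (Cx.pi fun _ : Fin n => A)).d x)) := by
  change GrMod.dmap _ _ = _
  rw [GrMod.dmap_inj]
  rfl

/-- The differential of A enters that of O[A] only through its derivation extensions, and these are
additive in it. -/
theorem SymSeq.schurD_perturb (O : SymSeq k) (A : Cx k) {t : A.toGrMod →ₗ[k] A.toGrMod}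
    (ht : IsPerturbation A t) :
    SymSeq.schurD O (A.perturb t ht) = SymSeq.schurD O A +
      ThickMap.schurMap O (ThickMap.der t ht.degree) (ThickMap.der_symm t ht.degree) := by
  refine ThickMap.schur_ext (A := A.toGrMod) O fun n x => ?_
  rw [LinearMap.add_apply, ThickMap.schurMap_inj, SymSeq.schurD_inj O A, ← map_add, ← map_add]
  refine (SymSeq.schurD_inj O (A.perturb t ht) n x).trans ?_
  have h := LinearMap.congr_fun (Cx.tensor_perturb_d (O.obj n) A ht n) x
  exact congrArg (fun y => GrMod.inj (fun n : ℕ => SymSeq.schurLevel O A.toGrMod n) n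
      (GrMod.coinvMk _ _ (SymSeq.schur_mem O A.toGrMod n) y)) h

/-- The axioms of a coalgebra over a cooperad that do not involve differentials. -/
structure IsGradedCoalgebra (C : Cooperad k) (A : GrMod k)
    (Δ : A →ₗ[k] SymSeq.schurG C.toSymSeq A) : Prop where
  degree : HasDegree A (SymSeq.schurG C.toSymSeq A) 0 Δ
  coassoc : ∀ a, (SymSeq.schurHom C.Δ A (Δ a),
    ThickMap.schurMap C.toSymSeq (ThickMap.tpow Δ degree) (ThickMap.tpow_symm Δ degree) (Δ a)) ∈
      SymSeq.schurAssocGraph C.toSymSeq C.toSymSeq A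
  counit : ∀ a, (SymSeq.schurHom C.ε A (Δ a), a) ∈ SymSeq.schurUnitGraph A

theorem isCoalgebra_iff {C : Cooperad k} {A : Cx k}
    {Δ : A.toGrMod →ₗ[k] SymSeq.schurG C.toSymSeq A.toGrMod} :
    IsCoalgebra C A Δ ↔ IsGradedCoalgebra C A.toGrMod Δ ∧
      SymSeq.schurD C.toSymSeq A ∘ₗ Δ = Δ ∘ₗ A.d :=
  ⟨fun h => ⟨⟨h.degree, h.coassoc, h.counit⟩,
    LinearMap.ext fun x => LinearMap.congr_fun h.chain x⟩,
    fun h => ⟨h.1.degree, LinearMap.ext fun x => LinearMap.congr_fun h.2 x, h.1.coassoc,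
      h.1.counit⟩⟩

/-- Coassociativity and counit do not see the differential. The condition that Δ be a chain map
changes by exactly the coderivation equation for t. -/
theorem IsCoalgebra.perturb {C : Cooperad k} {A : Cx k}
    {Δ : A.toGrMod →ₗ[k] SymSeq.schurG C.toSymSeq A.toGrMod} (hA : IsCoalgebra C A Δ)
    {t : A.toGrMod →ₗ[k] A.toGrMod} (ht : IsPerturbation A t)
    (hcoder : IsCoderivation C A.toGrMod Δ t) : IsCoalgebra C (A.perturb t ht) Δ := by
  obtain ⟨h1, h2⟩ := isCoalgebra_iff.1 hA
  have h3 : SymSeq.schurD C.toSymSeq (A.perturb t ht) ∘ₗ Δ = Δ ∘ₗ (A.d + t) := by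
    rw [SymSeq.schurD_perturb, LinearMap.comp_add, LinearMap.add_comp, hcoder.comm, ← h2]
  exact isCoalgebra_iff.2 ⟨h1, h3⟩
end Coalgebra

/-! ### The perturbation lemma for coalgebras -/

namespace ThickMap

variable {k : Type u} [CommRing k] {A : GrMod k}

/-- The thick map `(1 - H t)⁻¹`. -/
def resolvent (H : ThickMap A A 1) (t : A →ₗ[k] A) (ht : HasDegree A A (-1) t)
    (hn : ∀ n x, ∃ m : ℕ, ((H.app n ∘ₗ (der t ht).app n :
      Module.End k (GrMod.pi fun _ : Fin n => A).carrier) ^ m) x = 0) : ThickMap A A 0 where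
  app n := Ring.inverse (1 - H.app n ∘ₗ (der t ht).app n :
    Module.End k (GrMod.pi fun _ : Fin n => A).carrier)
  app_mem n i a ha := by
    refine inverse_one_sub_mem (hn n) fun m => ?_
    rw [add_zero]
    induction m with
    | zero => exact ha
    | succ m ih =>
      rw [pow_succ', Module.End.mul_apply]
      have := H.app_mem n _ _ ((der t ht).app_mem n _ _ ih)
      rwa [neg_add_cancel_right] at this

variable {H : ThickMap A A 1} {t : A →ₗ[k] A} {ht : HasDegree A A (-1) t}
  {hn : ∀ n x, ∃ m : ℕ, ((H.app n ∘ₗ (der t ht).app n :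
      Module.End k (GrMod.pi fun _ : Fin n => A).carrier) ^ m) x = 0}

theorem resolvent_comp (n : ℕ) :
    (H.resolvent t ht hn).app n ∘ₗ (LinearMap.id - H.app n ∘ₗ (der t ht).app n) = LinearMap.id :=
  Ring.inverse_mul_cancel _ (isUnit_one_sub_of_locally_nilpotent (hn n))

theorem comp_resolvent (n : ℕ) :
    (LinearMap.id - H.app n ∘ₗ (der t ht).app n) ∘ₗ (H.resolvent t ht hn).app n = LinearMap.id :=
  Ring.mul_inverse_cancel _ (isUnit_one_sub_of_locally_nilpotent (hn n))

theorem one_eq_id {U : ThickMap A A 0} (h : U.app 1 = LinearMap.id) : U.one = LinearMap.id := by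
  ext x
  simp [one, h]

/-- Passing to first components respects sums and compositions, so the arity 1 case of
`resolvent_comp` becomes a statement about 1 - h t on A itself. -/
theorem resolvent_one_comp :
    (H.resolvent t ht hn).one ∘ₗ (LinearMap.id - H.one ∘ₗ t) = LinearMap.id := by
  have h1 : HasDegree A A 0 (LinearMap.id : A →ₗ[k] A) := fun i a ha => by rwa [add_zero]
  have h2 := one_eq_id (U := (H.resolvent t ht hn).comp
    ((tpow LinearMap.id h1).sub (H.comp (der t ht) (neg_add_cancel 1))) (add_zero 0)) (by
      refine Eq.trans ?_ (resolvent_comp (hn := hn) 1)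
      exact congrArg (fun x => (H.resolvent t ht hn).app 1 ∘ₗ
        (x - H.app 1 ∘ₗ (der t ht).app 1)) PiTensorProduct.map_id)
  rwa [one_comp, one_sub, one_tpow, one_comp, one_der] at h2

/-- The thick map `t (1 - H t)⁻¹`. -/
def sigma (H : ThickMap A A 1) (t : A →ₗ[k] A) (ht : HasDegree A A (-1) t)
    (hn : ∀ n x, ∃ m : ℕ, ((H.app n ∘ₗ (der t ht).app n :
      Module.End k (GrMod.pi fun _ : Fin n => A).carrier) ^ m) x = 0) : ThickMap A A (-1) :=
  (der t ht).comp (H.resolvent t ht hn) (zero_add _)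

theorem sigma_isSigma (n : ℕ) :
    IsSigma (H.app n) (GrMod.piDer (fun _ : Fin n => A) (-1) fun _ => t)
      ((H.sigma t ht hn).app n) :=
  IsSigma.of_inverse (resolvent_comp n) (comp_resolvent n)

end ThickMap

section Coalgebra

variable {k : Type u} [CommRing k]

/-- Here 1 - H T is a difference of thick coalgebra maps, so its inverse is one, and so is the
composite with T. -/
theorem IsThickCoalgebraMap.sigma {C : Cooperad k} {A : GrMod k}
    {Δ : A →ₗ[k] SymSeq.schurG C.toSymSeq A} {H : ThickMap A A 1} {t : A →ₗ[k] A}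
    (hH : IsThickCoalgebraMap C Δ Δ H) (ht : IsCoderivation C A Δ t)
    (hn : ∀ n x, ∃ m : ℕ, ((H.app n ∘ₗ (ThickMap.der t ht.degree).app n :
      Module.End k (GrMod.pi fun _ : Fin n => A).carrier) ^ m) x = 0) :
    IsThickCoalgebraMap C Δ Δ (H.sigma t ht.degree hn) := by
  have h1 : HasDegree A A 0 (LinearMap.id : A →ₗ[k] A) := fun i a ha => by rwa [add_zero]
  have e : ∀ n, (ThickMap.tpow LinearMap.id h1).app n = LinearMap.id :=
    fun n => PiTensorProduct.map_id
  refine ht.isThick.comp (IsThickCoalgebraMap.inverse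
    (P := (ThickMap.tpow LinearMap.id h1).sub (H.comp (ThickMap.der t ht.degree)
      (neg_add_cancel 1))) ((IsThickCoalgebraMap.id h1).sub (hH.comp ht.isThick _))
      (fun n => ?_) fun n => ?_) _
  · refine Eq.trans ?_ (ThickMap.comp_resolvent (hn := hn) n)
    exact congrArg (fun x => (x - H.app n ∘ₗ (ThickMap.der t ht.degree).app n) ∘ₗ
      (H.resolvent t ht.degree hn).app n) (e n)
  · refine Eq.trans ?_ (ThickMap.resolvent_comp (hn := hn) n)
    exact congrArg (fun x => (H.resolvent t ht.degree hn).app n ∘ₗ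
      (x - H.app n ∘ₗ (ThickMap.der t ht.degree).app n)) (e n)

theorem Preserves.comp {M N L : Type u} [AddCommGroup M] [Module k M] [AddCommGroup N] [Module k N]
    [AddCommGroup L] [Module k L] {F : ℤ → Submodule k M} {G : ℤ → Submodule k N}
    {E : ℤ → Submodule k L} {g : N →ₗ[k] L} {f : M →ₗ[k] N} (hg : Preserves G E g)
    (hf : Preserves F G f) : Preserves F E (g ∘ₗ f) :=
  fun p a ha => hg p _ (hf p a ha)

theorem Preserves.add {M N : Type u} [AddCommGroup M] [Module k M] [AddCommGroup N] [Module k N]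
    {F : ℤ → Submodule k M} {G : ℤ → Submodule k N} {g f : M →ₗ[k] N} (hg : Preserves F G g)
    (hf : Preserves F G f) : Preserves F G (g + f) :=
  fun p a ha => add_mem (hg p a ha) (hf p a ha)

theorem Preserves.inverse_one_sub {M : Type u} [AddCommGroup M] [Module k M]
    {W : ℤ → Submodule k M} (hW : Monotone W) {N : Module.End k M}
    (hN : ∀ p, ∀ x ∈ W p, N x ∈ W (p - 1)) (hn : ∀ x, ∃ n, (N ^ n) x = 0) :
    Preserves W W (Ring.inverse (1 - N) : Module.End k M) :=
  fun p a ha => inverse_one_sub_mem hn fun m => hW (by omega) (pow_mem_filtration hN m ha)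

namespace ThickMap

variable {A B : GrMod k}

theorem one_pertF (F : ThickMap A B 0) (H : ThickMap A A 1) (S : ThickMap A A (-1)) :
    (F.pertF H S).one = F.one + F.one ∘ₗ S.one ∘ₗ H.one := by
  rw [pertF, one_add, one_comp, one_comp]

theorem one_pertG (G : ThickMap B A 0) (H : ThickMap A A 1) (S : ThickMap A A (-1)) :
    (G.pertG H S).one = G.one + H.one ∘ₗ S.one ∘ₗ G.one := by
  rw [pertG, one_add, one_comp, one_comp]

theorem one_pertH (H : ThickMap A A 1) (S : ThickMap A A (-1)) :
    (H.pertH S).one = H.one + H.one ∘ₗ S.one ∘ₗ H.one := by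
  rw [pertH, one_add, one_comp, one_comp]

theorem one_pertT (F : ThickMap A B 0) (G : ThickMap B A 0) (S : ThickMap A A (-1)) :
    (F.pertT G S).one = F.one ∘ₗ S.one ∘ₗ G.one := by
  rw [pertT, one_comp, one_comp]

end ThickMap

/-- C[F] depends only on the components of F. When these are the tensor powers of F₁, the equation
for a thick coalgebra map is the one for a morphism. -/
theorem IsThickCoalgebraMap.isCoalgebraHom {C : Cooperad k} {A B : Cx k}
    {ΔA : A.toGrMod →ₗ[k] SymSeq.schurG C.toSymSeq A.toGrMod}
    {ΔB : B.toGrMod →ₗ[k] SymSeq.schurG C.toSymSeq B.toGrMod}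
    {F : ThickMap A.toGrMod B.toGrMod 0} (hF : IsThickCoalgebraMap C ΔA ΔB F)
    (hm : F.IsMorphism) (hd : B.d ∘ₗ F.one = F.one ∘ₗ A.d) :
    IsCoalgebraHom C A B ΔA ΔB F.one := by
  obtain ⟨sF, hF⟩ := hF
  refine ⟨F.one_mem, hd, ?_⟩
  rw [hF, ThickMap.schurMap_congr C.toSymSeq sF (ThickMap.tpow_symm F.one F.one_mem) hm]

theorem IsThickCoalgebraMap.isCoderivation {C : Cooperad k} {A : GrMod k}
    {Δ : A →ₗ[k] SymSeq.schurG C.toSymSeq A} {T : ThickMap A A (-1)}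
    (hT : IsThickCoalgebraMap C Δ Δ T)
    (hm : ∀ n, T.app n = GrMod.piDer (fun _ : Fin n => A) (-1) fun _ => T.one) :
    IsCoderivation C A Δ T.one := by
  obtain ⟨sT, hT⟩ := hT
  refine ⟨T.one_mem, ?_⟩
  rw [hT, ThickMap.schurMap_congr C.toSymSeq sT (ThickMap.der_symm T.one T.one_mem) hm]

theorem IsPerturbation.maurer_cartan {A : Cx k} {t : A.toGrMod →ₗ[k] A.toGrMod}
    (ht : IsPerturbation A t) : A.d ∘ₗ t + t ∘ₗ A.d + t ∘ₗ t = 0 := by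
  have h := ht.sq
  rw [LinearMap.comp_add, LinearMap.add_comp, LinearMap.add_comp, A.d_d, zero_add] at h
  rw [← h]; abel

theorem IsComplexFiltration.perturb {A : Cx k} {FA : ℤ → Submodule k A.carrier}
    (hF : IsComplexFiltration A FA) {t : A.toGrMod →ₗ[k] A.toGrMod} (ht : IsPerturbation A t)
    (h : Preserves FA FA t) : IsComplexFiltration (A.perturb t ht) FA :=
  ⟨hF.mono, hF.graded, fun p a ha => add_mem (hF.d_mem p a ha) (h p a ha), hF.exhaustive,
    hF.bounded⟩

theorem IsComplexFiltration.locally_nilpotent {A : Cx k} {FA : ℤ → Submodule k A.carrier}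
    (hF : IsComplexFiltration A FA) {N : Module.End k A.carrier}
    (hN : ∀ p, ∀ a ∈ FA p, N a ∈ FA (p - 1)) (a : A.carrier) : ∃ n, (N ^ n) a = 0 := by
  obtain ⟨q, hq⟩ := hF.bounded
  refine locally_nilpotent_of_filtration hN (p₀ := q) (fun p hp => ?_) ?_ a
  · rw [eq_bot_iff, ← hq]; exact hF.mono hp.le
  · refine eq_top_iff.2 fun x _ => ?_
    obtain ⟨p, hp⟩ := hF.exhaustive x
    exact Submodule.mem_iSup_of_mem p hp

theorem ThickMap.locally_nilpotent {A : Cx k} {FA : ℤ → Submodule k A.carrier}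
    (hF : IsComplexFiltration A FA) {t : A.toGrMod →ₗ[k] A.toGrMod}
    (ht : HasDegree A.toGrMod A.toGrMod (-1) t)
    (hlower : ∀ p, ∀ a ∈ FA p, t a ∈ FA (p - 1)) {H : ThickMap A.toGrMod A.toGrMod 1}
    (hH : ∀ n, Preserves (tensorFiltration FA n) (tensorFiltration FA n) (H.app n)) (n : ℕ)
    (x : (GrMod.pi fun _ : Fin n => A.toGrMod).carrier) :
    ∃ m : ℕ, ((H.app n ∘ₗ (ThickMap.der t ht).app n :
      Module.End k (GrMod.pi fun _ : Fin n => A.toGrMod).carrier) ^ m) x = 0 := by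
  obtain ⟨p₀, hp₀⟩ := tensorFiltration_bounded hF n
  exact locally_nilpotent_of_filtration
    (fun p a ha => hH n (p - 1) ((ThickMap.der t ht).app n a)
      (piDer_mem_tensorFiltration hF hlower n p a ha)) hp₀
    (tensorFiltration_exhaustive hF n) x

theorem ThickMap.sigma_preserves {A : Cx k} {FA : ℤ → Submodule k A.carrier}
    (hF : IsComplexFiltration A FA) {t : A.toGrMod →ₗ[k] A.toGrMod}
    (ht : HasDegree A.toGrMod A.toGrMod (-1) t)
    (hlower : ∀ p, ∀ a ∈ FA p, t a ∈ FA (p - 1)) {H : ThickMap A.toGrMod A.toGrMod 1}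
    (hH : ∀ n, Preserves (tensorFiltration FA n) (tensorFiltration FA n) (H.app n)) (n : ℕ) :
    Preserves (tensorFiltration FA n) (tensorFiltration FA n)
      ((H.sigma t ht (ThickMap.locally_nilpotent hF ht hlower hH)).app n) := by
  -- Arity 0 is separate because its filtration is not monotone; there S vanishes.
  rcases eq_or_ne n 0 with rfl | hn
  · intro p a ha
    rw [IsThickContraction.sigma_app_zero (ThickMap.sigma_isSigma 0)]
    exact zero_mem _
  · refine Preserves.comp (G := tensorFiltration FA n) (fun p a ha => ?_)
      (Preserves.inverse_one_sub (tensorFiltration_mono hF hn)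
        (fun p a ha => hH n (p - 1) ((ThickMap.der t ht).app n a)
          (piDer_mem_tensorFiltration hF hlower n p a ha))
        (ThickMap.locally_nilpotent hF ht hlower hH n))
    exact tensorFiltration_mono hF hn (by omega) (piDer_mem_tensorFiltration hF hlower n p a ha)

end Coalgebra

end

/-! ### Assembly of the theorem -/

theorem mainTheorem8 {k : Type u} [CommRing k] (C : Cooperad k) (A B : Cx k)
    (ΔA : A.toGrMod →ₗ[k] SymSeq.schurG C.toSymSeq A.toGrMod)
    (ΔB : B.toGrMod →ₗ[k] SymSeq.schurG C.toSymSeq B.toGrMod)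
    (FA : ℤ → Submodule k A.carrier) (FB : ℤ → Submodule k B.carrier)
    (f : A.toGrMod →ₗ[k] B.toGrMod) (g : B.toGrMod →ₗ[k] A.toGrMod)
    (h : A.toGrMod →ₗ[k] A.toGrMod)
    (hD : IsFilteredCoalgebraContraction C A B ΔA ΔB FA FB f g h)
    (t : A.toGrMod →ₗ[k] A.toGrMod) (ht : IsPerturbation A t)
    (hcoder : IsCoderivation C A.toGrMod ΔA t)
    (hlower : ∀ p, ∀ a ∈ FA p, t a ∈ FA (p - 1)) :
    IsUnit (1 - h * t : Module.End k A.carrier) ∧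
    (∀ a : A.carrier, ∃ N : ℕ, ∀ n ≥ N, pertSigma h t a =
      ∑ m ∈ Finset.range n, (t * (h * t) ^ m : Module.End k A.carrier) a) ∧
    ∃ ht' : IsPerturbation B (pertT f g h t),
      IsFilteredCoalgebraContraction C (A.perturb t ht) (B.perturb (pertT f g h t) ht')
        ΔA ΔB FA FB (pertF f h t) (pertG g h t) (pertH h t) ∧
      IsCoalgebraHom C (A.perturb t ht) (B.perturb (pertT f g h t) ht') ΔA ΔB (pertF f h t) ∧
      IsCoalgebraHom C (B.perturb (pertT f g h t) ht') (A.perturb t ht) ΔB ΔA (pertG g h t) ∧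
      IsCoderivation C B.toGrMod ΔB (pertT f g h t) := by
  obtain ⟨hc, hFA, hFB, hfp, hgp, hhp, F, G, H, rfl, rfl, rfl, hT, hP⟩ := hD
  have hlow : ∀ p, ∀ a ∈ FA p, (H.one * t : Module.End k A.carrier) a ∈ FA (p - 1) :=
    fun p a ha => hhp _ _ (hlower p a ha)
  have hnil := hFA.locally_nilpotent hlow
  have hunit : IsUnit (1 - H.one * t : Module.End k A.carrier) :=
    isUnit_one_sub_of_locally_nilpotent hnil
  refine ⟨hunit, fun a => ?_, ?_⟩
  · obtain ⟨N, hN⟩ := hnil a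
    -- N is the order of nilpotency of h t at a; beyond it the partial sums are constant.
    refine ⟨N, fun n hn => ?_⟩
    have h0 : ((H.one * t : Module.End k A.carrier) ^ n) a = 0 := by
      rw [← Nat.sub_add_cancel hn, pow_add, Module.End.mul_apply, hN, map_zero]
    change t (Ring.inverse (1 - H.one * t : Module.End k A.carrier) a) = _
    rw [inverse_one_sub_apply hunit h0, map_sum]
    rfl
  have hHp := fun n => (hP n).2.2
  have hn := ThickMap.locally_nilpotent hFA ht.degree hlower hHp
  let S : ThickMap A.toGrMod A.toGrMod (-1) := H.sigma t ht.degree hn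
  have hS : ∀ n, IsSigma (H.app n) (GrMod.piDer (fun _ : Fin n => A.toGrMod) (-1) fun _ => t)
      (S.app n) := fun n => ThickMap.sigma_isSigma n
  -- A left inverse of the unit 1 - h t is its inverse, so the first component of the thick
  -- resolvent is the resolvent of the statement.
  have hU : (H.resolvent t ht.degree hn).one =
      Ring.inverse (1 - H.one * t : Module.End k A.carrier) := by
    have h1 : ((H.resolvent t ht.degree hn).one : Module.End k A.carrier) *
        (1 - H.one * t : Module.End k A.carrier) = 1 := ThickMap.resolvent_one_comp
    have h2 := congrArg (· * Ring.inverse (1 - H.one * t : Module.End k A.carrier)) h1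
    simpa only [mul_assoc, Ring.mul_inverse_cancel _ hunit, mul_one, one_mul] using h2
  have hS1 : S.one = pertSigma H.one t := by
    change (ThickMap.comp _ _ _).one = _
    rw [ThickMap.one_comp, ThickMap.one_der, hU]
    rfl
  have hSp : ∀ n, Preserves (tensorFiltration FA n) (tensorFiltration FA n) (S.app n) :=
    ThickMap.sigma_preserves hFA ht.degree hlower hHp
  have hsig : IsSigma H.one t S.one := by
    rw [hS1]
    exact IsSigma.of_inverse (Ring.inverse_mul_cancel _ hunit) (Ring.mul_inverse_cancel _ hunit)
  have hS1p : Preserves FA FA S.one := by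
    rw [hS1]
    exact Preserves.comp (G := FA) (fun p a ha => hFA.mono (by omega) (hlower p a ha))
      (Preserves.inverse_one_sub hFA.mono hlow hnil)
  have eF : pertF F.one H.one t = (F.pertF H S).one := by rw [ThickMap.one_pertF, hS1]; rfl
  have eG : pertG G.one H.one t = (G.pertG H S).one := by rw [ThickMap.one_pertG, hS1]; rfl
  have eH : pertH H.one t = (H.pertH S).one := by rw [ThickMap.one_pertH, hS1]; rfl
  have eT : pertT F.one G.one H.one t = (F.pertT G S).one := by rw [ThickMap.one_pertT, hS1]; rfl
  -- The maps of the statement are the first components of the perturbed thick maps. They are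
  -- exchanged all at once, because the perturbed complex B depends on the proof that t' is a
  -- perturbation.
  suffices key : ∃ ht' : IsPerturbation B (F.pertT G S).one,
      IsFilteredCoalgebraContraction C (A.perturb t ht) (B.perturb (F.pertT G S).one ht')
        ΔA ΔB FA FB (F.pertF H S).one (G.pertG H S).one (H.pertH S).one ∧
      IsCoalgebraHom C (A.perturb t ht) (B.perturb (F.pertT G S).one ht') ΔA ΔB
        (F.pertF H S).one ∧
      IsCoalgebraHom C (B.perturb (F.pertT G S).one ht') (A.perturb t ht) ΔB ΔA
        (G.pertG H S).one ∧
      IsCoderivation C B.toGrMod ΔB (F.pertT G S).one by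
    rw [← eF, ← eG, ← eH, ← eT] at key
    exact key
  have ht' : IsPerturbation B (F.pertT G S).one := ⟨ThickMap.one_mem _, by
    rw [ThickMap.one_pertT]
    exact hc.linear.perturb_sq B.d_d ht.maurer_cartan hsig.left hsig.right⟩
  have hthick : IsThickContraction A B F G H :=
    ⟨hT.contraction, hT.f_morphism, hT.g_morphism, hT.h_pseudo⟩
  have hthick' := hthick.perturb ht hS ht'
  -- Compatibility with Δ now passes from H and t to S, and from there to F', G', H' and T', by the
  -- closure properties alone.
  have hST : IsThickCoalgebraMap C ΔA ΔA S := hT.h_thick.sigma hcoder hn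
  have hF' : IsThickCoalgebraMap C ΔA ΔB (F.pertF H S) :=
    hT.f_thick.add (hT.f_thick.comp (hST.comp hT.h_thick _) _)
  have hG' : IsThickCoalgebraMap C ΔB ΔA (G.pertG H S) :=
    hT.g_thick.add (hT.h_thick.comp (hST.comp hT.g_thick _) _)
  have hH' : IsThickCoalgebraMap C ΔA ΔA (H.pertH S) :=
    hT.h_thick.add (hT.h_thick.comp (hST.comp hT.h_thick _) _)
  have hT' : IsThickCoalgebraMap C ΔB ΔB (F.pertT G S) :=
    hT.f_thick.comp (hST.comp hT.g_thick _) _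
  -- T' is a thick coalgebra map whose components are the derivation extensions of t', which is the
  -- definition of a coderivation. It is also needed to make B a coalgebra for the new differential.
  have hcoder' : IsCoderivation C B.toGrMod ΔB (F.pertT G S).one :=
    hT'.isCoderivation (hthick.pertT_app ht hS)
  have hlin := hc.linear.perturb ht.maurer_cartan hsig.left hsig.right
  rw [← ThickMap.one_pertT, ← ThickMap.one_pertF, ← ThickMap.one_pertG,
    ← ThickMap.one_pertH] at hlin
  have hc' : IsContraction (A.perturb t ht) (B.perturb (F.pertT G S).one ht')
      (F.pertF H S).one (G.pertG H S).one (H.pertH S).one :=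
    ⟨ThickMap.one_mem _, ThickMap.one_mem _, ThickMap.one_mem _, hlin.f_d, hlin.g_d, hlin.h_d,
      hlin.f_g, hlin.f_h, hlin.h_h, hlin.h_g⟩
  refine ⟨ht', ⟨hc', ?_, ?_, ?_, ?_, ?_, F.pertF H S, G.pertG H S, H.pertH S, rfl, rfl, rfl,
    ⟨hthick'.contraction, hthick'.f_morphism, hthick'.g_morphism, hthick'.h_pseudo,
      hT.coalgebra_A.perturb ht hcoder, hT.coalgebra_B.perturb ht' hcoder', hF', hG', hH'⟩,
    fun n => ⟨?_, ?_, ?_⟩⟩, ?_, ?_, hcoder'⟩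
  · exact hFA.perturb ht fun p a ha => hFA.mono (by omega) (hlower p a ha)
  · refine hFB.perturb ht' ?_
    rw [ThickMap.one_pertT]
    exact hfp.comp (hS1p.comp hgp)
  · rw [ThickMap.one_pertF]; exact hfp.add (hfp.comp (hS1p.comp hhp))
  · rw [ThickMap.one_pertG]; exact hgp.add (hhp.comp (hS1p.comp hgp))
  · rw [ThickMap.one_pertH]; exact hhp.add (hhp.comp (hS1p.comp hhp))
  · exact (hP n).1.add ((hP n).1.comp ((hSp n).comp (hP n).2.2))
  · exact (hP n).2.1.add ((hP n).2.2.comp ((hSp n).comp (hP n).2.1))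
  · exact (hP n).2.2.add ((hP n).2.2.comp ((hSp n).comp (hP n).2.2))
  · exact hF'.isCoalgebraHom (A := A.perturb t ht) (B := B.perturb (F.pertT G S).one ht')
      hthick'.f_morphism hc'.f_d
  · exact hG'.isCoalgebraHom (A := B.perturb (F.pertT G S).one ht') (B := A.perturb t ht)
      hthick'.g_morphism hc'.g_d
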